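/- Let $n\ge 2$, let $T_n(\mathbb C)=\mathbb C^{n(n+1)/2}$ be the space of tableaux $v=(v_{ki})_{1\le i\le k\le n}$, and let $T_{n-1}(\mathbb Z)$ be the group of integral tableaux $z=(z_{ki})_{1\le i\le k\le n}$ with $z_{n1}=\dots=z_{nn}=0$. The group $G=S_n\times\cdots\times S_1$ acts on tableaux by $\sigma(w)_{ki}=w_{k,\sigma[k]^{-1}(i)}$. Let $\Sigma=\{1,\dots,t\}$ and let $(k_r,i_r,j_r)$, $r\in\Sigma$, satisfy $2\le k_r\le n-1$ and $1\le i_r<j_r\le k_r$, with $\{i_r,j_r\}\cap\{i_s,j_s\}=\emptyset$ whenever $r\ne s$ and $k_r=k_s$. Let $v\in T_n(\mathbb C)$ satisfy $v_{k_ri_r}=v_{k_rj_r}$ for all $r$, and $v_{ki}-v_{kj}\notin\mathbb Z$ for all other triples $(k,i,j)$ with $k\le n-1$ and $i<j\le k$ (so $v$ is $t$-singular of index $2$). Let $\tau_r\in G$ interchange $i_r$ and $j_r$ in row $k_r$. Subsets $I\subseteq R=(\{(i_1,j_1)\},\dots,\{(i_t,j_t)\})$ are identified with subsets of $\Sigma$.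 Derivative tableaux. $V(T(v))$ is the complex vector space generated by symbols $\mathcal D_IT(v+z)$ ($I\subseteq R$, $z\in T_{n-1}(\mathbb Z)$) subject to $\mathcal D_IT(v+\tau_r(z))=\mathcal D_IT(v+z)$ if $r\notin I$ and $\mathcal D_IT(v+\tau_r(z))=-\mathcal D_IT(v+z)$ if $r\in I$. Generic module. Let $K=\mathbb C(x_{ki}\mid 1\le i\le k\le n)$ and let $\mathcal V$ be the $K$-vector space with basis $T(x+z)$, $z\in T_{n-1}(\mathbb Z)$. Let $\Phi_{rs}\subset G$ be the set of $\sigma$ such that $\sigma[k]\in\{(1,i)\mid 1\le i\le k\}$ (with $(1,1)=\mathrm{Id}$) for $\min(r,s)\le k\le \max(r,s)-1$ and $\sigma[k]=\mathrm{Id}$ otherwise. Let $\delta^{k1}$ be the tableau with entry $1$ at position $(k,1)$ and $0$ elsewhere; put $\varepsilon_{rs}=\sum_{k=r}^{s-1}\delta^{k1}$ for $r<s$, $\varepsilon_{rr}=0$, $\varepsilon_{sr}=-\varepsilon_{rs}$. Let $$e_{rs}(w)=\begin{cases}-\dfrac{\prod_{j=1}^{s}(w_{s-1,1}-w_{sj})}{\prod_{j=2}^{s-1}(w_{s-1,1}-w_{s-1,j})}\displaystyle\prod_{j=r}^{s-2}\dfrac{\prod_{p=2}^{j+1}(w_{j1}-w_{j+1,p})}{\prod_{p=2}^{j}(w_{j1}-w_{jp})},&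 r<s,\\[2ex] \dfrac{\prod_{j=1}^{s-1}(w_{s1}-w_{s-1,j})}{\prod_{j=2}^{s}(w_{s1}-w_{sj})}\displaystyle\prod_{j=s+2}^{r}\dfrac{\prod_{p=2}^{j-2}(w_{j-1,1}-w_{j-2,p})}{\prod_{p=2}^{j-1}(w_{j-1,1}-w_{j-1,p})},& r>s,\\[2ex] r-1+\sum_{i=1}^{r}w_{ri}-\sum_{i=1}^{r-1}w_{r-1,i},& r=s.\end{cases}$$ Operators. Call $f\in K$ smooth if it is regular at $v$, and $F\in\mathcal V$ smooth if all its coefficients are. For $I\subseteq R$ and smooth $f$ let $\mathcal D^v_I(f)$ be the value at $v$ of $\prod_{r\in I}\frac12\left(\frac{\partial}{\partial x_{k_ri_r}}-\frac{\partial}{\partial x_{k_rj_r}}\right)f$. On smooth vectors of $\mathcal V$, with values in $V(T(v))$, let $\mathcal D_I^v$ be the additive map with $\mathcal D^v_I(fT(x+z))=\sum_{J\subseteq I}\mathcal D^v_{I\setminus J}(f)\,\mathcal D_JT(v+z)$. For $\Delta\subseteq\Sigma$ put $P_\Delta(x)=\prod_{r\in\Delta}(x_{k_ri_r}-x_{k_rj_r})$.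 Gelfand–Tsetlin subalgebra. Let $U=U(\mathfrak{gl}(n))$ and let $\Gamma\subseteq U$ be the subalgebra generated by the centers of $U(\mathfrak{gl}(m))$, $1\le m\le n$, where $\mathfrak{gl}(m)$ is spanned by the $E_{ij}$ with $i,j\le m$. Let $c_{mk}=\sum_{(i_1,\dots,i_k)\in\{1,\dots,m\}^k}E_{i_1i_2}E_{i_2i_3}\cdots E_{i_ki_1}$ and $\gamma_{mk}(w)=\sum_{i=1}^m(w_{mi}+m-1)^k\prod_{j\ne i}\left(1-\frac1{w_{mi}-w_{mj}}\right)$. Theorem. The formulas $$E_{rs}T(x+z)=\sum_{\sigma\in\Phi_{rs}}e_{rs}(\sigma(x+z))\,T(x+z+\sigma(\varepsilon_{rs}))$$ define a $K$-linear $\mathfrak{gl}(n)$-module structure on $\mathcal V$. The formulas $$g\cdot\mathcal D_IT(v+z)=\mathcal D^v_R\big(P_{\Sigma\setminus I}(x)\,gT(x+z)\big),\qquad g\in\mathfrak{gl}(n),$$ for all $I,z$ such that $z_{k_ri_r}\ne z_{k_rj_r}$ for every $r\in I$ (for the other $I,z$ one has $\mathcal D_IT(v+z)=0$), define a $\mathfrak{gl}(n)$-module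 structure on $V(T(v))$, the vectors $P_{\Sigma\setminus I}(x)\,gT(x+z)$ being smooth for these $I,z$. For these module structures: (1) ($\Gamma$ is $\mathcal D^v$-invariant.) For every $c\in\Gamma$, every $I\subseteq R$ and every $z\in T_{n-1}(\mathbb Z)$, the vector $cT(x+z)$ is smooth and $c\,\mathcal D_IT(v+z)=\mathcal D^v_I\big(cT(x+z)\big)$. (2) For all $1\le j\le i\le n$, $I\subseteq R$ and $z\in T_{n-1}(\mathbb Z)$, the function $\gamma_{ij}(x+z)$ is smooth and $$c_{ij}\,\mathcal D_IT(v+z)=\sum_{J\subseteq I}\mathcal D^v_J\big(\gamma_{ij}(x+z)\big)\,\mathcal D_{I\setminus J}T(v+z).$$ (3) For the same $i,j,I,z$, $\big(c_{ij}-\gamma_{ij}(v+z)\big)^{|I|+1}\mathcal D_IT(v+z)=0$, where $\gamma_{ij}(v+z)$ is the value at $x=v$ of the function $\gamma_{ij}(x+z)$. -/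

import Mathlib

/- Associative algebras carry the commutator bracket (not a global instance in Mathlib). -/
attribute [local instance 100] LieRing.ofAssociativeRing

noncomputable section

namespace GT

/-! ### Tableaux, row permutations, integral shifts -/

/-- Positions of a Gelfand–Tsetlin tableau with `n` rows. Rows and entries are counted from zero:
the pair `⟨k, i⟩` is the `(i+1)`-st entry of the row `k+1`, which has `k+1` entries. The top row
is the row `n`. -/
abbrev Idx (n : ℕ) : Type := Σ k : Fin n, Fin (k.val + 1)

/-- `T_n(A)`: tableaux with entries in `A`. -/
abbrev Tab (n : ℕ) (A : Type) : Type := Idx n → A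

/-- `T_{n-1}(ℤ)`: integral tableaux whose top row vanishes. -/
def shiftLattice (n : ℕ) : AddSubgroup (Tab n ℤ) where
  carrier := {z | ∀ p : Idx n, p.1.val + 1 = n → z p = 0}
  zero_mem' := fun _ _ => rfl
  add_mem' := by
    intro a b ha hb p hp
    simp [ha p hp, hb p hp]
  neg_mem' := by
    intro a ha p hp
    simp [ha p hp]

abbrev Shift (n : ℕ) : Type := shiftLattice n

/-- `G = S_n × ⋯ × S_1`. -/
abbrev RowPerm (n : ℕ) : Type := ∀ k : Fin n, Equiv.Perm (Fin (k.val + 1))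

/-- The action `σ(w)_{k,i} = w_{k, σ[k]⁻¹(i)}`. -/
def permTab {n : ℕ} {A : Type} (σ : RowPerm n) (w : Tab n A) : Tab n A :=
  fun p => w ⟨p.1, (σ p.1).symm p.2⟩

/-- The restriction of the `G`-action to `T_{n-1}(ℤ)`. -/
def permShift {n : ℕ} (σ : RowPerm n) (z : Shift n) : Shift n :=
  ⟨permTab σ z.1, fun p hp => z.2 ⟨p.1, (σ p.1).symm p.2⟩ hp⟩

/-- `Φ_{rs}`: the `σ ∈ G` such that `σ[k]` is a transposition `(1,i)`, `1 ≤ i ≤ k` (with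
`(1,1) = id`), for `min(r,s) ≤ k ≤ max(r,s) - 1`, and `σ[k] = id` for the other rows. -/
def Phi {n : ℕ} (r s : Fin n) : Finset (RowPerm n) :=
  open Classical in
  Finset.univ.filter fun σ => ∀ k : Fin n,
    (min r s ≤ k ∧ k < max r s → ∃ i : Fin (k.val + 1), σ k = Equiv.swap 0 i) ∧
    (¬ (min r s ≤ k ∧ k < max r s) → σ k = 1)

/-- `ε_{rs} = δ^{r,1} + ⋯ + δ^{s-1,1}` for `r < s`, `ε_{rr} = 0`, `ε_{sr} = -ε_{rs}`. -/
def eps {n : ℕ} (r s : Fin n) : Shift n :=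
  ⟨fun p => if p.2.val = 0 then
      (if r ≤ p.1 ∧ p.1 < s then 1 else if s ≤ p.1 ∧ p.1 < r then -1 else 0) else 0, by
    intro p hp
    have h1 : ¬ (p.1 < s) := fun h => by
      have := s.isLt
      have : p.1.val < s.val := h
      omega
    have h2 : ¬ (p.1 < r) := fun h => by
      have := r.isLt
      have : p.1.val < r.val := h
      omega
    simp [h1, h2]⟩

/-! ### The rational functions `e_{rs}` and `γ_{mk}` -/

/-- The entry `w_{k,i}` with rows and entries counted from one (zero outside `1 ≤ i ≤ k ≤ n`,
a value that never enters the formulas below). -/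
def ent {n : ℕ} {F : Type} [Field F] (w : Tab n F) (k i : ℕ) : F :=
  if h : (1 ≤ i ∧ i ≤ k) ∧ k ≤ n then w ⟨⟨k - 1, by omega⟩, ⟨i - 1, by simp; omega⟩⟩ else 0

/-- `e_{rs}(w)`, with `1 ≤ r, s ≤ n`. -/
def eCoef {n : ℕ} {F : Type} [Field F] (r s : ℕ) (w : Tab n F) : F :=
  if r < s then
    - ((∏ j ∈ Finset.Icc 1 s, (ent w (s - 1) 1 - ent w s j)) /
        (∏ j ∈ Finset.Icc 2 (s - 1), (ent w (s - 1) 1 - ent w (s - 1) j))) *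
      ∏ j ∈ Finset.Icc r (s - 2),
        ((∏ t ∈ Finset.Icc 2 (j + 1), (ent w j 1 - ent w (j + 1) t)) /
          (∏ t ∈ Finset.Icc 2 j, (ent w j 1 - ent w j t)))
  else if s < r then
    ((∏ j ∈ Finset.Icc 1 (s - 1), (ent w s 1 - ent w (s - 1) j)) /
        (∏ j ∈ Finset.Icc 2 s, (ent w s 1 - ent w s j))) *
      ∏ j ∈ Finset.Icc (s + 2) r,
        ((∏ t ∈ Finset.Icc 2 (j - 2), (ent w (j - 1) 1 - ent w (j - 2) t)) /
          (∏ t ∈ Finset.Icc 2 (j - 1), (ent w (j - 1) 1 - ent w (j - 1) t)))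
  else
    (r : F) - 1 + ∑ i ∈ Finset.Icc 1 r, ent w r i - ∑ i ∈ Finset.Icc 1 (r - 1), ent w (r - 1) i

/-- `γ_{mk}(w) = ∑_i (w_{mi} + m - 1)^k ∏_{j ≠ i} (1 - 1 / (w_{mi} - w_{mj}))`. -/
def gamma {n : ℕ} {F : Type} [Field F] (m k : ℕ) (w : Tab n F) : F :=
  ∑ i ∈ Finset.Icc 1 m, (ent w m i + (m : F) - 1) ^ k *
    ∏ j ∈ (Finset.Icc 1 m).erase i, (1 - 1 / (ent w m i - ent w m j))

/-! ### Rational functions of the variable tableau `x` and their derivatives at `v` -/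

abbrev Poly (n : ℕ) : Type := MvPolynomial (Idx n) ℂ

/-- The field of rational functions in the variables `x_{ki}`. -/
abbrev RatFun (n : ℕ) : Type := FractionRing (Poly n)

/-- `f` is smooth (regular) at `v`. -/
def IsSmooth {n : ℕ} (v : Tab n ℂ) (f : RatFun n) : Prop :=
  ∃ p q : Poly n, MvPolynomial.eval v q ≠ 0 ∧
    f = algebraMap (Poly n) (RatFun n) p / algebraMap (Poly n) (RatFun n) q

/-- The value `f(v)`, computed from the reduced fraction of `f`; meaningful for `f` smooth at `v`. -/
def evalAt {n : ℕ} (v : Tab n ℂ) (f : RatFun n) : ℂ :=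
  MvPolynomial.eval v (IsFractionRing.num (Poly n) f) /
    MvPolynomial.eval v (IsFractionRing.den (Poly n) f : Poly n)

/-- The partial derivative `∂f/∂x_p` of a rational function, by the quotient rule. -/
def pderivRat {n : ℕ} (p : Idx n) (f : RatFun n) : RatFun n :=
  let a : Poly n := IsFractionRing.num (Poly n) f
  let b : Poly n := (IsFractionRing.den (Poly n) f : Poly n)
  algebraMap (Poly n) (RatFun n) (MvPolynomial.pderiv p a * b - a * MvPolynomial.pderiv p b) /
    algebraMap (Poly n) (RatFun n) b ^ 2

/-- The tableau `x + z` whose entries are rational functions of the variable `x`. -/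
def xTab {n : ℕ} (z : Shift n) : Tab n (RatFun n) :=
  fun p => algebraMap (Poly n) (RatFun n) (MvPolynomial.X p) + ((z.1 p : ℤ) : RatFun n)

/-! ### Singular vectors of index 2 and derivative tableaux -/

/-- Triples `(k_r, i_r, j_r)`, `r = 1, …, t`, with `k_r ≤ n - 1` and `1 ≤ i_r < j_r ≤ k_r`, such
that the pairs in a common row are disjoint. (Listing them by increasing `k_r` is not needed.) -/
structure SingularPairs (n t : ℕ) where
  row : Fin t → Fin n
  fst : ∀ r, Fin ((row r).val + 1)
  snd : ∀ r, Fin ((row r).val + 1)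
  row_lt : ∀ r, (row r).val + 1 < n
  fst_lt_snd : ∀ r, fst r < snd r
  disjoint : ∀ r s, r ≠ s →
    Disjoint ({⟨row r, fst r⟩, ⟨row r, snd r⟩} : Set (Idx n)) {⟨row s, fst s⟩, ⟨row s, snd s⟩}

namespace SingularPairs

variable {n t : ℕ} (S : SingularPairs n t)

/-- The position `(k_r, i_r)`. -/
def left (r : Fin t) : Idx n := ⟨S.row r, S.fst r⟩

/-- The position `(k_r, j_r)`. -/
def right (r : Fin t) : Idx n := ⟨S.row r, S.snd r⟩

/-- `v` is `t`-singular of index 2 with exactly the singular pairs `S` (in the rows below the top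
row), and `v_{k_r,i_r} = v_{k_r,j_r}` for all `r`. -/
def IsCritical (v : Tab n ℂ) : Prop :=
  (∀ r, v (S.left r) = v (S.right r)) ∧
  ∀ k : Fin n, k.val + 1 < n → ∀ i j : Fin (k.val + 1), i < j →
    (∀ r, ¬ (S.left r = ⟨k, i⟩ ∧ S.right r = ⟨k, j⟩)) →
    ∀ m : ℤ, v ⟨k, i⟩ - v ⟨k, j⟩ ≠ (m : ℂ)

/-- `τ_r ∈ G` interchanges `i_r` and `j_r` in the row `k_r`. -/
def tau (r : Fin t) : RowPerm n :=
  Function.update (fun _ => 1) (S.row r) (Equiv.swap (S.fst r) (S.snd r))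

/-- The relations `D_I T(v + τ_r(z)) = ± D_I T(v + z)`, with the sign `-` if and only if
`I_r ≠ ∅`. A subset `I ⊆ R = ({(i_1,j_1)}, …, {(i_t,j_t)})` is encoded by the finite set
`{r | I_r ≠ ∅}` of indices. -/
def relations : Set ((Finset (Fin t) × Shift n) →₀ ℂ) :=
  {f | ∃ (I : Finset (Fin t)) (r : Fin t) (z : Shift n),
    f = Finsupp.single (I, permShift (S.tau r) z) 1 -
      (if r ∈ I then (-1 : ℂ) else 1) • Finsupp.single (I, z) 1}

/-- The complex vector space `V(T(v))` spanned by the derivative tableaux. -/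
abbrev DSpace : Type :=
  ((Finset (Fin t) × Shift n) →₀ ℂ) ⧸ Submodule.span ℂ S.relations

/-- The derivative tableau `D_I T(v + z)`. -/
def DT (I : Finset (Fin t)) (z : Shift n) : S.DSpace :=
  Submodule.Quotient.mk (Finsupp.single (I, z) 1)

/-- `P_Δ(x) = ∏_{r ∈ Δ} (x_{k_r,i_r} - x_{k_r,j_r})`. -/
def P (Δ : Finset (Fin t)) : RatFun n :=
  ∏ r ∈ Δ, (algebraMap (Poly n) (RatFun n) (MvPolynomial.X (S.left r)) -
    algebraMap (Poly n) (RatFun n) (MvPolynomial.X (S.right r)))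

/-- `½ (∂/∂x_{k_r,i_r} - ∂/∂x_{k_r,j_r})`. -/
def dOne (r : Fin t) (f : RatFun n) : RatFun n :=
  (pderivRat (S.left r) f - pderivRat (S.right r) f) / 2

/-- `D_I(f) = D_{I_t}(⋯ D_{I_2}(D_{I_1}(f)) ⋯)`. -/
def dFun (I : Finset (Fin t)) (f : RatFun n) : RatFun n :=
  ((List.finRange t).filter (fun r => decide (r ∈ I))).foldl (fun g r => S.dOne r g) f

/-- `D_I^v(f) = D_I(f)(v)`, for `f` smooth at `v`. -/
def dVal (v : Tab n ℂ) (I : Finset (Fin t)) (f : RatFun n) : ℂ :=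
  evalAt v (S.dFun I f)

end SingularPairs

/-- The space of the universal generic module, with basis the symbols `T(x + z)`,
`z ∈ T_{n-1}(ℤ)`, over the field of rational functions of the variable tableau `x`. -/
abbrev GenSpace (n : ℕ) : Type := Shift n →₀ RatFun n

/-- `T(x + z)`. -/
def genT {n : ℕ} (z : Shift n) : GenSpace n := Finsupp.single z 1

/-- All coefficients of `F` are smooth at `v`. -/
def IsSmoothVec {n : ℕ} (v : Tab n ℂ) (F : GenSpace n) : Prop := ∀ z, IsSmooth v (F z)

/-- `D_I^v` on vectors with smooth coefficients:
`D_I^v(f T(x+z)) = ∑_{J ⊆ I} D_{I∖J}^v(f) D_J T(v+z)`. -/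
def SingularPairs.dVec {n t : ℕ} (S : SingularPairs n t) (v : Tab n ℂ) (I : Finset (Fin t))
    (F : GenSpace n) : S.DSpace :=
  F.sum fun z f => ∑ J ∈ I.powerset, S.dVal v (I \ J) f • S.DT J z

/-! ### `gl(n)`, its enveloping algebra and the Gelfand–Tsetlin subalgebra -/

abbrev gl (n : ℕ) : Type := Matrix (Fin n) (Fin n) ℂ

abbrev U (n : ℕ) : Type := UniversalEnvelopingAlgebra ℂ (gl n)

/-- The elementary matrix `E_{rs}`. -/
def E {n : ℕ} (r s : Fin n) : gl n := Matrix.single r s 1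

/-- `U_m`, the subalgebra of `U` generated by `gl(m)`. -/
def Usub (n m : ℕ) : Subalgebra ℂ (U n) :=
  Algebra.adjoin ℂ {u | ∃ i j : Fin n, i.val < m ∧ j.val < m ∧
    u = UniversalEnvelopingAlgebra.ι ℂ (E i j)}

/-- `Z_m`, the center of `U_m`. -/
def Zsub (n m : ℕ) : Subalgebra ℂ (U n) :=
  Usub n m ⊓ Subalgebra.centralizer ℂ (Usub n m : Set (U n))

/-- The Gelfand–Tsetlin subalgebra `Γ`, generated by `Z_1, …, Z_n`. -/
def GTSub (n : ℕ) : Subalgebra ℂ (U n) :=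
  Algebra.adjoin ℂ (⋃ m ∈ Finset.Icc 1 n, (Zsub n m : Set (U n)))

/-- `c_{mk} = ∑ E_{i_1 i_2} E_{i_2 i_3} ⋯ E_{i_k i_1}` over `(i_1, …, i_k) ∈ {1, …, m}^k`, as the
trace of the `k`-th power of the matrix `(E_{ij})_{i,j ≤ m}` with entries in `U`. -/
def cGen (n m k : ℕ) : U n :=
  Matrix.trace ((Matrix.of fun i j : {i : Fin n // i.val < m} =>
    (UniversalEnvelopingAlgebra.ι ℂ (E i.1 j.1) : U n)) ^ k)

/-! ### The two `gl(n)`-actions -/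

/-- `ρ` is given by `E_{rs} T(x+z) = ∑_{σ ∈ Φ_{rs}} e_{rs}(σ(x+z)) T(x+z+σ(ε_{rs}))`. -/
def IsGenericAction {n : ℕ} (ρ : gl n →ₗ⁅ℂ⁆ Module.End (RatFun n) (GenSpace n)) : Prop :=
  ∀ (r s : Fin n) (z : Shift n),
    ρ (E r s) (genT z) =
      ∑ σ ∈ Phi r s, eCoef (r.val + 1) (s.val + 1) (permTab σ (xTab z)) •
        genT (z + permShift σ (eps r s))

/-- `ρ` is given by `g · D_I T(v+z) = D_R^v(P_{Σ∖Σ_I}(x) g T(x+z))`, for all `I` and `z` such that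
`z_{k_r,i_r} ≠ z_{k_r,j_r}` whenever `I_r ≠ ∅` (otherwise `D_I T(v+z) = 0` by the defining
relations); in that case the vector to which `D_R^v` is applied has smooth coefficients. -/
def IsDerivativeAction {n t : ℕ} (S : SingularPairs n t) (v : Tab n ℂ)
    (ρgen : gl n →ₗ⁅ℂ⁆ Module.End (RatFun n) (GenSpace n))
    (ρ : gl n →ₗ⁅ℂ⁆ Module.End ℂ S.DSpace) : Prop :=
  ∀ (g : gl n) (I : Finset (Fin t)) (z : Shift n),
    (∀ r ∈ I, z.1 (S.left r) ≠ z.1 (S.right r)) →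
      IsSmoothVec v (S.P (Finset.univ \ I) • ρgen g (genT z)) ∧
      ρ g (S.DT I z) = S.dVec v Finset.univ (S.P (Finset.univ \ I) • ρgen g (genT z))

end GT

end

noncomputable section

open Polynomial Finset

namespace GT

/-! Generic module. On the free module with basis `T(x + z)` the elements `E_{k,k+1}`, `E_{k+1,k}`
and `E_{kk}` act by sums of weighted shifts (`GenericArray.opE`, `opF`, `opH`), and the
Chevalley–Serre relations of gl(n) can be checked coefficient by coefficient. The relation `[e_k,
f_k] = h_k - h_{k+1}` is a divided-difference identity (`sum_prod_sub_div_prod_sub`); the other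
relations hold term by term or in antisymmetric pairs of terms. The remaining matrix units are
iterated commutators, and `IsChevalley.isMatrixUnits` shows that they satisfy the relations of gl(n)
by adjoining one row and one column at a time. Evaluating the iterated commutators gives the sums
over `Φ_{rs}` with coefficients `e_{rs}` (`isGenericAction_genRep`).

Singular module. For a singular pair `r`, the semilinear map `flipVec r` exchanges the two entries
of the pair in `x` and in `z` at once. It commutes with gl(n), and `D_I^v` changes under it by the
sign of the defining relations of `V(T(v))` (`dVec_flipVec`). The poles of `g T(x + z)` at `v` are
at most simple and come only from pairs at which `z` is symmetric, so the product of the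
corresponding gaps removes them (`P_sym_smul_genRep_mem`). In a smooth vector that is antisymmetric
under all flips, the coefficient of `T(x + z)` is divisible by exactly this product. Hence such
vectors (`antiVec`) are stable under gl(n), and on them `D_R^v` intertwines the generic action with
the operators defined on derivative tableaux (`genRep_antiVec`). Every derivative tableau is `D_R^v`
of such a vector, since antisymmetrization commutes with the action and does not change `D_R^v`
(`exists_antisymmetrization`). The Lie algebra relations therefore pass from the generic module to
`V(T(v))`.

Gelfand–Tsetlin subalgebra. By induction on the row, a central element of `U_m` is diagonal on the
generic module: it commutes with the `c_{kj}` for `k < m`, whose eigenvalues separate the lower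
rows, and it does not move the other rows. Its eigenvalue is unchanged by integral shifts of the
lower rows, and an invariant rational function is unaffected by any admissible substitution for the
variables of these rows (`mul_subst_eq_subst_mul`). Substituting numbers with nonintegral
differences shows that the eigenvalue is smooth at `v`. Copying row `m` into the lower rows turns
`T(x)` into a highest weight vector, on which the eigenvalue of `c_{mk}` can be computed recursively
and summed to `γ_{mk}` (`act_cGen_sub_mem`, `sum_hwEigen`, `act_cGen`).

Conclusion. If `u T(x + z)` is smooth, antisymmetrizing `P_{Σ∖I} T(x + z)` gives `u D_I T(v + z) =
D_I^v(u T(x + z))` (`derAct_DT`); this applies to all of `Γ`. The formula for `c_{ij}` is then the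
Leibniz rule, and after subtracting the value of `γ_{ij}` at `v` every remaining term has a strictly
smaller index set, which gives nilpotency. -/

/-- The divided difference of a product of as many monic linear factors as there are nodes. -/
theorem sum_prod_sub_div_prod_sub {F ι κ : Type*} [Field F] [DecidableEq ι] (s : Finset ι)
    (y : ι → F) (hy : Set.InjOn y s) (u : Finset κ) (b : κ → F) (hcard : u.card = s.card)
    (hs : s.Nonempty) :
    ∑ i ∈ s, (∏ j ∈ u, (y i - b j)) / ∏ j ∈ s.erase i, (y i - y j) =
      ∑ i ∈ s, y i - ∑ j ∈ u, b j := by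
  set f : F[X] := ∏ j ∈ u, (X - C (b j)) with hf
  set g : F[X] := ∏ j ∈ s, (X - C (y j)) with hg
  have hfm : f.Monic := monic_prod_of_monic _ _ fun j _ => monic_X_sub_C _
  have hgm : g.Monic := monic_prod_of_monic _ _ fun j _ => monic_X_sub_C _
  have hfd : f.natDegree = s.card := by rw [hf, natDegree_finsetProd_X_sub_C_eq_card]; exact hcard
  have hgd : g.natDegree = s.card := by rw [hg, natDegree_finsetProd_X_sub_C_eq_card]
  have hpos : 0 < s.card := hs.card_pos
  have hdeg : (f - g).degree < s.card := by
    have := degree_sub_lt_left (p := f) (q := g)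
      (by rw [degree_eq_natDegree hfm.ne_zero, degree_eq_natDegree hgm.ne_zero, hfd, hgd])
      hfm.ne_zero (by rw [hfm.leadingCoeff, hgm.leadingCoeff])
    rwa [degree_eq_natDegree hfm.ne_zero, hfd] at this
  -- Both products are monic of degree `s.card`, so `f - g` has smaller degree and Lagrange's
  -- formula computes its coefficient of degree `s.card - 1`. That coefficient is a difference of
  -- root sums, and at the nodes `f - g` equals `f` because `g` vanishes there.
  have key := Lagrange.coeff_eq_sum hy hdeg
  have hc : (f - g).coeff (s.card - 1) = ∑ i ∈ s, y i - ∑ j ∈ u, b j := by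
    rw [coeff_sub, hf, hg, prod_X_sub_C_coeff_card_pred s y hpos]
    have := prod_X_sub_C_coeff_card_pred u b (by omega)
    rw [hcard] at this
    rw [this]; ring
  rw [← hc, key]
  refine sum_congr rfl fun i hi => ?_
  congr 1
  have : ∏ j ∈ s, (y i - y j) = 0 := prod_eq_zero hi (sub_self _)
  simp [hf, hg, eval_prod, this]

/-- The commutator in an associative ring. -/
def comm {A : Type*} [Ring A] (x y : A) : A := x * y - y * x

/-! ### Weighted shift operators -/

section ShiftOp

variable {K Λ : Type*} [Field K] [AddCommGroup Λ]

/-- The operator `T(z) ↦ c(z) T(z + d)` on the free module with basis `T(z)`, `z ∈ Λ`. -/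
def shiftOp (c : Λ → K) (d : Λ) : Module.End K (Λ →₀ K) :=
  Finsupp.linearCombination K fun z => Finsupp.single (z + d) (c z)

theorem shiftOp_single (c : Λ → K) (d z : Λ) :
    shiftOp c d (Finsupp.single z 1) = Finsupp.single (z + d) (c z) := by
  simp [shiftOp]

theorem end_ext {K Λ : Type*} [Field K] {f g : Module.End K (Λ →₀ K)}
    (h : ∀ z, f (Finsupp.single z 1) = g (Finsupp.single z 1)) : f = g :=
  Finsupp.lhom_ext' fun z => LinearMap.ext_ring (h z)

theorem shiftOp_mul (a b : Λ → K) (d d' : Λ) :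
    shiftOp a d * shiftOp b d' = shiftOp (fun z => b z * a (z + d')) (d' + d) := by
  refine end_ext fun z => ?_
  have : (Finsupp.single (z + d') (b z) : Λ →₀ K) = b z • Finsupp.single (z + d') 1 := by simp
  rw [Module.End.mul_apply, shiftOp_single, this, map_smul, shiftOp_single, shiftOp_single,
    Finsupp.smul_single, smul_eq_mul, add_assoc]

theorem shiftOp_add (a b : Λ → K) (d : Λ) :
    shiftOp a d + shiftOp b d = shiftOp (fun z => a z + b z) d :=
  end_ext fun z => by simp [shiftOp_single]

theorem shiftOp_sub (a b : Λ → K) (d : Λ) :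
    shiftOp a d - shiftOp b d = shiftOp (fun z => a z - b z) d :=
  end_ext fun z => by simp [shiftOp_single]

theorem shiftOp_sum {ι : Type*} (s : Finset ι) (a : ι → Λ → K) (d : Λ) :
    ∑ i ∈ s, shiftOp (a i) d = shiftOp (fun z => ∑ i ∈ s, a i z) d :=
  end_ext fun z => by simp [shiftOp_single, LinearMap.sum_apply, Finsupp.single_finsetSum]

theorem shiftOp_eq_zero {a : Λ → K} (d : Λ) (h : ∀ z, a z = 0) : shiftOp a d = 0 :=
  end_ext fun z => by simp [shiftOp_single, h]

theorem shiftOp_lie (a b : Λ → K) (d d' : Λ) :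
    comm (shiftOp a d) (shiftOp b d') =
      shiftOp (fun z => b z * a (z + d') - a z * b (z + d)) (d + d') := by
  rw [comm, shiftOp_mul, shiftOp_mul, add_comm d' d, shiftOp_sub]

theorem shiftOp_lie_lie (a a' b : Λ → K) (d d' c : Λ) :
    comm (shiftOp a d) (comm (shiftOp a' d') (shiftOp b c)) =
      shiftOp (fun z => (b z * a' (z + c) * a (z + d' + c) - a' z * b (z + d') * a (z + d' + c))
        - (a z * b (z + d) * a' (z + d + c) - a z * a' (z + d) * b (z + d + d'))) (d + d' + c) := by
  rw [shiftOp_lie, shiftOp_lie, ← add_assoc]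
  congr 1
  funext z
  simp only [← add_assoc]
  ring

/-- A double sum of an antisymmetric expression vanishes. -/
theorem sum_sum_eq_zero_of_antisymm (F : Type*) {ι M : Type*} [Field F] [CharZero F]
    [AddCommGroup M] [Module F M] (s : Finset ι)
    (f : ι → ι → M) (h : ∀ i ∈ s, ∀ j ∈ s, f i j + f j i = 0) : ∑ i ∈ s, ∑ j ∈ s, f i j = 0 := by
  have h2 : ∑ i ∈ s, ∑ j ∈ s, f i j + ∑ i ∈ s, ∑ j ∈ s, f i j = 0 := by
    nth_rw 2 [sum_comm]
    rw [← sum_add_distrib]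
    refine sum_eq_zero fun i hi => ?_
    rw [← sum_add_distrib]
    exact sum_eq_zero fun j hj => h i hi j hj
  have h3 : (2 : F) • ∑ i ∈ s, ∑ j ∈ s, f i j = 0 := by rw [two_smul]; exact h2
  exact (smul_eq_zero.mp h3).resolve_left two_ne_zero

/-- The Serre relation for a pair of shifts that share the factor they exchange with a third. -/
theorem serre_coeff_double {s X Y r r' b : K} (h0 : X - Y ≠ 0) (h1 : X - Y + s ≠ 0)
    (h2 : Y - X + s ≠ 0) :
    ((b * ((Y + s) * r' / (Y - X)) * ((X + s) * r / (X - Y + s)) -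
        Y * r' / (Y - X) * b * ((X + s) * r / (X - Y + s))) -
      (X * r / (X - Y) * b * ((Y + s) * r' / (Y - X + s)) -
        X * r / (X - Y) * (Y * r' / (Y - X + s)) * b)) +
    ((b * ((X + s) * r / (X - Y)) * ((Y + s) * r' / (Y - X + s)) -
        X * r / (X - Y) * b * ((Y + s) * r' / (Y - X + s))) -
      (Y * r' / (Y - X) * b * ((X + s) * r / (X - Y + s)) -
        Y * r' / (Y - X) * (X * r / (X - Y + s)) * b)) = 0 := by
  have h3 : Y - X ≠ 0 := fun h => h0 (by linear_combination -h)
  field_simp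
  ring

/-- The Serre relation for a pair of shifts of a row entering the coefficient of a third. -/
theorem serre_coeff_single {s X Y r r' b : K} (h0 : Y - X ≠ 0) (h1 : Y - X + s ≠ 0)
    (h2 : X - Y + s ≠ 0) :
    ((X * Y * b * (r' / (X - Y)) * (r / (Y - X + s)) -
        r' / (X - Y) * (X * (Y + s) * b) * (r / (Y - X + s))) -
      (r / (Y - X) * ((X + s) * Y * b) * (r' / (X - Y + s)) -
        r / (Y - X) * (r' / (X - Y + s)) * ((X + s) * (Y + s) * b))) +
    ((X * Y * b * (r / (Y - X)) * (r' / (X - Y + s)) -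
        r / (Y - X) * ((X + s) * Y * b) * (r' / (X - Y + s))) -
      (r' / (X - Y) * (X * (Y + s) * b) * (r / (Y - X + s)) -
        r' / (X - Y) * (r / (Y - X + s)) * ((X + s) * (Y + s) * b))) = 0 := by
  have h3 : X - Y ≠ 0 := fun h => h0 (by linear_combination -h)
  field_simp
  ring

end ShiftOp

end GT

/-! ### Raising, lowering and weight operators of a generic triangular array. -/

namespace GT

theorem comm_sum {A ι : Type*} [Ring A] (x : A) (s : Finset ι) (f : ι → A) :
    comm x (∑ i ∈ s, f i) = ∑ i ∈ s, comm x (f i) := by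
  simp [comm, mul_sum, sum_mul, sum_sub_distrib]

theorem sum_comm_left {A ι : Type*} [Ring A] (x : A) (s : Finset ι) (f : ι → A) :
    comm (∑ i ∈ s, f i) x = ∑ i ∈ s, comm (f i) x := by
  simp [comm, mul_sum, sum_mul, sum_sub_distrib]

/-- A lattice `Λ` acting by integral shifts on a generic triangular array: `entry z k i`, with
`i ≤ k`, is the entry `i` of the row `k` at the lattice point `z`, and `unit k i` shifts it by `1`.
Only the rows `k` with `k + 1 < N` are shifted. -/
structure GenericArray (K Λ : Type*) [Field K] [AddCommGroup Λ] (N : ℕ) where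
  entry : Λ → ℕ → ℕ → K
  unit : ℕ → ℕ → Λ
  entry_add : ∀ {k i : ℕ}, k + 1 < N → i ≤ k → ∀ z l j,
    entry (z + unit k i) l j = entry z l j + if l = k ∧ j = i then 1 else 0
  generic : ∀ {k i j : ℕ}, k + 1 < N → i ≤ k → j ≤ k → i ≠ j → ∀ (z : Λ) (m : ℤ),
    entry z k i - entry z k j ≠ m

namespace GenericArray

variable {K Λ : Type*} [Field K] [AddCommGroup Λ] {N : ℕ} (W : GenericArray K Λ N)

theorem entry_sub {k i : ℕ} (hk : k + 1 < N) (hi : i ≤ k) (z : Λ) (l j : ℕ) :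
    W.entry (z + -W.unit k i) l j = W.entry z l j - if l = k ∧ j = i then 1 else 0 := by
  have := W.entry_add hk hi (z + -W.unit k i) l j
  rw [neg_add_cancel_right] at this
  rw [this, add_sub_cancel_right]

/-- The coefficient of the raising operator of row `k` at the entry `i`. -/
def raise (k i : ℕ) (z : Λ) : K :=
  -((∏ j ∈ range (k + 2), (W.entry z k i - W.entry z (k + 1) j)) /
    ∏ j ∈ (range (k + 1)).erase i, (W.entry z k i - W.entry z k j))

/-- The coefficient of the lowering operator of row `k` at the entry `i`. -/
def lower (k i : ℕ) (z : Λ) : K :=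
  (∏ j ∈ range k, (W.entry z k i - W.entry z (k - 1) j)) /
    ∏ j ∈ (range (k + 1)).erase i, (W.entry z k i - W.entry z k j)

/-- The weight of the row `k`. -/
def weight (k : ℕ) (z : Λ) : K :=
  (k : K) + ∑ i ∈ range (k + 1), W.entry z k i - ∑ i ∈ range k, W.entry z (k - 1) i

/-- The operator representing `E_{k,k+1}`. -/
def opE (k : ℕ) : Module.End K (Λ →₀ K) := ∑ i ∈ range (k + 1), shiftOp (W.raise k i) (W.unit k i)

/-- The operator representing `E_{k+1,k}`. -/
def opF (k : ℕ) : Module.End K (Λ →₀ K) := ∑ i ∈ range (k + 1), shiftOp (W.lower k i) (-W.unit k i)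

/-- The operator representing `E_{k,k}`. -/
def opH (k : ℕ) : Module.End K (Λ →₀ K) := shiftOp (W.weight k) 0

variable {W}

/-- Factor out of `raise` the differences with one entry of the next row and one of the same row. -/
theorem raise_eq {k i i' j : ℕ} (hj : j < k + 2) (hi' : i' < k + 1) (hii' : i' ≠ i) (z : Λ) :
    W.raise k i z = (W.entry z k i - W.entry z (k + 1) j) *
      (-(∏ m ∈ (range (k + 2)).erase j, (W.entry z k i - W.entry z (k + 1) m)) /
        ∏ m ∈ ((range (k + 1)).erase i).erase i', (W.entry z k i - W.entry z k m)) /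
      (W.entry z k i - W.entry z k i') := by
  rw [raise, ← mul_prod_erase _ _ (mem_range.mpr hj),
    ← mul_prod_erase ((range (k + 1)).erase i) _ (mem_erase.mpr ⟨hii', mem_range.mpr hi'⟩)]
  rw [mul_div_assoc', div_div, neg_div', mul_neg, mul_comm (W.entry z k i - W.entry z k i')]

/-- This and the following factorizations isolate the factors that change when another entry is
shifted. The cofactor is then invariant under that shift, and each relation becomes a small rational
identity in the isolated factors. -/
theorem raise_eq_left {k i j : ℕ} (hj : j < k + 2) (z : Λ) :
    W.raise k i z = (W.entry z k i - W.entry z (k + 1) j) *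
      (-(∏ m ∈ (range (k + 2)).erase j, (W.entry z k i - W.entry z (k + 1) m)) /
        ∏ m ∈ (range (k + 1)).erase i, (W.entry z k i - W.entry z k m)) := by
  rw [raise, ← mul_prod_erase _ _ (mem_range.mpr hj), mul_div_assoc', neg_div', mul_neg]

theorem raise_eq_right {k i i' : ℕ} (hi' : i' < k + 1) (hii' : i' ≠ i) (z : Λ) :
    W.raise k i z = (-(∏ m ∈ range (k + 2), (W.entry z k i - W.entry z (k + 1) m)) /
        ∏ m ∈ ((range (k + 1)).erase i).erase i', (W.entry z k i - W.entry z k m)) /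
      (W.entry z k i - W.entry z k i') := by
  rw [raise, ← mul_prod_erase ((range (k + 1)).erase i) _ (mem_erase.mpr ⟨hii', mem_range.mpr hi'⟩),
    div_div, neg_div', mul_comm (W.entry z k i - W.entry z k i')]

theorem raise_eq_pair {k i j j' : ℕ} (hj : j < k + 2) (hj' : j' < k + 2) (hjj' : j' ≠ j) (z : Λ) :
    W.raise k i z = (W.entry z k i - W.entry z (k + 1) j) * (W.entry z k i - W.entry z (k + 1) j') *
      (-(∏ m ∈ ((range (k + 2)).erase j).erase j', (W.entry z k i - W.entry z (k + 1) m)) /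
        ∏ m ∈ (range (k + 1)).erase i, (W.entry z k i - W.entry z k m)) := by
  rw [raise_eq_left hj, ← mul_prod_erase ((range (k + 2)).erase j) _
    (mem_erase.mpr ⟨hjj', mem_range.mpr hj'⟩)]
  ring

theorem lower_eq {k i i' j : ℕ} (hj : j < k + 1) (hi' : i' < k + 2) (hii' : i' ≠ i) (z : Λ) :
    W.lower (k + 1) i z = (W.entry z (k + 1) i - W.entry z k j) *
      ((∏ m ∈ (range (k + 1)).erase j, (W.entry z (k + 1) i - W.entry z k m)) /
        ∏ m ∈ ((range (k + 2)).erase i).erase i', (W.entry z (k + 1) i - W.entry z (k + 1) m)) /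
      (W.entry z (k + 1) i - W.entry z (k + 1) i') := by
  rw [lower, ← mul_prod_erase _ _ (mem_range.mpr hj),
    ← mul_prod_erase ((range (k + 1 + 1)).erase i) _ (mem_erase.mpr ⟨hii', mem_range.mpr hi'⟩)]
  rw [mul_div_assoc', div_div, mul_comm (W.entry z (k + 1) i - W.entry z (k + 1) i')]
  rfl

theorem lower_eq_left {k i j : ℕ} (hj : j < k + 1) (z : Λ) :
    W.lower (k + 1) i z = (W.entry z (k + 1) i - W.entry z k j) *
      ((∏ m ∈ (range (k + 1)).erase j, (W.entry z (k + 1) i - W.entry z k m)) /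
        ∏ m ∈ (range (k + 2)).erase i, (W.entry z (k + 1) i - W.entry z (k + 1) m)) := by
  rw [lower, ← mul_prod_erase _ _ (mem_range.mpr hj), mul_div_assoc']
  rfl

theorem lower_eq_right {k i i' : ℕ} (hi' : i' < k + 1) (hii' : i' ≠ i) (z : Λ) :
    W.lower k i z = ((∏ m ∈ range k, (W.entry z k i - W.entry z (k - 1) m)) /
        ∏ m ∈ ((range (k + 1)).erase i).erase i', (W.entry z k i - W.entry z k m)) /
      (W.entry z k i - W.entry z k i') := by
  rw [lower, ← mul_prod_erase ((range (k + 1)).erase i) _ (mem_erase.mpr ⟨hii', mem_range.mpr hi'⟩),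
    div_div, mul_comm (W.entry z k i - W.entry z k i')]

theorem lower_eq_pair {k i j j' : ℕ} (hj : j < k + 1) (hj' : j' < k + 1) (hjj' : j' ≠ j) (z : Λ) :
    W.lower (k + 1) i z =
      (W.entry z (k + 1) i - W.entry z k j) * (W.entry z (k + 1) i - W.entry z k j') *
      ((∏ m ∈ ((range (k + 1)).erase j).erase j', (W.entry z (k + 1) i - W.entry z k m)) /
        ∏ m ∈ (range (k + 2)).erase i, (W.entry z (k + 1) i - W.entry z (k + 1) m)) := by
  rw [lower_eq_left hj, ← mul_prod_erase ((range (k + 1)).erase j) _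
    (mem_erase.mpr ⟨hjj', mem_range.mpr hj'⟩)]
  ring

/-- Products of differences agree at two lattice points if the entries involved do. -/
theorem prod_sub_congr {k i l : ℕ} {s : Finset ℕ} {z z' : Λ}
    (h : W.entry z' k i = W.entry z k i) (h' : ∀ m ∈ s, W.entry z' l m = W.entry z l m) :
    ∏ m ∈ s, (W.entry z' k i - W.entry z' l m) = ∏ m ∈ s, (W.entry z k i - W.entry z l m) :=
  prod_congr rfl fun m hm => by rw [h, h' m hm]

theorem raise_congr {k i : ℕ} {z z' : Λ} (h : ∀ j, W.entry z' k j = W.entry z k j)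
    (h' : ∀ j, W.entry z' (k + 1) j = W.entry z (k + 1) j) : W.raise k i z' = W.raise k i z := by
  rw [raise, raise, prod_sub_congr (h i) fun j _ => h' j, prod_sub_congr (h i) fun j _ => h j]

theorem lower_congr {k i : ℕ} {z z' : Λ} (h : ∀ j, W.entry z' k j = W.entry z k j)
    (h' : ∀ j, 0 < k → W.entry z' (k - 1) j = W.entry z (k - 1) j) :
    W.lower k i z' = W.lower k i z := by
  rw [lower, lower, prod_sub_congr (h i) fun j hj => h' j (by rw [mem_range] at hj; omega),
    prod_sub_congr (h i) fun j _ => h j]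

theorem generic_add {k i j : ℕ} (hk : k + 1 < N) (hi : i ≤ k) (hj : j ≤ k) (hij : i ≠ j) (z : Λ)
    (m : ℤ) : W.entry z k i - W.entry z k j + m ≠ 0 := fun h =>
  W.generic hk hi hj hij z (-m) (by push_cast; linear_combination h)

variable (W)

/-- Only for `l = k + 1` do the coefficients see each other's shift, and then only through the
difference `D` of the two moved entries. Both orders of application give `-D (D + 1)` times the same
cofactors. -/
theorem comm_opE_opF_of_ne {k l : ℕ} (hk : k + 1 < N) (hl : l + 1 < N) (hkl : k ≠ l) :
    comm (W.opE k) (W.opF l) = 0 := by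
  rw [opE, opF, sum_comm_left]
  refine sum_eq_zero fun i hi => ?_
  rw [comm_sum]
  refine sum_eq_zero fun j hj => ?_
  rw [mem_range] at hi hj
  rw [shiftOp_lie]
  refine shiftOp_eq_zero _ fun z => ?_
  have hA := W.entry_add hk (Nat.lt_succ_iff.mp hi)
  have hS := W.entry_sub hl (Nat.lt_succ_iff.mp hj)
  rcases eq_or_ne l (k + 1) with rfl | hne
  · rw [raise_eq_left hj, raise_eq_left hj, lower_eq_left hi, lower_eq_left hi]
    have e1 := prod_sub_congr (W := W) (k := k) (i := i) (l := k + 1) (z := z)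
      (z' := z + -W.unit (k + 1) j) (s := (range (k + 2)).erase j) (by simp [hS])
      (fun m hm => by simp [hS, (mem_erase.mp hm).1])
    have e2 := prod_sub_congr (W := W) (k := k) (i := i) (l := k) (z := z)
      (z' := z + -W.unit (k + 1) j) (s := (range (k + 1)).erase i) (by simp [hS])
      (fun m hm => by simp [hS])
    have e3 := prod_sub_congr (W := W) (k := k + 1) (i := j) (l := k) (z := z)
      (z' := z + W.unit k i) (s := (range (k + 1)).erase i) (by simp [hA])
      (fun m hm => by simp [hA, (mem_erase.mp hm).1])
    have e4 := prod_sub_congr (W := W) (k := k + 1) (i := j) (l := k + 1) (z := z)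
      (z' := z + W.unit k i) (s := (range (k + 2)).erase j) (by simp [hA])
      (fun m hm => by simp [hA])
    rw [e1, e2, e3, e4]
    simp [hA, hS]
    ring
  · rw [raise_congr (z := z) (z' := z + -W.unit l j), lower_congr (z := z) (z' := z + W.unit k i)]
    · ring
    · intro m; simp [hA, hkl.symm]
    · intro m hl0; rw [hA, if_neg (by omega), add_zero]
    · intro m; simp [hS, hkl]
    · intro m; simp [hS, hne.symm]

theorem comm_opE_opE_of_lt {k l : ℕ} (hl : l + 1 < N) (hkl : k + 1 < l) :
    comm (W.opE k) (W.opE l) = 0 := by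
  rw [opE, opE, sum_comm_left]
  refine sum_eq_zero fun i hi => ?_
  rw [comm_sum]
  refine sum_eq_zero fun j hj => ?_
  rw [mem_range] at hi hj
  rw [shiftOp_lie]
  refine shiftOp_eq_zero _ fun z => ?_
  have hA := W.entry_add (k := k) (by omega) (Nat.lt_succ_iff.mp hi)
  have hS := W.entry_add hl (Nat.lt_succ_iff.mp hj)
  rw [raise_congr (z := z) (z' := z + W.unit l j), raise_congr (z := z) (z' := z + W.unit k i)]
  · ring
  all_goals intro m; simp only [hA, hS]; rw [if_neg (by omega), add_zero]

theorem comm_opF_opF_of_lt {k l : ℕ} (hl : l + 1 < N) (hkl : k + 1 < l) :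
    comm (W.opF k) (W.opF l) = 0 := by
  rw [opF, opF, sum_comm_left]
  refine sum_eq_zero fun i hi => ?_
  rw [comm_sum]
  refine sum_eq_zero fun j hj => ?_
  rw [mem_range] at hi hj
  rw [shiftOp_lie]
  refine shiftOp_eq_zero _ fun z => ?_
  have hA := W.entry_sub (k := k) (by omega) (Nat.lt_succ_iff.mp hi)
  have hS := W.entry_sub hl (Nat.lt_succ_iff.mp hj)
  rw [lower_congr (z := z) (z' := z + -W.unit l j), lower_congr (z := z) (z' := z + -W.unit k i)]
  · ring
  all_goals intros; simp only [hA, hS]; rw [if_neg (by omega), sub_zero]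

theorem comm_opH_opH (k l : ℕ) : comm (W.opH k) (W.opH l) = 0 := by
  rw [opH, opH, shiftOp_lie]
  refine shiftOp_eq_zero _ fun z => ?_
  rw [add_zero]
  ring

theorem weight_add {k i : ℕ} (hk : k + 1 < N) (hi : i ≤ k) (l : ℕ) (z : Λ) :
    W.weight l (z + W.unit k i) =
      W.weight l z + ((if l = k then 1 else 0) - if l = k + 1 then 1 else 0) := by
  simp only [weight, W.entry_add hk hi, sum_add_distrib]
  have h1 : ∑ x ∈ range (l + 1), (if l = k ∧ x = i then (1 : K) else 0) = if l = k then 1 else 0 := by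
    by_cases h : l = k
    · subst h; simp [Nat.lt_succ_iff.mpr hi]
    · simp [h]
  have h2 : ∑ x ∈ range l, (if l - 1 = k ∧ x = i then (1 : K) else 0) =
      if l = k + 1 then 1 else 0 := by
    by_cases h : l = k + 1
    · subst h; simp [Nat.lt_succ_iff.mpr hi]
    · rw [if_neg h]
      refine sum_eq_zero fun x hx => if_neg ?_
      rw [mem_range] at hx
      omega
  rw [h1, h2]
  ring

theorem weight_sub {k i : ℕ} (hk : k + 1 < N) (hi : i ≤ k) (l : ℕ) (z : Λ) :
    W.weight l (z + -W.unit k i) =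
      W.weight l z - ((if l = k then 1 else 0) - if l = k + 1 then 1 else 0) := by
  have := W.weight_add hk hi l (z + -W.unit k i)
  rw [neg_add_cancel_right] at this
  rw [this]
  ring

theorem comm_opH_opE {k : ℕ} (hk : k + 1 < N) (l : ℕ) :
    comm (W.opH l) (W.opE k) =
      (((if l = k then 1 else 0) - if l = k + 1 then 1 else 0 : ℤ)) • W.opE k := by
  rw [opH, opE, comm_sum, smul_sum]
  refine sum_congr rfl fun i hi => ?_
  rw [shiftOp_lie]
  refine end_ext fun z => ?_
  rw [LinearMap.smul_apply, shiftOp_single, shiftOp_single,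
    W.weight_add hk (Nat.lt_succ_iff.mp (mem_range.mp hi)), zero_add, add_zero,
    ← Int.cast_smul_eq_zsmul K, Finsupp.smul_single]
  congr 1
  push_cast
  simp only [smul_eq_mul]
  ring

theorem comm_opH_opF {k : ℕ} (hk : k + 1 < N) (l : ℕ) :
    comm (W.opH l) (W.opF k) =
      (-((if l = k then 1 else 0) - if l = k + 1 then 1 else 0 : ℤ)) • W.opF k := by
  rw [opH, opF, comm_sum, smul_sum]
  refine sum_congr rfl fun i hi => ?_
  rw [shiftOp_lie]
  refine end_ext fun z => ?_
  rw [LinearMap.smul_apply, shiftOp_single, shiftOp_single,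
    W.weight_sub hk (Nat.lt_succ_iff.mp (mem_range.mp hi)), zero_add, add_zero,
    ← Int.cast_smul_eq_zsmul K, Finsupp.smul_single]
  congr 1
  push_cast
  simp only [smul_eq_mul]
  ring

end GenericArray

end GT

namespace GT

namespace GenericArray

variable {K Λ : Type*} [Field K] [AddCommGroup Λ] {N : ℕ} (W : GenericArray K Λ N)

/-- This is a single divided difference. The nodes are the entries of row `k` together with the same
entries lowered by one; the roots of the numerator are the entries of row `k + 1` and those of row
`k - 1` lowered by one, so the numbers `2k + 2` match. An original node gives the product with
`raise` applied first, a lowered node the product with `lower` first. The factor pairing a node with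
its translate is `1` or `-1` and accounts for the signs. -/
theorem sum_lower_mul_raise {k : ℕ} (hk : k + 1 < N) (z : Λ) :
    ∑ i ∈ range (k + 1), (W.lower k i z * W.raise k i (z + -W.unit k i) -
      W.raise k i z * W.lower k i (z + W.unit k i)) = W.weight k z - W.weight (k + 1) z := by
  set y : ℕ ⊕ ℕ → K := Sum.elim (fun i => W.entry z k i) (fun i => W.entry z k i - 1) with hy
  set b : ℕ ⊕ ℕ → K :=
    Sum.elim (fun j => W.entry z (k + 1) j) (fun j => W.entry z (k - 1) j - 1) with hb
  set s : Finset (ℕ ⊕ ℕ) := (range (k + 1)).disjSum (range (k + 1)) with hs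
  set u : Finset (ℕ ⊕ ℕ) := (range (k + 2)).disjSum (range k) with hu
  have hinj : Set.InjOn y s := by
    rintro (i | i) hi (j | j) hj h <;> simp [hs] at hi hj <;> simp [hy] at h
    · by_contra hne
      exact W.generic hk (by omega) (by omega) (fun e => hne (congrArg _ e)) z 0 (by simp [h])
    · exfalso
      rcases eq_or_ne i j with rfl | hne
      · exact one_ne_zero (α := K) (by linear_combination h)
      · exact W.generic hk (by omega) (by omega) hne z (-1) (by push_cast; rw [h]; ring)
    · exfalso
      rcases eq_or_ne i j with rfl | hne
      · simp at h
      · exact W.generic hk (by omega) (by omega) hne z 1 (by push_cast; rw [← h]; ring)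
    · by_contra hne
      exact W.generic hk (by omega) (by omega) (fun e => hne (congrArg _ e)) z 0 (by simp [h])
  have key := sum_prod_sub_div_prod_sub s y hinj u b (by simp [hs, hu]; ring)
    ⟨Sum.inl 0, by simp [hs]⟩
  have hL : ∑ i ∈ range (k + 1), (W.lower k i z * W.raise k i (z + -W.unit k i) -
      W.raise k i z * W.lower k i (z + W.unit k i)) =
      ∑ i ∈ s, (∏ j ∈ u, (y i - b j)) / ∏ j ∈ s.erase i, (y i - y j) := by
    rw [hs, sum_disjSum, ← sum_add_distrib]
    refine sum_congr rfl fun i hi => ?_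
    have hik := mem_range.mp hi
    have hA := W.entry_add hk (Nat.lt_succ_iff.mp hik) z
    have hS := W.entry_sub hk (Nat.lt_succ_iff.mp hik) z
    have el : ((range (k + 1)).disjSum (range (k + 1))).erase (Sum.inl i) =
        ((range (k + 1)).erase i).disjSum (range (k + 1)) := by
      ext (x | x) <;> simp
    have er : ((range (k + 1)).disjSum (range (k + 1))).erase (Sum.inr i) =
        (range (k + 1)).disjSum ((range (k + 1)).erase i) := by
      ext (x | x) <;> simp
    rw [el, er, hu]
    simp only [Finset.prod_disjSum, hy, hb, Sum.elim_inl, Sum.elim_inr]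
    rw [← mul_prod_erase (range (k + 1)) (fun x => W.entry z k i - (W.entry z k x - 1)) hi,
      ← mul_prod_erase (range (k + 1)) (fun x => W.entry z k i - 1 - W.entry z k x) hi]
    have r1 : W.raise k i (z + -W.unit k i) =
        -((∏ j ∈ range (k + 2), (W.entry z k i - 1 - W.entry z (k + 1) j)) /
          ∏ j ∈ (range (k + 1)).erase i, (W.entry z k i - 1 - W.entry z k j)) := by
      rw [raise]
      congr 2
      · exact prod_congr rfl fun j _ => by simp [hS]
      · exact prod_congr rfl fun j hj => by simp [hS, (mem_erase.mp hj).1]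
    have r2 : W.lower k i (z + W.unit k i) =
        (∏ j ∈ range k, (W.entry z k i - (W.entry z (k - 1) j - 1))) /
          ∏ j ∈ (range (k + 1)).erase i, (W.entry z k i - (W.entry z k j - 1)) := by
      rw [lower]
      congr 1
      · refine prod_congr rfl fun j hj => ?_
        rw [mem_range] at hj
        rw [hA, hA, if_pos ⟨rfl, rfl⟩, if_neg (by omega)]
        ring
      · refine prod_congr rfl fun j hj => ?_
        rw [hA, hA, if_pos ⟨rfl, rfl⟩, if_neg (fun h => (mem_erase.mp hj).1 h.2)]
        ring
    have r3 : ∏ x ∈ range k, (W.entry z k i - 1 - (W.entry z (k - 1) x - 1)) =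
        ∏ x ∈ range k, (W.entry z k i - W.entry z (k - 1) x) :=
      prod_congr rfl fun j _ => by ring
    have r4 : ∏ x ∈ (range (k + 1)).erase i, (W.entry z k i - 1 - (W.entry z k x - 1)) =
        ∏ x ∈ (range (k + 1)).erase i, (W.entry z k i - W.entry z k x) :=
      prod_congr rfl fun j _ => by ring
    rw [r1, r2, r3, r4, lower, raise]
    have a1 : W.entry z k i - (W.entry z k i - 1) = 1 := by ring
    have a2 : W.entry z k i - 1 - W.entry z k i = -1 := by ring
    rw [a1, a2]
    simp only [div_eq_mul_inv, mul_inv, inv_neg, inv_one]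
    ring
  rw [hL, key, hs, hu]
  simp only [sum_disjSum, hy, hb, Sum.elim_inl, Sum.elim_inr, weight, sum_sub_distrib, sum_const,
    card_range, Nat.add_sub_cancel, nsmul_eq_mul]
  push_cast
  ring

theorem comm_opE_opF_self {k : ℕ} (hk : k + 1 < N) :
    comm (W.opE k) (W.opF k) = W.opH k - W.opH (k + 1) := by
  have hterm : ∀ i ∈ range (k + 1),
      comm (shiftOp (W.raise k i) (W.unit k i)) (W.opF k) =
        shiftOp (fun z => W.lower k i z * W.raise k i (z + -W.unit k i) -
          W.raise k i z * W.lower k i (z + W.unit k i)) 0 := by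
    intro i hi
    rw [opF, comm_sum, sum_eq_single_of_mem i hi]
    · rw [shiftOp_lie, add_neg_cancel]
    -- Different entries of the row commute. Only the denominators see the other shift, and with `D`
    -- the difference of the two entries both orders produce `-1 / (D (D + 1))` times the same
    -- cofactors.
    · intro j hj hne
      rw [mem_range] at hi hj
      rw [shiftOp_lie]
      refine shiftOp_eq_zero _ fun z => ?_
      have hA := W.entry_add hk (Nat.lt_succ_iff.mp hi)
      have hS := W.entry_sub hk (Nat.lt_succ_iff.mp hj)
      rw [raise_eq_right hj hne, raise_eq_right hj hne, lower_eq_right hi hne.symm,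
        lower_eq_right hi hne.symm]
      have e1 := prod_sub_congr (W := W) (k := k) (i := i) (l := k + 1) (z := z)
        (z' := z + -W.unit k j) (s := range (k + 2)) (by simp [hS, hne.symm])
        (fun m hm => by simp [hS])
      have e2 := prod_sub_congr (W := W) (k := k) (i := i) (l := k) (z := z)
        (z' := z + -W.unit k j) (s := ((range (k + 1)).erase i).erase j) (by simp [hS, hne.symm])
        (fun m hm => by simp [hS, (mem_erase.mp hm).1])
      have e3 := prod_sub_congr (W := W) (k := k) (i := j) (l := k - 1) (z := z)
        (z' := z + W.unit k i) (s := range k) (by simp [hA, hne])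
        (fun m hm => by rw [mem_range] at hm; rw [hA, if_neg (by omega), add_zero])
      have e4 := prod_sub_congr (W := W) (k := k) (i := j) (l := k) (z := z)
        (z' := z + W.unit k i) (s := ((range (k + 1)).erase j).erase i) (by simp [hA, hne])
        (fun m hm => by simp [hA, (mem_erase.mp hm).1])
      rw [e1, e2, e3, e4]
      simp only [hA, hS, if_pos, hne, hne.symm, and_false, and_true, if_false]
      have g1 := W.generic_add hk (Nat.lt_succ_iff.mp hi) (Nat.lt_succ_iff.mp hj) hne.symm z 0
      have g2 := W.generic_add hk (Nat.lt_succ_iff.mp hi) (Nat.lt_succ_iff.mp hj) hne.symm z 1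
      push_cast at g1 g2
      generalize (-∏ m ∈ range (k + 2), (W.entry z k i - W.entry z (k + 1) m)) / _ = p
      generalize (∏ m ∈ range k, (W.entry z k j - W.entry z (k - 1) m)) / _ = q
      have g3 : W.entry z k j - W.entry z k i ≠ 0 := fun h => g1 (by linear_combination -h)
      have g4 : W.entry z k j - (W.entry z k i + 1) ≠ 0 := fun h => g2 (by linear_combination -h)
      have g5 : W.entry z k i - (W.entry z k j - 1) ≠ 0 := fun h => g2 (by linear_combination h)
      have g6 : W.entry z k i - W.entry z k j ≠ 0 := fun h => g1 (by linear_combination h)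
      simp only [sub_zero, add_zero]
      field_simp
      ring
  rw [opE, sum_comm_left, sum_congr rfl hterm, shiftOp_sum]
  rw [opH, opH, shiftOp_sub]
  congr 1
  funext z
  exact W.sum_lower_mul_raise hk z

theorem comm_comm_sum {A ι κ : Type*} [Ring A] (s : Finset ι) (t : Finset κ) (f : ι → A)
    (g : κ → A) :
    comm (∑ i ∈ s, f i) (comm (∑ i ∈ s, f i) (∑ j ∈ t, g j)) =
      ∑ j ∈ t, ∑ i ∈ s, ∑ i' ∈ s, comm (f i) (comm (f i') (g j)) := by
  simp only [comm_sum, sum_comm_left]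
  exact sum_congr rfl fun j _ => sum_comm

end GenericArray

/-! ### The cubic Serre relations for shift operators. -/

section Serre

variable {K Λ ι : Type*} [Field K] [AddCommGroup Λ]

/-- The cubic Serre relation when the coefficients of the doubled operator involve the entry
shifted by the other one. -/
theorem sum_comm_comm_eq_zero_of_double [CharZero K] (s : Finset ι) (a : ι → Λ → K) (d : ι → Λ)
    (b : Λ → K) (c : Λ) (ε : K) (X : ι → Λ → K) (r : ι → ι → Λ → K) (q : ι → Λ → K)
    (hX : ∀ i ∈ s, ∀ i' ∈ s, i ≠ i' → ∀ z, X i z - X i' z ≠ 0)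
    (hXc : ∀ i ∈ s, ∀ z, X i (z + c) = X i z + ε)
    (hXd : ∀ i ∈ s, ∀ z, X i (z + d i) = X i z - ε)
    (hXd' : ∀ i ∈ s, ∀ i' ∈ s, i ≠ i' → ∀ z, X i (z + d i') = X i z)
    (ha : ∀ i ∈ s, ∀ i' ∈ s, i ≠ i' → ∀ z, a i z = X i z * r i i' z / (X i z - X i' z))
    (hrc : ∀ i ∈ s, ∀ i' ∈ s, i ≠ i' → ∀ z, r i i' (z + c) = r i i' z)
    (hrd : ∀ i ∈ s, ∀ i' ∈ s, i ≠ i' → ∀ z, r i i' (z + d i') = r i i' z)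
    (hq : ∀ i ∈ s, ∀ z, a i z = X i z * q i z) (hqc : ∀ i ∈ s, ∀ z, q i (z + c) = q i z)
    (hb : ∀ i ∈ s, ∀ z, b (z + d i) = b z) :
    ∑ i ∈ s, ∑ i' ∈ s, comm (shiftOp (a i) (d i)) (comm (shiftOp (a i') (d i')) (shiftOp b c)) =
      0 := by
  refine sum_sum_eq_zero_of_antisymm (M := Module.End K (Λ →₀ K)) K s
    (fun i i' => comm (shiftOp (a i) (d i)) (comm (shiftOp (a i') (d i')) (shiftOp b c))) fun i hi i' hi' => ?_
  rw [shiftOp_lie_lie, shiftOp_lie_lie, add_comm (d i') (d i), shiftOp_add]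
  refine shiftOp_eq_zero _ fun z => ?_
  rcases eq_or_ne i i' with rfl | hne
  -- For a repeated index the coefficient is a second difference of the linear factor `X` and
  -- vanishes by itself. Distinct indices cancel only after exchanging the two.
  · simp only [hq i hi, hqc i hi, hXc i hi, hXd i hi, hb i hi]
    ring
  · have h0 := hX i hi i' hi' hne z
    have h1 := hX i hi i' hi' hne (z + d i')
    have h2 := hX i' hi' i hi hne.symm (z + d i)
    rw [hXd i' hi', hXd' i hi i' hi' hne] at h1
    rw [hXd i hi, hXd' i' hi' i hi hne.symm] at h2
    have e1 : X i z - (X i' z - ε) = X i z - X i' z + ε := by ring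
    have e2 : X i' z - (X i z - ε) = X i' z - X i z + ε := by ring
    have e3 : X i z + ε - (X i' z + ε) = X i z - X i' z := by ring
    have e4 : X i' z + ε - (X i z + ε) = X i' z - X i z := by ring
    have e5 : X i z + ε - (X i' z - ε + ε) = X i z - X i' z + ε := by ring
    have e6 : X i' z + ε - (X i z - ε + ε) = X i' z - X i z + ε := by ring
    simp only [ha i hi i' hi' hne, ha i' hi' i hi hne.symm, hXc i hi, hXc i' hi', hXd i hi,
      hXd i' hi', hXd' i hi i' hi' hne, hXd' i' hi' i hi hne.symm, hrc i hi i' hi' hne,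
      hrc i' hi' i hi hne.symm, hrd i hi i' hi' hne, hrd i' hi' i hi hne.symm, hb i hi, hb i' hi',
      e1, e2, e3, e4, e5, e6]
    rw [e1] at h1
    rw [e2] at h2
    exact serre_coeff_double h0 h1 h2

/-- The cubic Serre relation when the coefficient of the single operator involves the entries
shifted by the doubled one. -/
theorem sum_comm_comm_eq_zero_of_single [CharZero K] (s : Finset ι) (a : ι → Λ → K) (d : ι → Λ)
    (b : Λ → K) (c : Λ) (ε : K) (X : ι → Λ → K) (r p : ι → ι → Λ → K) (q : ι → Λ → K)
    (hX : ∀ i ∈ s, ∀ i' ∈ s, i ≠ i' → ∀ z, X i' z - X i z ≠ 0)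
    (hXd : ∀ i ∈ s, ∀ z, X i (z + d i) = X i z + ε)
    (hXd' : ∀ i ∈ s, ∀ i' ∈ s, i ≠ i' → ∀ z, X i (z + d i') = X i z)
    (ha : ∀ i ∈ s, ∀ i' ∈ s, i ≠ i' → ∀ z, a i z = r i i' z / (X i' z - X i z))
    (hac : ∀ i ∈ s, ∀ z, a i (z + c) = a i z)
    (hrd : ∀ i ∈ s, ∀ i' ∈ s, i ≠ i' → ∀ z, r i i' (z + d i') = r i i' z)
    (hb : ∀ i ∈ s, ∀ i' ∈ s, i ≠ i' → ∀ z, b z = X i z * X i' z * p i i' z)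
    (hpd : ∀ i ∈ s, ∀ i' ∈ s, i ≠ i' → ∀ z, p i i' (z + d i) = p i i' z)
    (hpd' : ∀ i ∈ s, ∀ i' ∈ s, i ≠ i' → ∀ z, p i i' (z + d i') = p i i' z)
    (hq : ∀ i ∈ s, ∀ z, b z = X i z * q i z) (hqd : ∀ i ∈ s, ∀ z, q i (z + d i) = q i z) :
    ∑ i ∈ s, ∑ i' ∈ s, comm (shiftOp (a i) (d i)) (comm (shiftOp (a i') (d i')) (shiftOp b c)) =
      0 := by
  refine sum_sum_eq_zero_of_antisymm (M := Module.End K (Λ →₀ K)) K s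
    (fun i i' => comm (shiftOp (a i) (d i)) (comm (shiftOp (a i') (d i')) (shiftOp b c))) fun i hi i' hi' => ?_
  rw [shiftOp_lie_lie, shiftOp_lie_lie, add_comm (d i') (d i), shiftOp_add]
  refine shiftOp_eq_zero _ fun z => ?_
  rcases eq_or_ne i i' with rfl | hne
  · simp only [hq i hi, hqd i hi, hXd i hi, hac i hi]
    ring
  · have h0 := hX i hi i' hi' hne z
    have h1 := hX i hi i' hi' hne (z + d i')
    have h2 := hX i' hi' i hi hne.symm (z + d i)
    rw [hXd i' hi', hXd' i hi i' hi' hne] at h1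
    rw [hXd i hi, hXd' i' hi' i hi hne.symm] at h2
    have e1 : X i z + ε - X i' z = X i z - X i' z + ε := by ring
    have e2 : X i' z + ε - X i z = X i' z - X i z + ε := by ring
    simp only [hac i hi, hac i' hi']
    simp only [ha i hi i' hi' hne, ha i' hi' i hi hne.symm, hb i hi i' hi' hne, hXd i hi,
      hXd i' hi', hXd' i hi i' hi' hne, hXd' i' hi' i hi hne.symm,
      hrd i hi i' hi' hne, hrd i' hi' i hi hne.symm, hpd i hi i' hi' hne, hpd' i hi i' hi' hne,
      e1, e2]
    rw [e2] at h1
    rw [e1] at h2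
    exact serre_coeff_single h0 h1 h2

end Serre

namespace GenericArray

variable {K Λ : Type*} [Field K] [AddCommGroup Λ] {N : ℕ} (W : GenericArray K Λ N) [CharZero K]

/-- Fix the shift `j` in the upper row. The coefficients of the doubled operator contain the entry
`j` of row `k + 1`, while that of the single operator ignores row `k`. The factor `X` drops by one
when this entry is raised, whence `ε = -1`. -/
theorem serre_opE_opE_succ {k : ℕ} (hk : k + 2 < N) :
    comm (W.opE k) (comm (W.opE k) (W.opE (k + 1))) = 0 := by
  rw [opE, opE, comm_comm_sum]
  refine sum_eq_zero fun j hj => ?_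
  have hA : ∀ i ∈ range (k + 1), ∀ z l m, W.entry (z + W.unit k i) l m = _ := fun i hi =>
    W.entry_add (by omega) (Nat.lt_succ_iff.mp (mem_range.mp hi))
  have hB := W.entry_add (k := k + 1) hk (Nat.lt_succ_iff.mp (mem_range.mp hj))
  refine sum_comm_comm_eq_zero_of_double (range (k + 1)) (W.raise k) (W.unit k) _ _ (-1)
    (fun i z => W.entry z k i - W.entry z (k + 1) j)
    (fun i i' z => -(∏ m ∈ (range (k + 2)).erase j, (W.entry z k i - W.entry z (k + 1) m)) /
        ∏ m ∈ ((range (k + 1)).erase i).erase i', (W.entry z k i - W.entry z k m))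
    (fun i z => -(∏ m ∈ (range (k + 2)).erase j, (W.entry z k i - W.entry z (k + 1) m)) /
        ∏ m ∈ (range (k + 1)).erase i, (W.entry z k i - W.entry z k m))
    ?_ ?_ ?_ ?_ ?_ ?_ ?_ ?_ ?_ ?_
  · intro i hi i' hi' hne z h
    rw [mem_range] at hi hi'
    exact W.generic (k := k) (by omega) (by omega) (by omega) hne z 0 (by
      push_cast; linear_combination h)
  · intro i _ z; simp [hB]; ring
  · intro i hi z; simp [hA i hi]; ring
  · intro i _ i' hi' hne z; simp [hA i' hi', hne]
  · intro i _ i' hi' hne z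
    rw [raise_eq (mem_range.mp hj) (mem_range.mp hi') hne.symm, sub_sub_sub_cancel_right]
  · intro i _ i' _ _ z
    congr 1
    · exact congrArg Neg.neg <| prod_sub_congr (by simp [hB]) fun m hm => by simp [hB, (mem_erase.mp hm).1]
    · exact prod_sub_congr (by simp [hB]) fun m hm => by simp [hB]
  · intro i _ i' hi' hne z
    congr 1
    · exact congrArg Neg.neg <| prod_sub_congr (by simp [hA i' hi', hne]) fun m hm => by simp [hA i' hi']
    · exact prod_sub_congr (by simp [hA i' hi', hne]) fun m hm => by
        simp [hA i' hi', (mem_erase.mp hm).1]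
  · intro i _ z
    exact raise_eq_left (mem_range.mp hj) z
  · intro i _ z
    congr 1
    · exact congrArg Neg.neg <| prod_sub_congr (by simp [hB]) fun m hm => by simp [hB, (mem_erase.mp hm).1]
    · exact prod_sub_congr (by simp [hB]) fun m hm => by simp [hB]
  · intro i hi z
    exact raise_congr (fun m => by simp [hA i hi]) fun m => by
      rw [hA i hi, if_neg (by omega), add_zero]

/-- The dependence is reversed: `raise (k + 1)` ignores row `k`, whereas the coefficient of the
single operator contains all entries of row `k + 1`, including the two that are moved. -/
theorem serre_opE_succ_opE {k : ℕ} (hk : k + 2 < N) :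
    comm (W.opE (k + 1)) (comm (W.opE (k + 1)) (W.opE k)) = 0 := by
  rw [opE, opE, comm_comm_sum]
  refine sum_eq_zero fun j hj => ?_
  have hA : ∀ i ∈ range (k + 2), ∀ z l m, W.entry (z + W.unit (k + 1) i) l m = _ := fun i hi =>
    W.entry_add (by omega) (Nat.lt_succ_iff.mp (mem_range.mp hi))
  have hB := W.entry_add (k := k) (by omega) (Nat.lt_succ_iff.mp (mem_range.mp hj))
  refine sum_comm_comm_eq_zero_of_single (range (k + 2)) (W.raise (k + 1)) (W.unit (k + 1)) _ _ (-1)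
    (fun i z => W.entry z k j - W.entry z (k + 1) i)
    (fun i i' z => -(∏ m ∈ range (k + 3), (W.entry z (k + 1) i - W.entry z (k + 2) m)) /
        ∏ m ∈ ((range (k + 2)).erase i).erase i', (W.entry z (k + 1) i - W.entry z (k + 1) m))
    (fun i i' z =>
      -(∏ m ∈ ((range (k + 2)).erase i).erase i', (W.entry z k j - W.entry z (k + 1) m)) /
        ∏ m ∈ (range (k + 1)).erase j, (W.entry z k j - W.entry z k m))
    (fun i z => -(∏ m ∈ (range (k + 2)).erase i, (W.entry z k j - W.entry z (k + 1) m)) /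
        ∏ m ∈ (range (k + 1)).erase j, (W.entry z k j - W.entry z k m))
    ?_ ?_ ?_ ?_ ?_ ?_ ?_ ?_ ?_ ?_ ?_
  · intro i hi i' hi' hne z h
    rw [mem_range] at hi hi'
    exact W.generic hk (by omega) (by omega) hne z 0 (by
      push_cast; linear_combination h)
  · intro i hi z; simp [hA i hi]; ring
  · intro i _ i' hi' hne z; simp [hA i' hi', hne]
  · intro i _ i' hi' hne z
    rw [raise_eq_right (mem_range.mp hi') hne.symm, sub_sub_sub_cancel_left]
  · intro i hi z
    exact raise_congr (fun m => by simp [hB]) fun m => by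
      rw [hB, if_neg (by omega), add_zero]
  · intro i _ i' hi' hne z
    congr 1
    · exact congrArg Neg.neg <| prod_sub_congr (by simp [hA i' hi', hne]) fun m hm => by simp [hA i' hi']
    · exact prod_sub_congr (by simp [hA i' hi', hne]) fun m hm => by
        simp [hA i' hi', (mem_erase.mp hm).1]
  · intro i hi i' hi' hne z
    exact raise_eq_pair (mem_range.mp hi) (mem_range.mp hi') hne.symm z
  · intro i hi i' _ _ z
    congr 1
    · exact congrArg Neg.neg <| prod_sub_congr (by simp [hA i hi]) fun m hm => by
        simp [hA i hi, (mem_erase.mp (mem_erase.mp hm).2).1]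
    · exact prod_sub_congr (by simp [hA i hi]) fun m hm => by simp [hA i hi]
  · intro i hi i' hi' _ z
    congr 1
    · exact congrArg Neg.neg <| prod_sub_congr (by simp [hA i' hi']) fun m hm => by
        simp [hA i' hi', (mem_erase.mp hm).1]
    · exact prod_sub_congr (by simp [hA i' hi']) fun m hm => by simp [hA i' hi']
  · intro i hi z
    exact raise_eq_left (mem_range.mp hi) z
  · intro i hi z
    congr 1
    · exact congrArg Neg.neg <| prod_sub_congr (by simp [hA i hi]) fun m hm => by
        simp [hA i hi, (mem_erase.mp hm).1]
    · exact prod_sub_congr (by simp [hA i hi]) fun m hm => by simp [hA i hi]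

/-- Lowering coefficients involve the row below instead of the row above. The upper row is therefore
the one whose doubled operator sees the shift of the single one. -/
theorem serre_opF_succ_opF {k : ℕ} (hk : k + 2 < N) :
    comm (W.opF (k + 1)) (comm (W.opF (k + 1)) (W.opF k)) = 0 := by
  rw [opF, opF, comm_comm_sum]
  refine sum_eq_zero fun j hj => ?_
  have hA : ∀ i ∈ range (k + 2), ∀ z l m, W.entry (z + -W.unit (k + 1) i) l m = _ := fun i hi =>
    W.entry_sub (by omega) (Nat.lt_succ_iff.mp (mem_range.mp hi))
  have hB := W.entry_sub (k := k) (by omega) (Nat.lt_succ_iff.mp (mem_range.mp hj))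
  refine sum_comm_comm_eq_zero_of_double (range (k + 2)) (W.lower (k + 1))
    (fun i => -W.unit (k + 1) i) _ _ 1
    (fun i z => W.entry z (k + 1) i - W.entry z k j)
    (fun i i' z => (∏ m ∈ (range (k + 1)).erase j, (W.entry z (k + 1) i - W.entry z k m)) /
        ∏ m ∈ ((range (k + 2)).erase i).erase i', (W.entry z (k + 1) i - W.entry z (k + 1) m))
    (fun i z => (∏ m ∈ (range (k + 1)).erase j, (W.entry z (k + 1) i - W.entry z k m)) /
        ∏ m ∈ (range (k + 2)).erase i, (W.entry z (k + 1) i - W.entry z (k + 1) m))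
    ?_ ?_ ?_ ?_ ?_ ?_ ?_ ?_ ?_ ?_
  · intro i hi i' hi' hne z h
    rw [mem_range] at hi hi'
    exact W.generic hk (by omega) (by omega) hne z 0 (by
      push_cast; linear_combination h)
  · intro i _ z; simp [hB]; ring
  · intro i hi z; simp [hA i hi]; ring
  · intro i _ i' hi' hne z; simp [hA i' hi', hne]
  · intro i _ i' hi' hne z
    rw [lower_eq (mem_range.mp hj) (mem_range.mp hi') hne.symm, sub_sub_sub_cancel_right]
  · intro i _ i' _ _ z
    congr 1
    · exact prod_sub_congr (by simp [hB]) fun m hm => by simp [hB, (mem_erase.mp hm).1]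
    · exact prod_sub_congr (by simp [hB]) fun m hm => by simp [hB]
  · intro i _ i' hi' hne z
    congr 1
    · exact prod_sub_congr (by simp [hA i' hi', hne]) fun m hm => by simp [hA i' hi']
    · exact prod_sub_congr (by simp [hA i' hi', hne]) fun m hm => by
        simp [hA i' hi', (mem_erase.mp hm).1]
  · intro i _ z
    exact lower_eq_left (mem_range.mp hj) z
  · intro i _ z
    congr 1
    · exact prod_sub_congr (by simp [hB]) fun m hm => by simp [hB, (mem_erase.mp hm).1]
    · exact prod_sub_congr (by simp [hB]) fun m hm => by simp [hB]
  · intro i hi z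
    exact lower_congr (fun m => by simp [hA i hi]) fun m _ => by
      rw [hA i hi, if_neg (by omega), sub_zero]

theorem serre_opF_opF_succ {k : ℕ} (hk : k + 2 < N) :
    comm (W.opF k) (comm (W.opF k) (W.opF (k + 1))) = 0 := by
  rw [opF, opF, comm_comm_sum]
  refine sum_eq_zero fun j hj => ?_
  have hA : ∀ i ∈ range (k + 1), ∀ z l m, W.entry (z + -W.unit k i) l m = _ := fun i hi =>
    W.entry_sub (by omega) (Nat.lt_succ_iff.mp (mem_range.mp hi))
  have hB := W.entry_sub (k := k + 1) (by omega) (Nat.lt_succ_iff.mp (mem_range.mp hj))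
  refine sum_comm_comm_eq_zero_of_single (range (k + 1)) (W.lower k) (fun i => -W.unit k i) _ _ 1
    (fun i z => W.entry z (k + 1) j - W.entry z k i)
    (fun i i' z => (∏ m ∈ range k, (W.entry z k i - W.entry z (k - 1) m)) /
        ∏ m ∈ ((range (k + 1)).erase i).erase i', (W.entry z k i - W.entry z k m))
    (fun i i' z =>
      (∏ m ∈ ((range (k + 1)).erase i).erase i', (W.entry z (k + 1) j - W.entry z k m)) /
        ∏ m ∈ (range (k + 2)).erase j, (W.entry z (k + 1) j - W.entry z (k + 1) m))
    (fun i z => (∏ m ∈ (range (k + 1)).erase i, (W.entry z (k + 1) j - W.entry z k m)) /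
        ∏ m ∈ (range (k + 2)).erase j, (W.entry z (k + 1) j - W.entry z (k + 1) m))
    ?_ ?_ ?_ ?_ ?_ ?_ ?_ ?_ ?_ ?_ ?_
  · intro i hi i' hi' hne z h
    rw [mem_range] at hi hi'
    exact W.generic (k := k) (by omega) (by omega) (by omega) hne z 0 (by
      push_cast; linear_combination h)
  · intro i hi z; simp [hA i hi]; ring
  · intro i _ i' hi' hne z; simp [hA i' hi', hne]
  · intro i _ i' hi' hne z
    rw [lower_eq_right (mem_range.mp hi') hne.symm, sub_sub_sub_cancel_left]
  · intro i hi z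
    exact lower_congr (fun m => by simp [hB]) fun m _ => by
      rw [hB, if_neg (by omega), sub_zero]
  · intro i _ i' hi' hne z
    congr 1
    · exact prod_sub_congr (by simp [hA i' hi', hne]) fun m hm => by
        rw [mem_range] at hm; rw [hA i' hi', if_neg (by omega), sub_zero]
    · exact prod_sub_congr (by simp [hA i' hi', hne]) fun m hm => by
        simp [hA i' hi', (mem_erase.mp hm).1]
  · intro i hi i' hi' hne z
    exact lower_eq_pair (mem_range.mp hi) (mem_range.mp hi') hne.symm z
  · intro i hi i' _ _ z
    congr 1
    · exact prod_sub_congr (by simp [hA i hi]) fun m hm => by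
        simp [hA i hi, (mem_erase.mp (mem_erase.mp hm).2).1]
    · exact prod_sub_congr (by simp [hA i hi]) fun m hm => by simp [hA i hi]
  · intro i hi i' hi' _ z
    congr 1
    · exact prod_sub_congr (by simp [hA i' hi']) fun m hm => by
        simp [hA i' hi', (mem_erase.mp hm).1]
    · exact prod_sub_congr (by simp [hA i' hi']) fun m hm => by simp [hA i' hi']
  · intro i hi z
    exact lower_eq_left (mem_range.mp hi) z
  · intro i hi z
    congr 1
    · exact prod_sub_congr (by simp [hA i hi]) fun m hm => by
        simp [hA i hi, (mem_erase.mp hm).1]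
    · exact prod_sub_congr (by simp [hA i hi]) fun m hm => by simp [hA i hi]

end GenericArray

end GT

namespace GT

/-! ### Matrix units of gl(N) from Chevalley generators. -/

section SerreTypeA

variable {L : Type*} [LieRing L]

/-- The commutation relations of the matrix units with indices at most `p`. -/
def IsMatrixUnits (X : ℕ → ℕ → L) (p : ℕ) : Prop :=
  ∀ a b c d, a ≤ p → b ≤ p → c ≤ p → d ≤ p →
    ⁅X a b, X c d⁆ = (if b = c then X a d else 0) - if d = a then X c b else 0

/-- The vector operator generated by `e` under `gl(p + 1)`. -/
def vecOp (X : ℕ → ℕ → L) (p : ℕ) (e : L) (a : ℕ) : L := if a = p then e else ⁅X a p, e⁆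

/-- `e` is a lowest component of a vector operator for the matrix units `X`. -/
structure IsLowest (X : ℕ → ℕ → L) (p : ℕ) (e : L) : Prop where
  zero : ∀ a b, a ≤ p → b < p → ⁅X a b, e⁆ = 0
  self : ⁅X p p, e⁆ = e
  serre : ∀ q, q + 1 = p → ⁅X q p, ⁅X q p, e⁆⁆ = 0
  serre' : ∀ q, q + 1 = p → ⁅e, ⁅X q p, e⁆⁆ = 0

variable {X : ℕ → ℕ → L} {p : ℕ} {e : L}

theorem IsLowest.lie_self (hl : IsLowest X p e) {a b : ℕ} (ha : a ≤ p) (hb : b ≤ p) :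
    ⁅X a b, e⁆ = if b = p then vecOp X p e a else 0 := by
  by_cases h : b = p
  · subst h
    rw [if_pos rfl, vecOp]
    split_ifs with h'
    · subst h'; exact hl.self
    · rfl
  · rw [if_neg h, hl.zero a b ha (by omega)]

theorem IsLowest.lie_vecOp_of_lt (hX : IsMatrixUnits X p) (hl : IsLowest X p e) {a b c : ℕ} (ha : a ≤ p) (hb : b < p) (hc : c ≤ p) :
    ⁅X a b, vecOp X p e c⁆ = if b = c then vecOp X p e a else 0 := by
  by_cases hcp : c = p
  · subst hcp
    rw [if_neg (by omega), vecOp, if_pos rfl, hl.zero a b ha hb]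
  · have hv : vecOp X p e c = ⁅X c p, e⁆ := by rw [vecOp, if_neg hcp]
    rw [hv, leibniz_lie, hX a b c p ha hb.le hc le_rfl, hl.zero a b ha hb, lie_zero, add_zero,
      sub_lie]
    have h0 : ⁅(if p = a then X c b else 0), e⁆ = 0 := by
      split_ifs
      · exact hl.zero c b hc hb
      · exact zero_lie e
    rw [h0, sub_zero]
    split_ifs
    · rw [hl.lie_self ha le_rfl, if_pos rfl]
    · exact zero_lie e

/-- The bracket is symmetric in `a` and `c` because `X a p` and `X c p` commute. The Serre relation
is the case `a = c = p - 1`; bracketing it with `X a (p - 1)` yields twice the case `(a, p - 1)`,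
which is where the absence of 2-torsion is used. Bracketing with `X c (p - 1)` then reaches every
second index. -/
theorem IsLowest.lie_vecOp_last (h2 : ∀ x : L, x + x = 0 → x = 0) (hX : IsMatrixUnits X p)
    (hl : IsLowest X p e) {a c : ℕ} (ha : a < p) (hc : c < p) :
    ⁅X a p, vecOp X p e c⁆ = 0 := by
  obtain ⟨q, rfl⟩ : ∃ q, p = q + 1 := ⟨p - 1, by omega⟩
  have hvq : ∀ c, c < q + 1 → vecOp X (q + 1) e c = ⁅X c (q + 1), e⁆ := fun c hc => by
    rw [vecOp, if_neg (by omega)]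
  have hqq : ⁅X q (q + 1), vecOp X (q + 1) e q⁆ = 0 := by
    rw [hvq q (by omega)]
    exact hl.serre q rfl
  have hsymm : ∀ a c, a < q + 1 → c < q + 1 →
      ⁅X a (q + 1), vecOp X (q + 1) e c⁆ = ⁅X c (q + 1), vecOp X (q + 1) e a⁆ := by
    intro a c ha hc
    rw [hvq c hc, leibniz_lie, hX a (q + 1) c (q + 1) ha.le le_rfl hc.le le_rfl,
      if_neg (by omega), if_neg (by omega), sub_zero, zero_lie, zero_add, hvq a ha]
  have hraise : ∀ a, a < q → ⁅X a (q + 1), vecOp X (q + 1) e q⁆ = 0 := by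
    intro a ha
    have h := congrArg (fun x => ⁅X a q, x⁆) hqq
    simp only [lie_zero] at h
    rw [leibniz_lie, hX a q q (q + 1) (by omega) (by omega) (by omega) le_rfl, if_pos rfl,
      if_neg (by omega), sub_zero, hl.lie_vecOp_of_lt hX (a := a) (b := q) (c := q) (by omega) (by omega)
        (by omega), if_pos rfl, hsymm q a (by omega) (by omega)] at h
    exact h2 _ h
  have hq : ∀ a, a < q + 1 → ⁅X a (q + 1), vecOp X (q + 1) e q⁆ = 0 := by
    intro a ha
    rcases eq_or_ne a q with rfl | hne
    · exact hqq
    · exact hraise a (by omega)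
  rcases eq_or_ne c q with rfl | hcq
  · exact hq a ha
  rcases eq_or_ne a q with rfl | haq
  · rw [hsymm _ _ ha hc]
    exact hq c hc
  have h := congrArg (fun x => ⁅X c q, x⁆) (hq a ha)
  simp only [lie_zero] at h
  rwa [leibniz_lie, hX c q a (q + 1) (by omega) (by omega) (by omega) le_rfl, if_neg (by omega),
    if_neg (by omega), sub_zero, zero_lie, zero_add,
    hl.lie_vecOp_of_lt hX (by omega) (by omega) (by omega), if_pos rfl] at h

theorem IsLowest.lie_vecOp (h2 : ∀ x : L, x + x = 0 → x = 0) (hX : IsMatrixUnits X p)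
    (hl : IsLowest X p e) {a b c : ℕ} (ha : a ≤ p) (hb : b ≤ p) (hc : c ≤ p) :
    ⁅X a b, vecOp X p e c⁆ = if b = c then vecOp X p e a else 0 := by
  rcases hb.lt_or_eq with hb | rfl
  · exact hl.lie_vecOp_of_lt hX ha hb hc
  rcases hc.lt_or_eq with hc | rfl
  · rw [if_neg (by omega)]
    rcases ha.lt_or_eq with ha | rfl
    · exact hl.lie_vecOp_last h2 hX ha hc
    · rw [vecOp, if_neg (by omega), leibniz_lie, hX a a c a le_rfl le_rfl hc.le le_rfl,
        if_neg (by omega), if_pos rfl, hl.self, zero_sub, neg_lie, neg_add_cancel]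
  · have hv : vecOp X c e c = e := by rw [vecOp, if_pos rfl]
    rw [hv, hl.lie_self ha le_rfl]

/-- The second Serre relation says that `e` commutes with component `p - 1`. Bracketing with the `X
a (p - 1)` spreads this to all components, and bracketing with `X a p` replaces `e` by an arbitrary
component. -/
theorem IsLowest.vecOp_lie_vecOp (h2 : ∀ x : L, x + x = 0 → x = 0) (hX : IsMatrixUnits X p)
    (hl : IsLowest X p e) {a b : ℕ} (ha : a ≤ p) (hb : b ≤ p) :
    ⁅vecOp X p e a, vecOp X p e b⁆ = 0 := by
  have hp : vecOp X p e p = e := by rw [vecOp, if_pos rfl]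
  have h1 : ∀ q, q + 1 = p → ∀ a, a < p → ⁅e, vecOp X p e a⁆ = 0 := by
    intro q hq a ha
    have h0 : ⁅e, vecOp X p e q⁆ = 0 := by
      rw [vecOp, if_neg (by omega)]
      exact hl.serre' q hq
    rcases eq_or_ne a q with rfl | hne
    · exact h0
    have h := congrArg (fun x => ⁅X a q, x⁆) h0
    simp only [lie_zero] at h
    rwa [leibniz_lie, hl.zero a q (by omega) (by omega), zero_lie, zero_add,
      hl.lie_vecOp h2 hX (by omega) (by omega) (by omega), if_pos rfl] at h
  have h1' : ∀ a, a ≤ p → ⁅e, vecOp X p e a⁆ = 0 := by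
    intro a ha
    rcases ha.lt_or_eq with ha | rfl
    · exact h1 (p - 1) (by omega) a ha
    · rw [hp]
      exact _root_.lie_self e
  rcases ha.lt_or_eq with ha | rfl
  · rcases hb.lt_or_eq with hb | rfl
    · have h := congrArg (fun x => ⁅X a p, x⁆) (h1' b hb.le)
      simp only [lie_zero] at h
      rwa [leibniz_lie, hl.lie_self ha.le le_rfl, if_pos rfl,
        hl.lie_vecOp h2 hX ha.le le_rfl hb.le, if_neg (by omega), lie_zero, add_zero] at h
    · rw [hp, ← lie_skew, h1' a ha.le, neg_zero]
  · rw [hp]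
    exact h1' b hb

/-- The negative transpose is an automorphism of gl, so each statement about the new column made of
raising vectors also gives the statement about the new row made of lowering vectors. -/
theorem IsMatrixUnits.neg_transpose (hX : IsMatrixUnits X p) :
    IsMatrixUnits (fun a b => -X b a) p := by
  intro a b c d ha hb hc hd
  rw [neg_lie, lie_neg, neg_neg, hX b a d c hb ha hd hc]
  simp only [eq_comm (a := d) (b := a), eq_comm (a := b) (b := c)]
  split_ifs <;> abel

/-- The relations between a vector operator, a dual vector operator and the matrix units. -/
theorem vecOp_lie_dual {f k : L} (h2 : ∀ x : L, x + x = 0 → x = 0) (hX : IsMatrixUnits X p)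
    (hl : IsLowest X p e) (hl' : IsLowest (fun a b => -X b a) p f)
    (hef : ⁅e, f⁆ = X p p - k) (hk : ∀ a b, a ≤ p → b ≤ p → ⁅X a b, k⁆ = 0)
    {a b : ℕ} (ha : a ≤ p) (hb : b ≤ p) :
    ⁅vecOp X p e a, vecOp (fun a b => -X b a) p f b⁆ = X a b - if a = b then k else 0 := by
  have hX' := hX.neg_transpose
  have hp : vecOp X p e p = e := by rw [vecOp, if_pos rfl]
  have hp' : vecOp (fun a b => -X b a) p f p = f := by rw [vecOp, if_pos rfl]
  set Y : ℕ → ℕ → L := fun a b => ⁅vecOp X p e a, vecOp (fun a b => -X b a) p f b⁆ with hY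
  have hd : ∀ a b c, a ≤ p → b ≤ p → c ≤ p → ⁅X a b, vecOp (fun a b => -X b a) p f c⁆ =
      -if a = c then vecOp (fun a b => -X b a) p f b else 0 := by
    intro a b c ha hb hc
    rw [← hl'.lie_vecOp h2 hX' hb ha hc, neg_lie, neg_neg]
  -- Under the `X a b` the brackets `Y` transform like matrix units. All of them are therefore
  -- determined by `Y p p`, which is the prescribed bracket of `e` and `f`.
  have hYt : ∀ a b c d, a ≤ p → b ≤ p → c ≤ p → d ≤ p →
      ⁅X a b, Y c d⁆ = (if b = c then Y a d else 0) - if a = d then Y c b else 0 := by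
    intro a b c d ha hb hc hd'
    simp only [hY]
    rw [leibniz_lie, hl.lie_vecOp h2 hX ha hb hc, hd a b d ha hb hd', lie_neg, ← sub_eq_add_neg]
    congr 1
    · split_ifs
      · rfl
      · exact zero_lie _
    · split_ifs
      · rfl
      · exact lie_zero _
  have hpp : Y p p = X p p - k := by simp only [hY]; rw [hp, hp', hef]
  have hap : ∀ a, a < p → Y a p = X a p := by
    intro a ha
    have h := hYt a p p p ha.le le_rfl le_rfl le_rfl
    rw [if_pos rfl, if_neg (by omega), sub_zero, hpp, lie_sub, hk a p ha.le le_rfl, sub_zero,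
      hX a p p p ha.le le_rfl le_rfl le_rfl, if_pos rfl, if_neg (by omega), sub_zero] at h
    exact h.symm
  have hpb : ∀ b, b < p → Y p b = X p b := by
    intro b hb
    have h := hYt p b p p le_rfl hb.le le_rfl le_rfl
    rw [if_pos rfl, if_neg (by omega), zero_sub, hpp, lie_sub, hk p b le_rfl hb.le, sub_zero,
      hX p b p p le_rfl hb.le le_rfl le_rfl, if_pos rfl, if_neg (by omega), zero_sub] at h
    exact (neg_injective h).symm
  change Y a b = _
  rcases ha.lt_or_eq with ha | rfl
  · rcases hb.lt_or_eq with hb | rfl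
    · have h := hYt a p p b ha.le le_rfl le_rfl hb.le
      rw [if_pos rfl, hpb b hb, hX a p p b ha.le le_rfl le_rfl hb.le, if_pos rfl] at h
      by_cases hab : a = b
      · subst hab
        rw [if_pos rfl, if_pos rfl, hpp] at h
        rw [if_pos rfl, sub_eq_iff_eq_add.mp h.symm]
        abel
      · rw [if_neg hab, if_neg (Ne.symm hab), sub_zero, sub_zero] at h
        rw [if_neg hab, sub_zero, h]
    · rw [if_neg (by omega), sub_zero, hap a ha]
  · rcases hb.lt_or_eq with hb | rfl
    · rw [if_neg (by omega), sub_zero, hpb b hb]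
    · rw [if_pos rfl, hpp]

/-- The Chevalley–Serre relations of `gl(N)`. -/
structure IsChevalley (N : ℕ) (e f h : ℕ → L) : Prop where
  hh : ∀ k l, ⁅h k, h l⁆ = 0
  he : ∀ k l, k + 1 < N →
    ⁅h l, e k⁆ = ((if l = k then 1 else 0) - if l = k + 1 then 1 else 0 : ℤ) • e k
  hf : ∀ k l, k + 1 < N →
    ⁅h l, f k⁆ = (-((if l = k then 1 else 0) - if l = k + 1 then 1 else 0 : ℤ)) • f k
  ef_self : ∀ k, k + 1 < N → ⁅e k, f k⁆ = h k - h (k + 1)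
  ef_ne : ∀ k l, k + 1 < N → l + 1 < N → k ≠ l → ⁅e k, f l⁆ = 0
  ee : ∀ k l, l + 1 < N → k + 1 < l → ⁅e k, e l⁆ = 0
  ff : ∀ k l, l + 1 < N → k + 1 < l → ⁅f k, f l⁆ = 0
  serre_e : ∀ k, k + 2 < N → ⁅e k, ⁅e k, e (k + 1)⁆⁆ = 0
  serre_e' : ∀ k, k + 2 < N → ⁅e (k + 1), ⁅e (k + 1), e k⁆⁆ = 0
  serre_f : ∀ k, k + 2 < N → ⁅f k, ⁅f k, f (k + 1)⁆⁆ = 0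
  serre_f' : ∀ k, k + 2 < N → ⁅f (k + 1), ⁅f (k + 1), f k⁆⁆ = 0

/-- Iterated brackets of the raising generators. -/
def upVec (e : ℕ → L) (a : ℕ) : ℕ → L
  | 0 => 0
  | b + 1 => if a = b then e b else ⁅upVec e a b, e b⁆

/-- Iterated brackets of the lowering generators. -/
def downVec (f : ℕ → L) (a : ℕ) : ℕ → L
  | 0 => 0
  | b + 1 => if a = b then f b else ⁅f b, downVec f a b⁆

/-- The matrix units generated by Chevalley generators. -/
def rootVec (e f h : ℕ → L) (a b : ℕ) : L :=
  if a < b then upVec e a b else if b < a then downVec f b a else h a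

variable {e f h : ℕ → L}

theorem rootVec_self (a : ℕ) : rootVec e f h a a = h a := by simp [rootVec]

theorem rootVec_succ (a : ℕ) : rootVec e f h a (a + 1) = e a := by simp [rootVec, upVec]

theorem rootVec_pred (a : ℕ) : rootVec e f h (a + 1) a = f a := by simp [rootVec, downVec]

theorem rootVec_up {a b : ℕ} (hab : a < b) :
    rootVec e f h a (b + 1) = ⁅rootVec e f h a b, e b⁆ := by
  rw [rootVec, if_pos (by omega), upVec, if_neg (by omega), rootVec, if_pos hab]

theorem rootVec_down {a b : ℕ} (hab : a < b) :
    rootVec e f h (b + 1) a = ⁅f b, rootVec e f h b a⁆ := by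
  rw [rootVec, if_neg (by omega), if_pos (by omega), downVec, if_neg (by omega), rootVec,
    if_neg (by omega), if_pos hab]

/-- The centralizer of `y` is closed under brackets, and a root vector is an iterated bracket of the
generators with indices between `a` and `b`. -/
theorem rootVec_lie_eq_zero {y : L} {a b : ℕ} (he : ∀ k, k < b → ⁅e k, y⁆ = 0)
    (hf : ∀ k, k < a → ⁅f k, y⁆ = 0) (hh : a = b → ⁅h a, y⁆ = 0) : ⁅rootVec e f h a b, y⁆ = 0 := by
  rcases lt_trichotomy a b with hab | rfl | hab
  · obtain ⟨c, rfl⟩ := Nat.exists_eq_add_of_lt hab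
    clear hab
    induction c with
    | zero => rw [add_zero, rootVec_succ]; exact he a (by omega)
    | succ c ih =>
      rw [← add_assoc, rootVec_up (by omega), lie_lie, he _ (by omega),
        ih (fun k hk => he k (by omega)) (fun h => absurd h (by omega)), lie_zero, lie_zero,
        sub_zero]
  · rw [rootVec_self]
    exact hh rfl
  · obtain ⟨c, rfl⟩ := Nat.exists_eq_add_of_lt hab
    clear hab
    induction c with
    | zero => rw [add_zero, rootVec_pred]; exact hf b (by omega)
    | succ c ih =>
      rw [← add_assoc, rootVec_down (by omega), lie_lie, hf _ (by omega),
        ih (fun k hk => hf k (by omega)) (fun h => absurd h (by omega)), lie_zero, lie_zero,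
        sub_zero]

namespace IsChevalley

variable {N : ℕ}

theorem isLowest_e (H : IsChevalley N e f h) {p : ℕ} (hp : p + 1 < N) : IsLowest (rootVec e f h) p (e p) where
  zero a b ha hb := by
    refine rootVec_lie_eq_zero (fun k hk => H.ee k p hp (by omega)) (fun k hk => ?_) fun hab => ?_
    · rw [← lie_skew, H.ef_ne p k hp (by omega) (by omega), neg_zero]
    · rw [H.he p a hp, if_neg (by omega), if_neg (by omega), sub_zero, zero_smul]
  self := by rw [rootVec_self, H.he p p hp]; simp
  serre q hq := by
    subst hq
    rw [rootVec_succ]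
    exact H.serre_e q hp
  serre' q hq := by
    subst hq
    rw [rootVec_succ, ← lie_skew (e q) (e (q + 1)), lie_neg, H.serre_e' q hp, neg_zero]

theorem isLowest_f (H : IsChevalley N e f h) {p : ℕ} (hp : p + 1 < N) :
    IsLowest (fun a b => -rootVec e f h b a) p (f p) where
  zero a b ha hb := by
    rw [neg_lie, neg_eq_zero]
    refine rootVec_lie_eq_zero (fun k hk => H.ef_ne k p (by omega) hp (by omega))
      (fun k hk => H.ff k p hp (by omega)) fun hab => ?_
    rw [H.hf p b hp, if_neg (by omega), if_neg (by omega), sub_zero, neg_zero, zero_smul]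
  self := by rw [rootVec_self, neg_lie, H.hf p p hp]; simp
  serre q hq := by
    subst hq
    rw [rootVec_pred, neg_lie, neg_lie, lie_neg, neg_neg]
    exact H.serre_f q hp
  serre' q hq := by
    subst hq
    rw [rootVec_pred, neg_lie, lie_neg, ← lie_skew (f q) (f (q + 1)), lie_neg, neg_neg,
      H.serre_f' q hp]

/-- Induction on the size of the block. The new column is the vector operator generated by `e p`,
the new row is the dual one generated by `f p`, and the new corner `h (p + 1)` commutes with the old
block. The sixteen cases record which of the four indices are new. -/
theorem isMatrixUnits (H : IsChevalley N e f h) (h2 : ∀ x : L, x + x = 0 → x = 0) {p : ℕ} (hp : p < N) :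
    IsMatrixUnits (rootVec e f h) p := by
  induction p with
  | zero =>
    intro a b c d ha hb hc hd
    obtain rfl : a = 0 := by omega
    obtain rfl : b = 0 := by omega
    obtain rfl : c = 0 := by omega
    obtain rfl : d = 0 := by omega
    rw [lie_self]; simp
  | succ p ih =>
    set X := rootVec e f h with hXdef
    have hX := ih (by omega)
    have hl := H.isLowest_e hp
    have hl' := H.isLowest_f hp
    have hk : ∀ a b, a ≤ p → b ≤ p → ⁅X a b, h (p + 1)⁆ = 0 := by
      intro a b ha hb
      refine rootVec_lie_eq_zero (fun k hk => ?_) (fun k hk => ?_) fun _ => H.hh _ _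
      · rw [← lie_skew, H.he k _ (by omega), if_neg (by omega), if_neg (by omega)]; simp
      · rw [← lie_skew, H.hf k _ (by omega), if_neg (by omega), if_neg (by omega)]; simp
    have hef : ⁅e p, f p⁆ = X p p - h (p + 1) := by
      rw [H.ef_self p hp, hXdef, rootVec_self]
    have hup : ∀ a, a ≤ p → X a (p + 1) = vecOp X p (e p) a := by
      intro a ha
      rw [vecOp]
      split_ifs with h
      · rw [h]; exact rootVec_succ p
      · exact rootVec_up (by omega)
    have hdn : ∀ a, a ≤ p → X (p + 1) a = vecOp (fun a b => -X b a) p (f p) a := by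
      intro a ha
      rw [vecOp]
      split_ifs with h
      · rw [h]; exact rootVec_pred p
      · rw [neg_lie, lie_skew]; exact rootVec_down (by omega)
    have hkk : X (p + 1) (p + 1) = h (p + 1) := rootVec_self _
    have mv : ∀ a b c, a ≤ p → b ≤ p → c ≤ p →
        ⁅X a b, X c (p + 1)⁆ = if b = c then X a (p + 1) else 0 := by
      intro a b c ha hb hc
      rw [hup c hc, hup a ha, hl.lie_vecOp h2 hX ha hb hc]
    have md : ∀ a b c, a ≤ p → b ≤ p → c ≤ p →
        ⁅X a b, X (p + 1) c⁆ = -if c = a then X (p + 1) b else 0 := by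
      intro a b c ha hb hc
      have := hl'.lie_vecOp h2 hX.neg_transpose hb ha hc
      rw [neg_lie] at this
      rw [hdn c hc, hdn b hb, ← neg_eq_iff_eq_neg, this]
      simp only [eq_comm]
    have vv : ∀ a b, a ≤ p → b ≤ p → ⁅X a (p + 1), X b (p + 1)⁆ = 0 := by
      intro a b ha hb
      rw [hup a ha, hup b hb, hl.vecOp_lie_vecOp h2 hX ha hb]
    have dd : ∀ a b, a ≤ p → b ≤ p → ⁅X (p + 1) a, X (p + 1) b⁆ = 0 := by
      intro a b ha hb
      rw [hdn a ha, hdn b hb, hl'.vecOp_lie_vecOp h2 hX.neg_transpose ha hb]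
    have vd : ∀ a b, a ≤ p → b ≤ p →
        ⁅X a (p + 1), X (p + 1) b⁆ = X a b - if b = a then X (p + 1) (p + 1) else 0 := by
      intro a b ha hb
      rw [hup a ha, hdn b hb, vecOp_lie_dual h2 hX hl hl' hef hk ha hb, hkk]
      simp only [eq_comm]
    have kv : ∀ a, a ≤ p → ⁅X (p + 1) (p + 1), X a (p + 1)⁆ = -X a (p + 1) := by
      intro a ha
      have he : ⁅h (p + 1), e p⁆ = -e p := by rw [H.he p _ hp]; simp
      rw [hkk, hup a ha, vecOp]
      split_ifs with h'
      · exact he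
      · rw [leibniz_lie, ← lie_skew (h (p + 1)) (X a p), hk a p ha le_rfl, he]; simp
    have kd : ∀ a, a ≤ p → ⁅X (p + 1) (p + 1), X (p + 1) a⁆ = X (p + 1) a := by
      intro a ha
      have he : ⁅h (p + 1), f p⁆ = f p := by rw [H.hf p _ hp]; simp
      rw [hkk, hdn a ha, vecOp]
      split_ifs with h'
      · exact he
      · rw [leibniz_lie, lie_neg, ← lie_skew (h (p + 1)) (X p a), hk p a le_rfl ha, he]; simp
    intro a b c d ha hb hc hd
    have cases : ∀ x, x ≤ p + 1 → x ≤ p ∨ x = p + 1 := fun x hx => by omega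
    have hne : ∀ x, x ≤ p → x ≠ p + 1 := fun x hx => by omega
    rcases cases a ha with ha | rfl <;> rcases cases b hb with hb | rfl <;>
      rcases cases c hc with hc | rfl <;> rcases cases d hd with hd | rfl
    · exact hX a b c d ha hb hc hd
    · rw [mv a b c ha hb hc, if_neg (hne a ha).symm, sub_zero]
    · rw [md a b d ha hb hd, if_neg (hne b hb), zero_sub]
    · rw [hkk, hk a b ha hb, if_neg (hne b hb), if_neg (hne a ha).symm, sub_zero]
    · rw [← lie_skew, mv c d a hc hd ha, if_neg (hne c hc).symm, zero_sub]
    · rw [vv a c ha hc, if_neg (hne c hc).symm, if_neg (hne a ha).symm, sub_zero]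
    · rw [vd a d ha hd, if_pos rfl]
    · rw [← lie_skew, kv a ha, neg_neg, if_pos rfl, if_neg (hne a ha).symm, sub_zero]
    · rw [← lie_skew, md c d b hc hd hb, neg_neg, if_neg (hne d hd), sub_zero]
    · rw [← lie_skew, vd c b hc hb, if_pos rfl, neg_sub]
    · rw [dd b d hb hd, if_neg (hne b hb), if_neg (hne d hd), sub_zero]
    · rw [← lie_skew, kd b hb, if_neg (hne b hb), if_pos rfl, zero_sub]
    · rw [hkk, ← lie_skew, hk c d hc hd, if_neg (hne c hc).symm, if_neg (hne d hd)]; simp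
    · rw [kv c hc, if_neg (hne c hc).symm, if_pos rfl, zero_sub]
    · rw [kd d hd, if_pos rfl, if_neg (hne d hd), sub_zero]
    · rw [lie_self]; simp

end IsChevalley

end SerreTypeA

end GT

namespace GT

/-! ### Representations of `gl(n)` from matrix units -/

section MatrixLieHom

variable {A : Type*} [Ring A] [Algebra ℂ A] {n : ℕ}

/-- The Lie algebra homomorphism on `gl(n)` determined by the images of the matrix units. -/
def matrixLieHom (X : Fin n → Fin n → A)
    (hX : ∀ a b c d, comm (X a b) (X c d) =
      (if b = c then X a d else 0) - if d = a then X c b else 0) : gl n →ₗ⁅ℂ⁆ A where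
  toFun g := ∑ r, ∑ s, g r s • X r s
  map_add' g g' := by simp [add_smul, sum_add_distrib]
  map_smul' c g := by simp [mul_smul, smul_sum]
  map_lie' := by
    intro g g'
    have h1 : ∀ g g' : gl n, ∑ r, ∑ s, (g * g') r s • X r s =
        ∑ a, ∑ b, ∑ c, ∑ d, (g a b * g' c d) • (if b = c then X a d else 0) := by
      intro g g'
      simp only [Matrix.mul_apply, sum_smul, smul_ite, smul_zero]
      refine sum_congr rfl fun a _ => ?_
      rw [sum_comm]
      refine sum_congr rfl fun b _ => ?_
      rw [sum_comm]
      refine sum_congr rfl fun d _ => ?_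
      rw [sum_ite_eq, if_pos (mem_univ _)]
    have h2 : ∑ r, ∑ s, (g' * g) r s • X r s =
        ∑ a, ∑ b, ∑ c, ∑ d, (g a b * g' c d) • (if d = a then X c b else 0) := by
      rw [h1]
      have : ∀ a b c d, (g' a b * g c d) • (if b = c then X a d else 0) =
        (g c d * g' a b) • (if b = c then X a d else 0) := fun a b c d => by rw [mul_comm]
      simp only [this]
      rw [sum_congr rfl fun a _ => sum_comm, sum_comm]
      refine sum_congr rfl fun c _ => ?_
      rw [sum_congr rfl fun a _ => sum_comm, sum_comm]
    have h3 : ∀ r s, (⁅g, g'⁆ : gl n) r s = (g * g') r s - (g' * g) r s := fun r s => rfl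
    have h4 : ∀ x y : A, ⁅x, y⁆ = comm x y := fun x y => rfl
    have h5 : ∀ (c d : ℂ) (x y : A), comm (c • x) (d • y) = (c * d) • comm x y := by
      intro c d x y
      simp only [comm, smul_mul_smul_comm, mul_comm d c, smul_sub]
    simp only [h3, sub_smul, sum_sub_distrib]
    rw [h1, h2, h4]
    have h6 : ∀ F : Fin n → Fin n → Fin n → Fin n → A,
        ∑ c, ∑ d, ∑ a, ∑ b, F a b c d = ∑ a, ∑ b, ∑ c, ∑ d, F a b c d := by
      intro F
      rw [sum_congr rfl fun c _ => sum_comm, sum_comm]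
      refine sum_congr rfl fun a _ => ?_
      rw [sum_congr rfl fun c _ => sum_comm, sum_comm]
    simp only [sum_comm_left, comm_sum, h5, hX, smul_sub, sum_sub_distrib]
    rw [h6 fun a b c d => (g a b * g' c d) • if b = c then X a d else 0,
      h6 fun a b c d => (g a b * g' c d) • if d = a then X c b else 0]

theorem matrixLieHom_E (X : Fin n → Fin n → A) (hX) (r s : Fin n) :
    matrixLieHom X hX (E r s) = X r s := by
  change ∑ a, ∑ b, (E r s) a b • X a b = X r s
  rw [sum_eq_single r, sum_eq_single s]
  · simp [E]
  · intro b _ hb; simp [E, hb.symm]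
  · simp
  · intro a _ ha
    exact sum_eq_zero fun b _ => by simp [E, ha.symm]
  · simp

end MatrixLieHom

/-! ### Chevalley generators in an associative ring -/

section AssociativeUnits

variable {A : Type*} [Ring A]

/-- The matrix units generated by Chevalley generators in an associative ring. -/
def unitsOf (e f h : ℕ → A) : ℕ → ℕ → A := rootVec e f h

variable {e f h : ℕ → A}

theorem unitsOf_self (a : ℕ) : unitsOf e f h a a = h a := rootVec_self a

theorem unitsOf_succ (a : ℕ) : unitsOf e f h a (a + 1) = e a := rootVec_succ a

theorem unitsOf_pred (a : ℕ) : unitsOf e f h (a + 1) a = f a := rootVec_pred a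

theorem unitsOf_up {a b : ℕ} (hab : a < b) :
    unitsOf e f h a (b + 1) = comm (unitsOf e f h a b) (e b) := rootVec_up hab

theorem unitsOf_down {a b : ℕ} (hab : a < b) :
    unitsOf e f h (b + 1) a = comm (f b) (unitsOf e f h b a) := rootVec_down hab

/-- A property of operators that holds for the Chevalley generators and is closed under
commutators holds for all matrix units. -/
theorem unitsOf_induction {N : ℕ} (P : A → Prop) (hh : ∀ k, k < N → P (h k))
    (he : ∀ k, k + 1 < N → P (e k)) (hf : ∀ k, k + 1 < N → P (f k))
    (hc : ∀ x y, P x → P y → P (comm x y)) {a b : ℕ} (ha : a < N) (hb : b < N) :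
    P (unitsOf e f h a b) := by
  rcases lt_trichotomy a b with hab | rfl | hab
  · obtain ⟨c, rfl⟩ := Nat.exists_eq_add_of_lt hab
    clear hab
    induction c with
    | zero => rw [add_zero, unitsOf_succ]; exact he a hb
    | succ c ih =>
      rw [← add_assoc, unitsOf_up (by omega)]
      exact hc _ _ (ih (by omega)) (he _ (by omega))
  · rw [unitsOf_self]
    exact hh a ha
  · obtain ⟨c, rfl⟩ := Nat.exists_eq_add_of_lt hab
    clear hab
    induction c with
    | zero => rw [add_zero, unitsOf_pred]; exact hf b ha
    | succ c ih =>
      rw [← add_assoc, unitsOf_down (by omega)]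
      exact hc _ _ (hf _ (by omega)) (ih (by omega))

/-- The bracket-free form for operators: in an associative ring the Lie bracket is `comm` by
definition. -/
theorem unitsOf_comm {N : ℕ} (h2 : ∀ x : A, x + x = 0 → x = 0)
    (hh : ∀ k l, comm (h k) (h l) = 0)
    (he : ∀ k l, k + 1 < N →
      comm (h l) (e k) = ((if l = k then 1 else 0) - if l = k + 1 then 1 else 0 : ℤ) • e k)
    (hf : ∀ k l, k + 1 < N →
      comm (h l) (f k) = (-((if l = k then 1 else 0) - if l = k + 1 then 1 else 0 : ℤ)) • f k)
    (ef_self : ∀ k, k + 1 < N → comm (e k) (f k) = h k - h (k + 1))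
    (ef_ne : ∀ k l, k + 1 < N → l + 1 < N → k ≠ l → comm (e k) (f l) = 0)
    (ee : ∀ k l, l + 1 < N → k + 1 < l → comm (e k) (e l) = 0)
    (ff : ∀ k l, l + 1 < N → k + 1 < l → comm (f k) (f l) = 0)
    (serre_e : ∀ k, k + 2 < N → comm (e k) (comm (e k) (e (k + 1))) = 0)
    (serre_e' : ∀ k, k + 2 < N → comm (e (k + 1)) (comm (e (k + 1)) (e k)) = 0)
    (serre_f : ∀ k, k + 2 < N → comm (f k) (comm (f k) (f (k + 1))) = 0)
    (serre_f' : ∀ k, k + 2 < N → comm (f (k + 1)) (comm (f (k + 1)) (f k)) = 0)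
    {a b c d : ℕ} (ha : a < N) (hb : b < N) (hc : c < N) (hd : d < N) :
    comm (unitsOf e f h a b) (unitsOf e f h c d) =
      (if b = c then unitsOf e f h a d else 0) - if d = a then unitsOf e f h c b else 0 := by
  have H : IsChevalley N e f h :=
    ⟨hh, he, hf, ef_self, ef_ne, ee, ff, serre_e, serre_e', serre_f, serre_f'⟩
  exact H.isMatrixUnits h2 (p := N - 1) (by omega) a b c d (by omega) (by omega) (by omega)
    (by omega)

end AssociativeUnits

/-! ### The generic array of rational functions -/

/-- Here `ent` counts rows and entries from one while `Idx` counts from zero. Arrays are indexed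
from zero below, with one added to both arguments whenever `ent` is used. -/
theorem ent_eq {n : ℕ} {F : Type} [Field F] (w : Tab n F) {k i : ℕ} (hk : k < n) (hi : i ≤ k) :
    ent w (k + 1) (i + 1) = w ⟨⟨k, hk⟩, ⟨i, Nat.lt_succ_iff.mpr hi⟩⟩ := by
  rw [ent, dif_pos (by omega)]
  rfl

theorem ent_eq_zero {n : ℕ} {F : Type} [Field F] (w : Tab n F) {k i : ℕ}
    (h : ¬(i ≤ k ∧ k < n)) : ent w (k + 1) (i + 1) = 0 := by
  rw [ent, dif_neg (by omega)]

/-- The tableau with entry `1` at the position `(k, i)`, rows and entries counted from zero. -/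
def unitShift (n k i : ℕ) : Shift n :=
  ⟨fun p => if p.1.val = k ∧ p.2.val = i ∧ k + 1 < n then 1 else 0, fun p hp => by
    refine if_neg ?_
    rintro ⟨h1, -, h3⟩
    omega⟩

theorem xTab_add {n : ℕ} (z z' : Shift n) (p : Idx n) :
    xTab (z + z') p = xTab z p + ((z'.1 p : ℤ) : RatFun n) := by
  simp [xTab, add_assoc]

theorem ent_xTab_add {n : ℕ} (z z' : Shift n) {k i : ℕ} (hk : k < n) (hi : i ≤ k) :
    ent (xTab (z + z')) (k + 1) (i + 1) = ent (xTab z) (k + 1) (i + 1) +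
      ((z'.1 ⟨⟨k, hk⟩, ⟨i, Nat.lt_succ_iff.mpr hi⟩⟩ : ℤ) : RatFun n) := by
  rw [ent_eq _ hk hi, ent_eq _ hk hi, xTab_add]

theorem xTab_sub_ne {n : ℕ} (z : Shift n) {p q : Idx n} (hpq : p ≠ q) (m : ℤ) :
    xTab z p - xTab z q ≠ m := by
  intro h
  have h1 : algebraMap (Poly n) (RatFun n)
      (MvPolynomial.X p - MvPolynomial.X q + MvPolynomial.C ((z.1 p - z.1 q - m : ℤ) : ℂ)) =
        algebraMap (Poly n) (RatFun n) 0 := by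
    have : ∀ k : ℤ, (MvPolynomial.C (k : ℂ) : Poly n) = (k : Poly n) := fun k => by simp
    rw [this]
    simp only [xTab] at h
    simp only [map_add, map_sub, map_intCast, map_zero]
    push_cast
    linear_combination h
  -- The point is chosen so that the polynomial, which is supposed to be zero, takes the value `1`
  -- there.
  have h2 := congrArg (MvPolynomial.eval fun r => if r = p then
    1 - ((z.1 p - z.1 q - m : ℤ) : ℂ) else 0) (IsFractionRing.injective (Poly n) (RatFun n) h1)
  simp [hpq.symm] at h2

/-- The array of the entries of `x + z`. -/
def genArray (n : ℕ) : GenericArray (RatFun n) (Shift n) n where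
  entry z k i := ent (xTab z) (k + 1) (i + 1)
  unit k i := unitShift n k i
  entry_add := by
    intro k i hk hi z l j
    by_cases h : j ≤ l ∧ l < n
    · rw [ent_xTab_add z _ h.2 h.1]
      simp only [unitShift, hk, and_true]
      split_ifs <;> simp
    · rw [ent_eq_zero _ h, ent_eq_zero _ h, if_neg (by omega), add_zero]
  generic := by
    intro k i j hk hi hj hij z m
    rw [ent_eq _ (by omega) hi, ent_eq _ (by omega) hj]
    refine xTab_sub_ne z ?_ m
    intro h
    simp at h
    exact hij h

/-- The operator representing the matrix unit `E_{ab}` on the generic module. -/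
def genUnit (n a b : ℕ) : Module.End (RatFun n) (GenSpace n) :=
  unitsOf (genArray n).opE (genArray n).opF (genArray n).opH a b

instance ratFun_charZero (n : ℕ) : CharZero (RatFun n) :=
  charZero_of_injective_algebraMap (IsFractionRing.injective (Poly n) (RatFun n))

theorem genUnit_comm {n a b c d : ℕ} (ha : a < n) (hb : b < n) (hc : c < n) (hd : d < n) :
    comm (genUnit n a b) (genUnit n c d) =
      (if b = c then genUnit n a d else 0) - if d = a then genUnit n c b else 0 := by
  refine unitsOf_comm (N := n) ?_ (genArray n).comm_opH_opH
    (fun k l hk => (genArray n).comm_opH_opE hk l) (fun k l hk => (genArray n).comm_opH_opF hk l)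
    (fun k hk => (genArray n).comm_opE_opF_self hk)
    (fun k l hk hl hkl => (genArray n).comm_opE_opF_of_ne hk hl hkl)
    (fun k l hl hkl => (genArray n).comm_opE_opE_of_lt hl hkl)
    (fun k l hl hkl => (genArray n).comm_opF_opF_of_lt hl hkl)
    (fun k hk => (genArray n).serre_opE_opE_succ hk)
    (fun k hk => (genArray n).serre_opE_succ_opE hk)
    (fun k hk => (genArray n).serre_opF_opF_succ hk)
    (fun k hk => (genArray n).serre_opF_succ_opF hk) ha hb hc hd
  intro x hx
  refine LinearMap.ext fun y => ?_
  have h3 : x y + x y = 0 := by rw [← LinearMap.add_apply, hx]; rfl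
  exact self_eq_neg.mp (eq_neg_of_add_eq_zero_left h3)

/-- The generic module. -/
def genRep (n : ℕ) : gl n →ₗ⁅ℂ⁆ Module.End (RatFun n) (GenSpace n) :=
  matrixLieHom (fun r s => genUnit n r s) fun a b c d => by
    rw [genUnit_comm a.2 b.2 c.2 d.2]
    simp only [Fin.ext_iff]

theorem genRep_E {n : ℕ} (r s : Fin n) : genRep n (E r s) = genUnit n r s :=
  matrixLieHom_E _ _ r s

end GT

namespace GT

/-! ### The explicit action of the matrix units -/

theorem prod_Icc_one {M : Type*} [CommMonoid M] (m : ℕ) (g : ℕ → M) :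
    ∏ p ∈ Icc 1 m, g p = ∏ j ∈ range m, g (j + 1) :=
  prod_nbij' (fun p => p - 1) (fun j => j + 1) (by simp; omega) (by simp)
    (by simp; omega) (by simp) fun p hp => by
      rw [mem_Icc] at hp; rw [Nat.sub_add_cancel hp.1]

theorem prod_Icc_two {M : Type*} [CommMonoid M] (k : ℕ) (g : ℕ → M) :
    ∏ p ∈ Icc 2 (k + 1), g p = ∏ j ∈ (range (k + 1)).erase 0, g (j + 1) :=
  prod_nbij' (fun p => p - 1) (fun j => j + 1) (by simp; omega) (by simp; omega)
    (by simp; omega) (by simp) fun p hp => by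
      rw [mem_Icc] at hp; rw [Nat.sub_add_cancel (by omega)]

theorem swap_zero_le {c j k : ℕ} (hc : c ≤ k) (hj : j ≤ k) : Equiv.swap 0 c j ≤ k := by
  rw [Equiv.swap_apply_def]
  split_ifs <;> omega

theorem prod_erase_swap {M : Type*} [CommMonoid M] {k c : ℕ} (hc : c ≤ k) (g : ℕ → M) :
    ∏ j ∈ (range (k + 1)).erase 0, g (Equiv.swap 0 c j) = ∏ j ∈ (range (k + 1)).erase c, g j := by
  refine prod_nbij' (Equiv.swap 0 c) (Equiv.swap 0 c) ?_ ?_ (by simp) (by simp) (by simp)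
  · intro j hj
    rw [mem_erase, mem_range] at hj ⊢
    refine ⟨fun h => hj.1 ?_, Nat.lt_succ_iff.mpr (swap_zero_le hc (by omega))⟩
    rw [← Equiv.swap_apply_left 0 c] at h
    exact (Equiv.swap 0 c).injective h
  · intro j hj
    rw [mem_erase, mem_range] at hj ⊢
    refine ⟨fun h => hj.1 ?_, Nat.lt_succ_iff.mpr (swap_zero_le hc (by omega))⟩
    exact (Equiv.swap 0 c).injective (h.trans (Equiv.swap_apply_right 0 c).symm)

section Ent

variable {n : ℕ} {F : Type} [Field F]

theorem ent_permTab_of_one {σ : RowPerm n} {k : ℕ} {hk : k < n} (h : σ ⟨k, hk⟩ = 1) (w : Tab n F)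
    (i : ℕ) : ent (permTab σ w) (k + 1) (i + 1) = ent w (k + 1) (i + 1) := by
  by_cases hi : i ≤ k
  · rw [ent_eq _ hk hi, ent_eq _ hk hi, permTab]
    simp only [h]
    rfl
  · rw [ent_eq_zero _ (by omega), ent_eq_zero _ (by omega)]

theorem ent_permTab_congr {σ σ' : RowPerm n} {k : ℕ} {hk : k < n} (h : σ ⟨k, hk⟩ = σ' ⟨k, hk⟩)
    (w : Tab n F) (i : ℕ) :
    ent (permTab σ w) (k + 1) (i + 1) = ent (permTab σ' w) (k + 1) (i + 1) := by
  by_cases hi : i ≤ k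
  · rw [ent_eq _ hk hi, ent_eq _ hk hi, permTab, permTab]
    simp only [h]
  · rw [ent_eq_zero _ (by omega), ent_eq_zero _ (by omega)]

theorem ent_permTab_of_swap {σ : RowPerm n} {k c : ℕ} {hk : k < n} {hc : c < k + 1}
    (h : σ ⟨k, hk⟩ = Equiv.swap 0 ⟨c, hc⟩) (w : Tab n F) {i : ℕ} (hi : i ≤ k) :
    ent (permTab σ w) (k + 1) (i + 1) = ent w (k + 1) (Equiv.swap 0 c i + 1) := by
  rw [ent_eq _ hk hi, ent_eq _ hk (swap_zero_le (by omega) hi), permTab]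
  simp only [h, Equiv.symm_swap]
  congr 2
  ext
  simp only [Equiv.swap_apply_def, Fin.ext_iff]
  split_ifs <;> simp_all

theorem ent_permTab_first {σ : RowPerm n} {k c : ℕ} {hk : k < n} {hc : c < k + 1}
    (h : σ ⟨k, hk⟩ = Equiv.swap 0 ⟨c, hc⟩) (w : Tab n F) :
    ent (permTab σ w) (k + 1) 1 = ent w (k + 1) (c + 1) := by
  have := ent_permTab_of_swap h w (i := 0) (by omega)
  rwa [Equiv.swap_apply_left] at this

theorem prod_ent_permTab {M : Type*} [CommMonoid M] {σ : RowPerm n} {k c : ℕ} {hk : k < n}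
    {hc : c < k + 1} (h : σ ⟨k, hk⟩ = Equiv.swap 0 ⟨c, hc⟩) (w : Tab n F) (g : F → M) :
    ∏ p ∈ Icc 2 (k + 1), g (ent (permTab σ w) (k + 1) p) =
      ∏ j ∈ (range (k + 1)).erase c, g (ent w (k + 1) (j + 1)) := by
  rw [prod_Icc_two k fun p => g (ent (permTab σ w) (k + 1) p),
    ← prod_erase_swap (by omega) fun j => g (ent w (k + 1) (j + 1))]
  refine prod_congr rfl fun j hj => ?_
  rw [mem_erase, mem_range] at hj
  rw [ent_permTab_of_swap h w (by omega)]

theorem prod_ent_permTab_of_one {M : Type*} [CommMonoid M] {σ : RowPerm n} {k : ℕ} {hk : k < n}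
    (h : σ ⟨k, hk⟩ = 1) (w : Tab n F) (g : F → M) :
    ∏ p ∈ Icc 1 (k + 1), g (ent (permTab σ w) (k + 1) p) =
      ∏ j ∈ range (k + 1), g (ent w (k + 1) (j + 1)) := by
  rw [prod_Icc_one (k + 1) fun p => g (ent (permTab σ w) (k + 1) p)]
  exact prod_congr rfl fun j _ => by rw [ent_permTab_of_one h]

/-- The factor of `e_{ab}` contributed by the rows below the last two, for `a < b`. -/
def upRest (w : Tab n F) (a b : ℕ) : F :=
  ∏ j ∈ Icc a b, ((∏ t ∈ Icc 2 (j + 1), (ent w j 1 - ent w (j + 1) t)) /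
    (∏ t ∈ Icc 2 j, (ent w j 1 - ent w j t)))

/-- The factor of `e_{ba}` contributed by the rows above the first two, for `a < b`. -/
def downRest (w : Tab n F) (a b : ℕ) : F :=
  ∏ j ∈ Icc a b, ((∏ t ∈ Icc 2 (j - 2), (ent w (j - 1) 1 - ent w (j - 2) t)) /
    (∏ t ∈ Icc 2 (j - 1), (ent w (j - 1) 1 - ent w (j - 1) t)))

theorem eCoef_up (w : Tab n F) {a b : ℕ} (hab : a ≤ b) :
    eCoef (a + 1) (b + 2) w =
      -((∏ j ∈ Icc 1 (b + 2), (ent w (b + 1) 1 - ent w (b + 2) j)) /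
        (∏ j ∈ Icc 2 (b + 1), (ent w (b + 1) 1 - ent w (b + 1) j))) * upRest w (a + 1) b := by
  rw [eCoef, if_pos (by omega)]
  rfl

theorem eCoef_down (w : Tab n F) {a b : ℕ} (hab : a ≤ b) :
    eCoef (b + 2) (a + 1) w =
      ((∏ j ∈ Icc 1 a, (ent w (a + 1) 1 - ent w a j)) /
        (∏ j ∈ Icc 2 (a + 1), (ent w (a + 1) 1 - ent w (a + 1) j))) * downRest w (a + 3) (b + 2) := by
  rw [eCoef, if_neg (by omega), if_pos (by omega)]
  rfl

theorem upRest_succ (w : Tab n F) {a b : ℕ} (hab : a ≤ b + 1) :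
    upRest w a (b + 1) = upRest w a b *
      ((∏ t ∈ Icc 2 (b + 2), (ent w (b + 1) 1 - ent w (b + 2) t)) /
        (∏ t ∈ Icc 2 (b + 1), (ent w (b + 1) 1 - ent w (b + 1) t))) := by
  rw [upRest, prod_Icc_succ_top hab]
  rfl

theorem downRest_succ (w : Tab n F) {a b : ℕ} (hab : a ≤ b + 3) :
    downRest w a (b + 3) = downRest w a (b + 2) *
      ((∏ t ∈ Icc 2 (b + 1), (ent w (b + 2) 1 - ent w (b + 1) t)) /
        (∏ t ∈ Icc 2 (b + 2), (ent w (b + 2) 1 - ent w (b + 2) t))) := by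
  rw [downRest, prod_Icc_succ_top hab]
  rfl

theorem ent_permTab_row_congr {w w' : Tab n F} {k : ℕ} (hk : k < n)
    (h : ∀ j, ent w' (k + 1) (j + 1) = ent w (k + 1) (j + 1)) (σ : RowPerm n) (i : ℕ) :
    ent (permTab σ w') (k + 1) (i + 1) = ent (permTab σ w) (k + 1) (i + 1) := by
  by_cases hi : i ≤ k
  · rw [ent_eq _ hk hi, ent_eq _ hk hi, permTab, permTab]
    have := h ((σ ⟨k, hk⟩).symm ⟨i, Nat.lt_succ_iff.mpr hi⟩)
    rwa [ent_eq _ hk (Nat.lt_succ_iff.mp (Fin.is_lt _)),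
      ent_eq _ hk (Nat.lt_succ_iff.mp (Fin.is_lt _))] at this
  · rw [ent_eq_zero _ (by omega), ent_eq_zero _ (by omega)]

theorem prod_ent_sub_congr {w w' : Tab n F} {k l : ℕ} {s : Finset ℕ} (hs : ∀ t ∈ s, 1 ≤ t)
    (h : ent w' (k + 1) 1 = ent w (k + 1) 1)
    (h' : ∀ i, ent w' (l + 1) (i + 1) = ent w (l + 1) (i + 1)) :
    ∏ t ∈ s, (ent w' (k + 1) 1 - ent w' (l + 1) t) =
      ∏ t ∈ s, (ent w (k + 1) 1 - ent w (l + 1) t) := by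
  refine prod_congr rfl fun t ht => ?_
  obtain ⟨t, rfl⟩ : ∃ t', t = t' + 1 := ⟨t - 1, by have := hs t ht; omega⟩
  rw [h, h']

theorem upRest_congr {w w' : Tab n F} {a b : ℕ}
    (h : ∀ k, k ≤ b → ∀ i, ent w' (k + 1) (i + 1) = ent w (k + 1) (i + 1)) :
    upRest w' (a + 1) b = upRest w (a + 1) b := by
  refine prod_congr rfl fun j hj => ?_
  rw [mem_Icc] at hj
  obtain ⟨j, rfl⟩ : ∃ j', j = j' + 1 := ⟨j - 1, by omega⟩
  rw [prod_ent_sub_congr (fun t ht => by rw [mem_Icc] at ht; omega) (h j (by omega) 0)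
    (h (j + 1) (by omega)), prod_ent_sub_congr (fun t ht => by rw [mem_Icc] at ht; omega)
    (h j (by omega) 0) (h j (by omega))]

theorem downRest_congr {w w' : Tab n F} {a b : ℕ}
    (h : ∀ k, k ≤ b → ∀ i, ent w' (k + 1) (i + 1) = ent w (k + 1) (i + 1)) :
    downRest w' (a + 3) (b + 2) = downRest w (a + 3) (b + 2) := by
  refine prod_congr rfl fun j hj => ?_
  rw [mem_Icc] at hj
  obtain ⟨j, rfl⟩ : ∃ j', j = j' + 3 := ⟨j - 3, by omega⟩
  have e1 : j + 3 - 2 = j + 1 := by omega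
  have e2 : j + 3 - 1 = j + 1 + 1 := by omega
  rw [e1, e2, prod_ent_sub_congr (fun t ht => by rw [mem_Icc] at ht; omega) (h (j + 1) (by omega) 0)
    (h j (by omega)), prod_ent_sub_congr (fun t ht => by rw [mem_Icc] at ht; omega)
    (h (j + 1) (by omega) 0) (h (j + 1) (by omega))]

end Ent

section Phi

variable {n : ℕ}

theorem Phi_symm (r s : Fin n) : Phi s r = Phi r s := by
  rw [Phi, Phi, min_comm, max_comm]

theorem mem_Phi {a b : ℕ} {ha : a < n} {hb : b < n} (hab : a ≤ b) {σ : RowPerm n} :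
    σ ∈ Phi ⟨a, ha⟩ ⟨b, hb⟩ ↔ ∀ k : Fin n,
      (a ≤ k.val ∧ k.val < b → ∃ i : Fin (k.val + 1), σ k = Equiv.swap 0 i) ∧
      (¬ (a ≤ k.val ∧ k.val < b) → σ k = 1) := by
  have h : (⟨a, ha⟩ : Fin n) ≤ ⟨b, hb⟩ := hab
  rw [Phi, mem_filter, min_eq_left h, max_eq_right h]
  simp only [mem_univ, true_and, Fin.le_def, Fin.lt_def]

theorem Phi_self (r : Fin n) : Phi r r = {1} := by
  obtain ⟨a, ha⟩ := r
  ext σ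
  rw [mem_Phi le_rfl, mem_singleton]
  constructor
  · intro h
    funext k
    exact (h k).2 (by omega)
  · rintro rfl k
    exact ⟨fun h => absurd h (by omega), fun _ => rfl⟩

/-- Passing from `b` to `b + 1` frees exactly one more row, the row `b`. Its transposition `(0 i)`
can be chosen independently of the rest and is recovered from the image of `0`. -/
theorem sum_Phi_succ {M : Type*} [AddCommMonoid M] {a b : ℕ} (hab : a ≤ b) (hb : b + 1 < n)
    (F : RowPerm n → M) :
    ∑ σ ∈ Phi ⟨a, by omega⟩ ⟨b + 1, hb⟩, F σ =
      ∑ i : Fin (b + 1), ∑ σ ∈ Phi ⟨a, by omega⟩ ⟨b, by omega⟩,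
        F (Function.update σ ⟨b, by omega⟩ (Equiv.swap 0 i)) := by
  rw [← sum_product']
  symm
  refine sum_nbij' (fun x => Function.update x.2 ⟨b, by omega⟩ (Equiv.swap 0 x.1))
    (fun σ => (σ ⟨b, by omega⟩ 0, Function.update σ ⟨b, by omega⟩ 1)) ?_ ?_ ?_ ?_ ?_
  · rintro ⟨i, σ⟩ h
    rw [mem_product, mem_Phi hab] at h
    rw [mem_Phi (by omega)]
    intro k
    by_cases hk : k = ⟨b, by omega⟩
    · subst hk
      simp only [Function.update_self]
      exact ⟨fun _ => ⟨i, rfl⟩, fun h => absurd h (by simp; omega)⟩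
    · rw [Function.update_of_ne hk]
      have hkb : k.val ≠ b := fun h => hk (Fin.ext h)
      exact ⟨fun h' => (h.2 k).1 (by omega), fun h' => (h.2 k).2 (by omega)⟩
  · intro σ h
    rw [mem_Phi (by omega)] at h
    rw [mem_product, mem_Phi hab]
    refine ⟨mem_univ _, fun k => ?_⟩
    by_cases hk : k = ⟨b, by omega⟩
    · subst hk
      exact ⟨fun h => absurd h (by simp), fun _ => Function.update_self _ _ _⟩
    · simp only [Function.update_of_ne hk]
      have hkb : k.val ≠ b := fun h => hk (Fin.ext h)
      exact ⟨fun h' => (h k).1 (by omega), fun h' => (h k).2 (by omega)⟩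
  · rintro ⟨i, σ⟩ h
    rw [mem_product, mem_Phi hab] at h
    have h1 : σ ⟨b, by omega⟩ = 1 := (h.2 ⟨b, by omega⟩).2 (by simp)
    simp [← h1]
  · intro σ h
    rw [mem_Phi (by omega)] at h
    obtain ⟨i, hi⟩ := (h ⟨b, by omega⟩).1 ⟨hab, by simp⟩
    simp only [Function.update_idem]
    rw [hi, Equiv.swap_apply_left, ← hi, Function.update_eq_self]
  · intro x _
    rfl

theorem permShift_apply (σ : RowPerm n) (z : Shift n) (p : Idx n) :
    (permShift σ z).1 p = z.1 ⟨p.1, (σ p.1).symm p.2⟩ := rfl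

theorem permShift_update_eps {a b : ℕ} (hab : a ≤ b) (hb : b + 1 < n) (σ : RowPerm n)
    (i : Fin (b + 1)) :
    permShift (Function.update σ ⟨b, by omega⟩ (Equiv.swap 0 i)) (eps ⟨a, by omega⟩ ⟨b + 1, hb⟩) =
      unitShift n b i + permShift σ (eps ⟨a, by omega⟩ ⟨b, by omega⟩) := by
  ext ⟨k, j⟩
  rw [AddSubgroup.coe_add, Pi.add_apply, permShift_apply, permShift_apply]
  by_cases hk : k = ⟨b, by omega⟩
  · subst hk
    simp only [Function.update_self, Equiv.symm_swap, eps, unitShift, Fin.le_def, Fin.lt_def]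
    have h0 : (Equiv.swap 0 i j).val = 0 ↔ j.val = i.val := by
      rw [← Fin.ext_iff, Fin.val_eq_zero_iff, Equiv.swap_apply_eq_iff, Equiv.swap_apply_left]
    simp only [h0]
    split_ifs <;> simp_all <;> omega
  · have hkb : k.val ≠ b := fun h => hk (Fin.ext h)
    simp only [Function.update_of_ne hk, eps, unitShift, Fin.le_def, Fin.lt_def]
    split_ifs <;> first | rfl | omega

theorem eps_swap (r s : Fin n) : eps s r = -eps r s := by
  ext ⟨k, j⟩
  rw [AddSubgroup.coe_neg, Pi.neg_apply]
  simp only [eps, Fin.le_def, Fin.lt_def]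
  split_ifs <;> first | rfl | omega

theorem permShift_neg (σ : RowPerm n) (z : Shift n) : permShift σ (-z) = -permShift σ z := by
  ext p
  rfl

theorem eps_self (r : Fin n) : eps r r = 0 := by
  ext ⟨k, j⟩
  simp only [eps, Fin.le_def, Fin.lt_def]
  split_ifs <;> first | rfl | omega

/-- A row permuted shift `ε_{ab}` is supported in the rows from `a` to `b - 1`, where it marks the
first entry of the permuted row. -/
theorem permShift_eps_apply {a b : ℕ} {ha : a < n} {hb : b < n} (hab : a ≤ b) (σ : RowPerm n)
    (p : Idx n) :
    (permShift σ (eps ⟨a, ha⟩ ⟨b, hb⟩)).1 p =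
      if a ≤ p.1.val ∧ p.1.val < b ∧ p.2 = σ p.1 0 then 1 else 0 := by
  rw [permShift_apply]
  simp only [eps, Fin.le_def, Fin.lt_def]
  have h0 : ((σ p.1).symm p.2).val = 0 ↔ p.2 = σ p.1 0 := by
    rw [Fin.val_eq_zero_iff, Equiv.symm_apply_eq]
  simp only [h0]
  by_cases h : p.2 = σ p.1 0
  · simp only [h, and_true, if_true]
    split_ifs <;> first | rfl | omega
  · simp [h]

end Phi

end GT

/-! ### The coefficients `e_{rs}` as iterated commutators of shifts. -/

namespace GT

variable {n : ℕ}

theorem genArray_entry (z : Shift n) (k i : ℕ) :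
    (genArray n).entry z k i = ent (xTab z) (k + 1) (i + 1) := rfl

theorem genArray_unit (k i : ℕ) : (genArray n).unit k i = unitShift n k i := rfl

theorem ent_xTab_add_unitShift {k i : ℕ} (hk : k + 1 < n) (hi : i ≤ k) (z : Shift n) (l j : ℕ) :
    ent (xTab (z + unitShift n k i)) (l + 1) (j + 1) =
      ent (xTab z) (l + 1) (j + 1) + if l = k ∧ j = i then 1 else 0 :=
  (genArray n).entry_add hk hi z l j

theorem ent_xTab_sub_unitShift {k i : ℕ} (hk : k + 1 < n) (hi : i ≤ k) (z : Shift n) (l j : ℕ) :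
    ent (xTab (z + -unitShift n k i)) (l + 1) (j + 1) =
      ent (xTab z) (l + 1) (j + 1) - if l = k ∧ j = i then 1 else 0 :=
  (genArray n).entry_sub hk hi z l j

/-- The leading factor of `e_{ab}`, `a < b`, is the coefficient of a raising operator. -/
theorem neg_prod_div_prod_eq_raise {b i : ℕ} (hb : b + 1 < n) {hi : i < b + 1} {σ : RowPerm n}
    (h : σ ⟨b, by omega⟩ = Equiv.swap 0 ⟨i, hi⟩) (h1 : σ ⟨b + 1, hb⟩ = 1) (z : Shift n) :
    -((∏ j ∈ Icc 1 (b + 2), (ent (permTab σ (xTab z)) (b + 1) 1 -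
          ent (permTab σ (xTab z)) (b + 2) j)) /
        (∏ j ∈ Icc 2 (b + 1), (ent (permTab σ (xTab z)) (b + 1) 1 -
          ent (permTab σ (xTab z)) (b + 1) j))) = (genArray n).raise b i z := by
  rw [ent_permTab_first h, prod_ent_permTab_of_one h1 _
    fun y => ent (xTab z) (b + 1) (i + 1) - y, prod_ent_permTab h _
    fun y => ent (xTab z) (b + 1) (i + 1) - y]
  rfl

/-- Raising the entry `i` of row `b + 1` lowers a single factor of the numerator by one. The
difference of the two coefficients is thus the product with that factor deleted, which is the
numerator of the new row in the longer coefficient. -/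
theorem eCoef_raise_step {a b i : ℕ} (hab : a ≤ b) (hb : b + 2 < n) (hi : i < b + 2)
    {σ : RowPerm n} (hσ : σ ∈ Phi ⟨a, by omega⟩ ⟨b + 1, by omega⟩) (z : Shift n) :
    eCoef (a + 1) (b + 3)
        (permTab (Function.update σ ⟨b + 1, by omega⟩ (Equiv.swap 0 ⟨i, hi⟩)) (xTab z)) =
      (genArray n).raise (b + 1) i z *
        (eCoef (a + 1) (b + 2) (permTab σ (xTab (z + unitShift n (b + 1) i))) -
          eCoef (a + 1) (b + 2) (permTab σ (xTab z))) := by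
  rw [mem_Phi (by omega)] at hσ
  set σ' := Function.update σ ⟨b + 1, by omega⟩ (Equiv.swap 0 ⟨i, hi⟩) with hσ'
  have hs : σ' ⟨b + 1, by omega⟩ = Equiv.swap 0 ⟨i, hi⟩ := Function.update_self _ _ _
  have hne : ∀ k (hk : k < n), k ≠ b + 1 → σ' ⟨k, hk⟩ = σ ⟨k, hk⟩ := fun k hk h =>
    Function.update_of_ne (by simpa using h) _ _
  have h1 : σ' ⟨b + 2, hb⟩ = 1 := by
    rw [hne _ hb (by omega)]
    exact (hσ _).2 (by simp)
  have h1' : σ ⟨b + 1, by omega⟩ = 1 := (hσ _).2 (by simp)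
  have hA := ent_xTab_add_unitShift (k := b + 1) hb (Nat.lt_succ_iff.mp hi) z
  have row' : ∀ k, k ≤ b → ∀ j, ent (permTab σ' (xTab z)) (k + 1) (j + 1) =
      ent (permTab σ (xTab z)) (k + 1) (j + 1) := fun k hk j =>
    ent_permTab_congr (hne k (by omega) (by omega)) _ _
  have rowp : ∀ k, k ≤ b → ∀ j, ent (permTab σ (xTab (z + unitShift n (b + 1) i))) (k + 1) (j + 1) =
      ent (permTab σ (xTab z)) (k + 1) (j + 1) := fun k hk j =>
    ent_permTab_row_congr (by omega) (fun j => by rw [hA, if_neg (by omega), add_zero]) σ j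
  rw [eCoef_up _ (show a ≤ b + 1 by omega), eCoef_up _ hab, eCoef_up _ hab,
    neg_prod_div_prod_eq_raise hb hs h1, upRest_succ _ (by omega), upRest_congr row',
    upRest_congr rowp]
  have y' := row' b le_rfl 0
  have yp := rowp b le_rfl 0
  rw [zero_add] at y' yp
  have d' : ∏ j ∈ Icc 2 (b + 1), (ent (permTab σ' (xTab z)) (b + 1) 1 -
      ent (permTab σ' (xTab z)) (b + 1) j) = ∏ j ∈ Icc 2 (b + 1),
        (ent (permTab σ (xTab z)) (b + 1) 1 - ent (permTab σ (xTab z)) (b + 1) j) :=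
    prod_ent_sub_congr (fun t ht => by rw [mem_Icc] at ht; omega) y' (row' b le_rfl)
  have dp : ∏ j ∈ Icc 2 (b + 1), (ent (permTab σ (xTab (z + unitShift n (b + 1) i))) (b + 1) 1 -
      ent (permTab σ (xTab (z + unitShift n (b + 1) i))) (b + 1) j) = ∏ j ∈ Icc 2 (b + 1),
        (ent (permTab σ (xTab z)) (b + 1) 1 - ent (permTab σ (xTab z)) (b + 1) j) :=
    prod_ent_sub_congr (fun t ht => by rw [mem_Icc] at ht; omega) yp (rowp b le_rfl)
  rw [d', dp, y', yp]
  generalize ent (permTab σ (xTab z)) (b + 1) 1 = y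
  rw [prod_ent_permTab hs _ fun x => y - x, prod_ent_permTab_of_one h1' _ fun x => y - x,
    prod_ent_permTab_of_one h1' _ fun x => y - x,
    ← mul_prod_erase (range (b + 1 + 1)) (fun j => y - ent (xTab z) (b + 1 + 1) (j + 1))
      (mem_range.mpr hi),
    ← mul_prod_erase (range (b + 1 + 1)) (fun j => y - ent (xTab (z + unitShift n (b + 1) i))
      (b + 1 + 1) (j + 1)) (mem_range.mpr hi)]
  have e : ∏ j ∈ (range (b + 1 + 1)).erase i,
      (y - ent (xTab (z + unitShift n (b + 1) i)) (b + 1 + 1) (j + 1)) =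
      ∏ j ∈ (range (b + 1 + 1)).erase i, (y - ent (xTab z) (b + 1 + 1) (j + 1)) :=
    prod_congr rfl fun j hj => by
      rw [hA, if_neg (fun h => (mem_erase.mp hj).1 h.2), add_zero]
  rw [e, hA, if_pos ⟨rfl, rfl⟩]
  simp only [div_eq_mul_inv]
  ring

/-- The shift already performed lowers one entry of row `b`, so exactly one factor in the numerator
of `lower` grows by one. Subtracting deletes this factor and leaves the numerator that the longer
coefficient needs. -/
theorem eCoef_lower_step {a b i : ℕ} (hab : a ≤ b) (hb : b + 2 < n) (hi : i < b + 2)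
    {σ : RowPerm n} (hσ : σ ∈ Phi ⟨a, by omega⟩ ⟨b + 1, by omega⟩) (z : Shift n) :
    eCoef (b + 3) (a + 1)
        (permTab (Function.update σ ⟨b + 1, by omega⟩ (Equiv.swap 0 ⟨i, hi⟩)) (xTab z)) =
      eCoef (b + 2) (a + 1) (permTab σ (xTab z)) *
        ((genArray n).lower (b + 1) i
          (z + -permShift σ (eps ⟨a, by omega⟩ ⟨b + 1, by omega⟩)) -
          (genArray n).lower (b + 1) i z) := by
  have hσ0 := hσ
  rw [mem_Phi (by omega)] at hσ
  set σ' := Function.update σ ⟨b + 1, by omega⟩ (Equiv.swap 0 ⟨i, hi⟩) with hσ'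
  have hs : σ' ⟨b + 1, by omega⟩ = Equiv.swap 0 ⟨i, hi⟩ := Function.update_self _ _ _
  have hne : ∀ k (hk : k < n), k ≠ b + 1 → σ' ⟨k, hk⟩ = σ ⟨k, hk⟩ := fun k hk h =>
    Function.update_of_ne (by simpa using h) _ _
  obtain ⟨⟨c, hc⟩, hcs⟩ := (hσ ⟨b, by omega⟩).1 ⟨hab, by simp⟩
  have hcs' : σ' ⟨b, by omega⟩ = Equiv.swap 0 ⟨c, hc⟩ := by rw [hne _ _ (by omega), hcs]
  have row' : ∀ k, k ≤ b → ∀ j, ent (permTab σ' (xTab z)) (k + 1) (j + 1) =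
      ent (permTab σ (xTab z)) (k + 1) (j + 1) := fun k hk j =>
    ent_permTab_congr (hne k (by omega) (by omega)) _ _
  set d := -permShift σ (eps ⟨a, by omega⟩ ⟨b + 1, by omega⟩) with hd
  have hS1 : ∀ j, j ≤ b + 1 → ent (xTab (z + d)) (b + 1 + 1) (j + 1) =
      ent (xTab z) (b + 1 + 1) (j + 1) := by
    intro j hj
    rw [ent_xTab_add _ _ (by omega) hj, hd, AddSubgroup.coe_neg, Pi.neg_apply,
      permShift_eps_apply (by omega)]
    simp
  have hS : ∀ j, j ≤ b → ent (xTab (z + d)) (b + 1) (j + 1) =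
      ent (xTab z) (b + 1) (j + 1) - if j = c then 1 else 0 := by
    intro j hj
    rw [ent_xTab_add _ _ (by omega) hj, hd, AddSubgroup.coe_neg, Pi.neg_apply,
      permShift_eps_apply (by omega)]
    simp only [hcs, Equiv.swap_apply_left, Fin.ext_iff]
    by_cases hjc : j = c
    · simp [hjc, hab]; ring
    · simp [hjc]
  have hfirst : (∏ j ∈ Icc 1 a, (ent (permTab σ' (xTab z)) (a + 1) 1 -
      ent (permTab σ' (xTab z)) a j)) = ∏ j ∈ Icc 1 a, (ent (permTab σ (xTab z)) (a + 1) 1 -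
      ent (permTab σ (xTab z)) a j) := by
    cases a with
    | zero => simp
    | succ a =>
      exact prod_ent_sub_congr (fun t ht => (mem_Icc.mp ht).1) (row' (a + 1) (by omega) 0)
        (row' a (by omega))
  rw [eCoef_down _ (show a ≤ b + 1 by omega), eCoef_down _ hab, downRest_succ _ (by omega),
    downRest_congr row', hfirst, prod_ent_sub_congr (fun t ht => by rw [mem_Icc] at ht; omega)
      (row' a (by omega) 0) (row' a (by omega)),
    ent_permTab_first hs, prod_ent_permTab hcs' _ fun x => ent (xTab z) (b + 1 + 1) (i + 1) - x,
    prod_ent_permTab hs _ fun x => ent (xTab z) (b + 1 + 1) (i + 1) - x,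
    GenericArray.lower_eq_left hc, GenericArray.lower_eq_left hc]
  simp only [genArray_entry]
  have e1 : ∏ m ∈ (range (b + 1)).erase c, (ent (xTab (z + d)) (b + 1 + 1) (i + 1) -
      ent (xTab (z + d)) (b + 1) (m + 1)) = ∏ m ∈ (range (b + 1)).erase c,
      (ent (xTab z) (b + 1 + 1) (i + 1) - ent (xTab z) (b + 1) (m + 1)) :=
    prod_congr rfl fun m hm => by
      rw [mem_erase, mem_range] at hm
      rw [hS1 i (by omega), hS m (by omega), if_neg hm.1, sub_zero]
  have e2 : ∏ m ∈ (range (b + 2)).erase i, (ent (xTab (z + d)) (b + 1 + 1) (i + 1) -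
      ent (xTab (z + d)) (b + 1 + 1) (m + 1)) = ∏ m ∈ (range (b + 2)).erase i,
      (ent (xTab z) (b + 1 + 1) (i + 1) - ent (xTab z) (b + 1 + 1) (m + 1)) :=
    prod_congr rfl fun m hm => by
      rw [mem_erase, mem_range] at hm
      rw [hS1 i (by omega), hS1 m (by omega)]
  have hc' : c < b + 1 := hc
  rw [e1, e2, hS1 i (by omega), hS c (by omega), if_pos rfl]
  ring

theorem opE_genT (k : ℕ) (z : Shift n) :
    (genArray n).opE k (genT z) =
      ∑ i : Fin (k + 1), (genArray n).raise k i z • genT (z + unitShift n k i) := by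
  rw [GenericArray.opE, LinearMap.sum_apply, Finset.sum_range]
  refine sum_congr rfl fun i _ => ?_
  rw [genT, shiftOp_single, genT, Finsupp.smul_single, smul_eq_mul, mul_one, genArray_unit]

theorem opF_genT (k : ℕ) (z : Shift n) :
    (genArray n).opF k (genT z) =
      ∑ i : Fin (k + 1), (genArray n).lower k i z • genT (z + -unitShift n k i) := by
  rw [GenericArray.opF, LinearMap.sum_apply, Finset.sum_range]
  refine sum_congr rfl fun i _ => ?_
  rw [genT, shiftOp_single, genT, Finsupp.smul_single, smul_eq_mul, mul_one, genArray_unit]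

theorem opH_genT (k : ℕ) (z : Shift n) :
    (genArray n).opH k (genT z) = (genArray n).weight k z • genT z := by
  rw [GenericArray.opH, genT, shiftOp_single, Finsupp.smul_single, smul_eq_mul, mul_one, add_zero]

theorem comm_apply {R V : Type*} [Ring R] [AddCommGroup V] [Module R V] (x y : Module.End R V)
    (v : V) : comm x y v = x (y v) - y (x v) := rfl

/-- Induction on `b`, the matrix unit for `b + 2` being the commutator of the one for `b + 1` with a
simple raising operator. The two double sums have the same terms `T(x + z + ...)`, and their
coefficients are matched by `eCoef_raise_step`. -/
theorem genUnit_raise {a b : ℕ} (hab : a ≤ b) (hb : b + 1 < n) (z : Shift n) :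
    genUnit n a (b + 1) (genT z) =
      ∑ σ ∈ Phi ⟨a, by omega⟩ ⟨b + 1, hb⟩, eCoef (a + 1) (b + 2) (permTab σ (xTab z)) •
        genT (z + permShift σ (eps ⟨a, by omega⟩ ⟨b + 1, hb⟩)) := by
  induction b, hab using Nat.le_induction generalizing z with
  | base =>
    rw [genUnit, unitsOf_succ, opE_genT, sum_Phi_succ le_rfl]
    refine sum_congr rfl fun i _ => ?_
    rw [Phi_self, sum_singleton, permShift_update_eps le_rfl, eps_self, eCoef_up _ le_rfl,
      neg_prod_div_prod_eq_raise (i := i) hb (Function.update_self _ _ _)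
        (Function.update_of_ne (by simp) _ _)]
    have h0 : permShift (1 : RowPerm n) (0 : Shift n) = 0 := rfl
    rw [h0, add_zero, upRest, Icc_eq_empty (by omega), prod_empty, mul_one]
  | succ b hab ih =>
    have ih' := ih (by omega)
    rw [genUnit, unitsOf_up (by omega), comm_apply]
    change genUnit n a (b + 1) _ - (genArray n).opE (b + 1) (genUnit n a (b + 1) _) = _
    rw [ih' z, map_sum, opE_genT, map_sum,
      sum_Phi_succ (a := a) (b := b + 1) (show a ≤ b + 1 by omega) hb]
    simp only [map_smul, ih', opE_genT, smul_sum]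
    rw [sum_comm (s := Phi _ _), ← sum_sub_distrib]
    refine sum_congr rfl fun i _ => ?_
    rw [← sum_sub_distrib]
    refine sum_congr rfl fun σ hσ => ?_
    -- The earlier shifts move only the rows `a, ..., b`, none of which enters the raising
    -- coefficient of row `b + 1`.
    have hr : (genArray n).raise (b + 1) i
        (z + permShift σ (eps ⟨a, by omega⟩ ⟨b + 1, by omega⟩)) =
        (genArray n).raise (b + 1) i z := by
      refine GenericArray.raise_congr ?_ ?_
      · intro j
        by_cases hj : j ≤ b + 1
        · rw [genArray_entry, ent_xTab_add _ _ (by omega) hj, permShift_eps_apply (by omega)]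
          simp [genArray_entry]
        · rw [genArray_entry, genArray_entry, ent_eq_zero _ (by omega), ent_eq_zero _ (by omega)]
      · intro j
        by_cases hj : j ≤ b + 2
        · rw [genArray_entry, ent_xTab_add _ _ (by omega) hj, permShift_eps_apply (by omega)]
          simp [genArray_entry]
        · rw [genArray_entry, genArray_entry, ent_eq_zero _ (by omega), ent_eq_zero _ (by omega)]
    rw [eCoef_raise_step hab hb i.2 hσ, permShift_update_eps (by omega), hr, smul_smul, smul_smul,
      add_assoc z, add_assoc z, add_comm (permShift _ _), ← sub_smul]
    congr 1
    ring

theorem eCoef_down_congr {a b : ℕ} (hab : a ≤ b) {w w' : Tab n (RatFun n)}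
    (row : ∀ k, k ≤ b → ∀ j, ent w' (k + 1) (j + 1) = ent w (k + 1) (j + 1)) :
    eCoef (b + 2) (a + 1) w' = eCoef (b + 2) (a + 1) w := by
  have hfirst : (∏ j ∈ Icc 1 a, (ent w' (a + 1) 1 - ent w' a j)) =
      ∏ j ∈ Icc 1 a, (ent w (a + 1) 1 - ent w a j) := by
    cases a with
    | zero => simp
    | succ a =>
      exact prod_ent_sub_congr (fun t ht => (mem_Icc.mp ht).1) (row (a + 1) (by omega) 0)
        (row a (by omega))
  rw [eCoef_down _ hab, eCoef_down _ hab, downRest_congr row, hfirst,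
    prod_ent_sub_congr (fun t ht => by rw [mem_Icc] at ht; omega)
      (row a (by omega) 0) (row a (by omega))]

theorem genUnit_lower {a b : ℕ} (hab : a ≤ b) (hb : b + 1 < n) (z : Shift n) :
    genUnit n (b + 1) a (genT z) =
      ∑ σ ∈ Phi ⟨a, by omega⟩ ⟨b + 1, hb⟩, eCoef (b + 2) (a + 1) (permTab σ (xTab z)) •
        genT (z + -permShift σ (eps ⟨a, by omega⟩ ⟨b + 1, hb⟩)) := by
  induction b, hab using Nat.le_induction generalizing z with
  | base =>
    rw [genUnit, unitsOf_pred, opF_genT, sum_Phi_succ le_rfl]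
    refine sum_congr rfl fun i _ => ?_
    have h0 : permShift (1 : RowPerm n) (0 : Shift n) = 0 := rfl
    have hs : Function.update (1 : RowPerm n) ⟨a, by omega⟩ (Equiv.swap 0 i) ⟨a, by omega⟩ =
      Equiv.swap 0 ⟨i.1, i.2⟩ := Function.update_self _ _ _
    have hrest : ∀ w : Tab n (RatFun n), downRest w (a + 3) (a + 2) = 1 := fun w => by
      rw [downRest, Icc_eq_empty (by omega), prod_empty]
    rw [Phi_self, sum_singleton, permShift_update_eps le_rfl, eps_self, eCoef_down _ le_rfl, h0,
      add_zero, hrest, mul_one, ent_permTab_first hs,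
      prod_ent_permTab hs _ fun x => ent (xTab z) (a + 1) (i + 1) - x]
    rw [GenericArray.lower]
    refine congrArg₂ _ (congrArg₂ _ ?_ rfl) rfl
    cases a with
    | zero => simp
    | succ a =>
      rw [prod_ent_permTab_of_one (k := a) (hk := by omega) (Function.update_of_ne (by simp) _ _) _
        fun x => ent (xTab z) (a + 1 + 1) (i + 1) - x]
      rfl
  | succ b hab ih =>
    have ih' := ih (by omega)
    rw [genUnit, unitsOf_down (by omega), comm_apply]
    change (genArray n).opF (b + 1) (genUnit n (b + 1) a _) - genUnit n (b + 1) a _ = _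
    rw [ih' z, map_sum, opF_genT, map_sum,
      sum_Phi_succ (a := a) (b := b + 1) (show a ≤ b + 1 by omega) hb]
    simp only [map_smul, ih', opF_genT, smul_sum]
    rw [sum_comm (s := Phi _ _), ← sum_sub_distrib]
    refine sum_congr rfl fun i _ => ?_
    rw [← sum_sub_distrib]
    refine sum_congr rfl fun σ hσ => ?_
    -- For lowering operators the roles are exchanged: the shorter coefficient involves only rows up
    -- to `b` and does not see the shift of row `b + 1`.
    have hr : eCoef (b + 2) (a + 1) (permTab σ (xTab (z + -unitShift n (b + 1) i))) =
        eCoef (b + 2) (a + 1) (permTab σ (xTab z)) := by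
      refine eCoef_down_congr hab fun k hk j => ?_
      refine ent_permTab_row_congr (by omega) (fun j => ?_) σ j
      rw [ent_xTab_sub_unitShift (by omega) (by omega), if_neg (by omega), sub_zero]
    rw [eCoef_lower_step hab hb i.2 hσ, permShift_update_eps (by omega), hr, smul_smul, smul_smul,
      neg_add, add_assoc z, add_assoc z, add_comm (-permShift _ _), ← sub_smul]
    congr 1
    ring

theorem sum_Icc_one {M : Type*} [AddCommMonoid M] (m : ℕ) (g : ℕ → M) :
    ∑ p ∈ Icc 1 m, g p = ∑ j ∈ range m, g (j + 1) :=
  prod_Icc_one (M := Multiplicative M) m g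

theorem isGenericAction_genRep (n : ℕ) : IsGenericAction (genRep n) := by
  intro r s z
  rw [genRep_E]
  obtain ⟨a, ha⟩ := r
  obtain ⟨b, hb⟩ := s
  rcases lt_trichotomy a b with hab | rfl | hab
  · obtain ⟨b, rfl⟩ : ∃ b', b = b' + 1 := ⟨b - 1, by omega⟩
    exact genUnit_raise (a := a) (b := b) (by omega) hb z
  · have h0 : permShift (1 : RowPerm n) (0 : Shift n) = 0 := rfl
    rw [Phi_self, sum_singleton, eps_self, h0, add_zero]
    change genUnit n a a (genT z) = _
    rw [genUnit, unitsOf_self, opH_genT]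
    congr 1
    have h1 : permTab (1 : RowPerm n) (xTab z) = xTab z := rfl
    rw [h1, eCoef, if_neg (lt_irrefl _), if_neg (lt_irrefl _), sum_Icc_one, sum_Icc_one,
      GenericArray.weight]
    push_cast
    rw [add_sub_cancel_right]
    congr 1
    cases a with
    | zero => simp
    | succ a => rfl
  · obtain ⟨a, rfl⟩ : ∃ b', a = b' + 1 := ⟨a - 1, by omega⟩
    rw [Phi_symm, eps_swap]
    simp only [permShift_neg]
    exact genUnit_lower (a := b) (b := a) (by omega) ha z

end GT

namespace GT

variable {n : ℕ}

/-! ### Rational functions regular along a homomorphism -/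

section Regular

variable {F : Type*} [Field F] (ψ : Poly n →+* F)

/-- The rational functions that are regular along `ψ`, the local ring of the kernel of `ψ`. -/
def regular : Subring (RatFun n) where
  carrier := {f | ∃ p q : Poly n, ψ q ≠ 0 ∧
    f = algebraMap (Poly n) (RatFun n) p / algebraMap (Poly n) (RatFun n) q}
  one_mem' := ⟨1, 1, by simp, by simp⟩
  zero_mem' := ⟨0, 1, by simp, by simp⟩
  neg_mem' := by
    rintro _ ⟨p, q, hq, rfl⟩
    exact ⟨-p, q, hq, by rw [map_neg]; exact (neg_div _ _).symm⟩
  mul_mem' := by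
    rintro _ _ ⟨p, q, hq, rfl⟩ ⟨p', q', hq', rfl⟩
    exact ⟨p * p', q * q', by simp [hq, hq'], by rw [map_mul, map_mul, div_mul_div_comm]⟩
  add_mem' := by
    rintro _ _ ⟨p, q, hq, rfl⟩ ⟨p', q', hq', rfl⟩
    have h : ∀ {q}, ψ q ≠ 0 → algebraMap (Poly n) (RatFun n) q ≠ 0 := fun {q} hq h0 => hq (by
      rw [IsFractionRing.injective (Poly n) (RatFun n) (h0.trans (map_zero _).symm), map_zero])
    exact ⟨p * q' + q * p', q * q', by simp [hq, hq'], by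
      rw [div_add_div _ _ (h hq) (h hq')]; simp⟩

variable {ψ}

theorem algebraMap_ne_zero_of_map {q : Poly n} (hq : ψ q ≠ 0) :
    algebraMap (Poly n) (RatFun n) q ≠ 0 := fun h0 => hq (by
  rw [IsFractionRing.injective (Poly n) (RatFun n) (h0.trans (map_zero _).symm), map_zero])

theorem algebraMap_mem_regular (p : Poly n) : algebraMap (Poly n) (RatFun n) p ∈ regular ψ :=
  ⟨p, 1, by simp, by simp⟩

theorem inv_mem_regular {q : Poly n} (hq : ψ q ≠ 0) :
    (algebraMap (Poly n) (RatFun n) q)⁻¹ ∈ regular ψ := ⟨1, q, hq, by simp⟩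

variable (ψ) in
/-- The rational functions that are regular along `ψ` with value `0`. -/
def vanishing : AddSubgroup (RatFun n) where
  carrier := {f | ∃ p q : Poly n, ψ q ≠ 0 ∧ ψ p = 0 ∧
    f = algebraMap (Poly n) (RatFun n) p / algebraMap (Poly n) (RatFun n) q}
  zero_mem' := ⟨0, 1, by simp, by simp, by simp⟩
  neg_mem' := by
    rintro _ ⟨p, q, hq, hp, rfl⟩
    exact ⟨-p, q, hq, by simp [hp], by rw [map_neg]; exact (neg_div _ _).symm⟩
  add_mem' := by
    rintro _ _ ⟨p, q, hq, hp, rfl⟩ ⟨p', q', hq', hp', rfl⟩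
    exact ⟨p * q' + q * p', q * q', by simp [hq, hq'], by simp [hp, hp'], by
      rw [div_add_div _ _ (algebraMap_ne_zero_of_map hq) (algebraMap_ne_zero_of_map hq')]; simp⟩

theorem mul_mem_vanishing {f g : RatFun n} (hf : f ∈ regular ψ) (hg : g ∈ vanishing ψ) :
    f * g ∈ vanishing ψ := by
  obtain ⟨p, q, hq, rfl⟩ := hf
  obtain ⟨p', q', hq', hp', rfl⟩ := hg
  exact ⟨p * p', q * q', by simp [hq, hq'], by simp [hp'],
    by rw [map_mul, map_mul, div_mul_div_comm]⟩

theorem algebraMap_mem_vanishing {p : Poly n} (hp : ψ p = 0) :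
    algebraMap (Poly n) (RatFun n) p ∈ vanishing ψ :=
  ⟨p, 1, by simp, hp, by simp⟩

end Regular

/-! ### Smooth functions and their values -/

/-- The ring of functions smooth at `v`. -/
abbrev smooth (v : Tab n ℂ) : Subring (RatFun n) := regular (MvPolynomial.eval v)

variable {v : Tab n ℂ}

theorem num_mul_eq {f : RatFun n} {p q : Poly n} (hq : q ≠ 0)
    (hf : f = algebraMap (Poly n) (RatFun n) p / algebraMap (Poly n) (RatFun n) q) :
    IsFractionRing.num (Poly n) f * q = p * (IsFractionRing.den (Poly n) f : Poly n) := by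
  have h1 := IsFractionRing.mk'_num_den' (Poly n) f
  rw [hf] at h1
  rw [div_eq_div_iff, ← map_mul, ← map_mul] at h1
  · rw [hf]
    exact IsFractionRing.injective (Poly n) (RatFun n) h1
  · exact IsFractionRing.to_map_ne_zero_of_mem_nonZeroDivisors (SetLike.coe_mem _)
  · rwa [Ne, IsFractionRing.to_map_eq_zero_iff]

/-- The reduced denominator divides every other denominator of `f`. This makes `evalAt`, which is
defined through the reduced fraction, computable from any fraction whose denominator is nonzero at
`v`. -/
theorem eval_den_ne_zero {f : RatFun n} {p q : Poly n} (hq : MvPolynomial.eval v q ≠ 0)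
    (hf : f = algebraMap (Poly n) (RatFun n) p / algebraMap (Poly n) (RatFun n) q) :
    MvPolynomial.eval v (IsFractionRing.den (Poly n) f : Poly n) ≠ 0 := by
  have h := num_mul_eq (fun h => hq (by rw [h, map_zero])) hf
  have h1 : (IsFractionRing.den (Poly n) f : Poly n) ∣ q :=
    (IsFractionRing.num_den_reduced (Poly n) f).symm.dvd_of_dvd_mul_left ⟨p, by rw [h, mul_comm]⟩
  obtain ⟨c, hc⟩ := h1
  intro h0
  exact hq (by rw [hc, map_mul, h0, zero_mul])

theorem evalAt_div {p q : Poly n} (hq : MvPolynomial.eval v q ≠ 0) :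
    evalAt v (algebraMap (Poly n) (RatFun n) p / algebraMap (Poly n) (RatFun n) q) =
      MvPolynomial.eval v p / MvPolynomial.eval v q := by
  have h := congrArg (MvPolynomial.eval v)
    (num_mul_eq (f := _) (fun h => hq (by rw [h, map_zero])) (p := p) (q := q) rfl)
  rw [map_mul, map_mul] at h
  rw [evalAt, div_eq_div_iff (eval_den_ne_zero hq rfl) hq, h]

theorem evalAt_algebraMap (p : Poly n) :
    evalAt v (algebraMap (Poly n) (RatFun n) p) = MvPolynomial.eval v p := by
  have := evalAt_div (v := v) (p := p) (q := 1) (by simp)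
  simpa using this

theorem evalAt_one : evalAt v (1 : RatFun n) = 1 := by
  simpa using evalAt_algebraMap (v := v) (1 : Poly n)

theorem evalAt_zero : evalAt v (0 : RatFun n) = 0 := by
  simpa using evalAt_algebraMap (v := v) (0 : Poly n)

theorem evalAt_mul {f g : RatFun n} (hf : f ∈ smooth v) (hg : g ∈ smooth v) :
    evalAt v (f * g) = evalAt v f * evalAt v g := by
  obtain ⟨p, q, hq, rfl⟩ := hf
  obtain ⟨p', q', hq', rfl⟩ := hg
  rw [div_mul_div_comm, ← map_mul, ← map_mul, evalAt_div (by simp [hq, hq']), evalAt_div hq,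
    evalAt_div hq', map_mul, map_mul, div_mul_div_comm]

theorem evalAt_add {f g : RatFun n} (hf : f ∈ smooth v) (hg : g ∈ smooth v) :
    evalAt v (f + g) = evalAt v f + evalAt v g := by
  obtain ⟨p, q, hq, rfl⟩ := hf
  obtain ⟨p', q', hq', rfl⟩ := hg
  rw [div_add_div _ _ (algebraMap_ne_zero_of_map hq) (algebraMap_ne_zero_of_map hq'),
    ← map_mul, ← map_mul, ← map_add, ← map_mul, evalAt_div (by simp [hq, hq']), evalAt_div hq,
    evalAt_div hq', div_add_div _ _ hq hq']
  simp

theorem evalAt_neg {f : RatFun n} (hf : f ∈ smooth v) : evalAt v (-f) = -evalAt v f := by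
  have := evalAt_add hf (neg_mem hf)
  rw [add_neg_cancel, evalAt_zero] at this
  exact (neg_eq_of_add_eq_zero_right this.symm).symm

theorem evalAt_sum {ι : Type*} (s : Finset ι) {f : ι → RatFun n} (hf : ∀ i ∈ s, f i ∈ smooth v) :
    evalAt v (∑ i ∈ s, f i) = ∑ i ∈ s, evalAt v (f i) := by
  classical
  induction s using Finset.induction_on with
  | empty => simp [evalAt_zero]
  | insert a s ha ih =>
    rw [sum_insert ha, sum_insert ha, evalAt_add (hf a (mem_insert_self _ _))
      (sum_mem fun i hi => hf i (mem_insert_of_mem hi)), ih fun i hi => hf i (mem_insert_of_mem hi)]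

/-- A complex number as a rational function. -/
theorem algebraMap_complex (c : ℂ) :
    algebraMap ℂ (RatFun n) c = algebraMap (Poly n) (RatFun n) (MvPolynomial.C c) :=
  IsScalarTower.algebraMap_apply ℂ (Poly n) (RatFun n) c

theorem algebraMap_complex_mem (c : ℂ) : algebraMap ℂ (RatFun n) c ∈ smooth v := by
  rw [algebraMap_complex]
  exact algebraMap_mem_regular _

theorem evalAt_complex (c : ℂ) : evalAt v (algebraMap ℂ (RatFun n) c) = c := by
  rw [algebraMap_complex, evalAt_algebraMap, MvPolynomial.eval_C]

/-! ### Partial derivatives -/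

/-- The quotient rule does not depend on the representing fraction: `h` is the cross-multiplied
equality of the two fractions and `h'` its derivative. -/
theorem quotient_rule_aux {R : Type*} [CommRing R] {a a' b b' p p' q q' : R} (h : a * q = p * b)
    (h' : a' * q + a * q' = p' * b + p * b') :
    (a' * b - a * b') * q ^ 2 = (p' * q - p * q') * b ^ 2 := by
  linear_combination (b * q) * h' - (b' * q + q' * b) * h

theorem quotient_rule_congr (x : Idx n) {a b p q : Poly n} (hb : b ≠ 0) (hq : q ≠ 0)
    (h : a * q = p * b) :
    algebraMap (Poly n) (RatFun n) (MvPolynomial.pderiv x a * b - a * MvPolynomial.pderiv x b) /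
        algebraMap (Poly n) (RatFun n) b ^ 2 =
      algebraMap (Poly n) (RatFun n) (MvPolynomial.pderiv x p * q - p * MvPolynomial.pderiv x q) /
        algebraMap (Poly n) (RatFun n) q ^ 2 := by
  have h' := congrArg (MvPolynomial.pderiv x) h
  rw [MvPolynomial.pderiv_mul, MvPolynomial.pderiv_mul] at h'
  have hb1 : algebraMap (Poly n) (RatFun n) b ≠ 0 := by
    rwa [Ne, IsFractionRing.to_map_eq_zero_iff]
  have hq1 : algebraMap (Poly n) (RatFun n) q ≠ 0 := by
    rwa [Ne, IsFractionRing.to_map_eq_zero_iff]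
  rw [div_eq_div_iff (pow_ne_zero 2 hb1) (pow_ne_zero 2 hq1), ← map_pow, ← map_pow, ← map_mul,
    ← map_mul]
  exact congrArg _ (quotient_rule_aux h h')

theorem pderivRat_div (x : Idx n) {p q : Poly n} (hq : q ≠ 0) :
    pderivRat x (algebraMap (Poly n) (RatFun n) p / algebraMap (Poly n) (RatFun n) q) =
      algebraMap (Poly n) (RatFun n) (MvPolynomial.pderiv x p * q - p * MvPolynomial.pderiv x q) /
        algebraMap (Poly n) (RatFun n) q ^ 2 :=
  quotient_rule_congr x (nonZeroDivisors.coe_ne_zero _) hq (num_mul_eq hq rfl)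

theorem exists_div (f : RatFun n) : ∃ p q : Poly n, q ≠ 0 ∧
    f = algebraMap (Poly n) (RatFun n) p / algebraMap (Poly n) (RatFun n) q := by
  obtain ⟨p, q, hq, rfl⟩ := IsFractionRing.div_surjective (A := Poly n) f
  exact ⟨p, q, nonZeroDivisors.ne_zero hq, rfl⟩

theorem pderivRat_algebraMap (x : Idx n) (p : Poly n) :
    pderivRat x (algebraMap (Poly n) (RatFun n) p) =
      algebraMap (Poly n) (RatFun n) (MvPolynomial.pderiv x p) := by
  have := pderivRat_div x (p := p) (q := 1) one_ne_zero
  simpa using this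

theorem pderivRat_add (x : Idx n) (f g : RatFun n) :
    pderivRat x (f + g) = pderivRat x f + pderivRat x g := by
  obtain ⟨p, q, hq, rfl⟩ := exists_div f
  obtain ⟨p', q', hq', rfl⟩ := exists_div g
  have h : algebraMap (Poly n) (RatFun n) q ≠ 0 := by rwa [Ne, IsFractionRing.to_map_eq_zero_iff]
  have h' : algebraMap (Poly n) (RatFun n) q' ≠ 0 := by rwa [Ne, IsFractionRing.to_map_eq_zero_iff]
  rw [div_add_div _ _ h h', ← map_mul, ← map_mul, ← map_add, ← map_mul, pderivRat_div x hq,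
    pderivRat_div x hq', pderivRat_div x (mul_ne_zero hq hq')]
  simp only [map_add, map_sub, map_mul, MvPolynomial.pderiv_mul]
  field_simp
  ring

theorem pderivRat_mul (x : Idx n) (f g : RatFun n) :
    pderivRat x (f * g) = pderivRat x f * g + f * pderivRat x g := by
  obtain ⟨p, q, hq, rfl⟩ := exists_div f
  obtain ⟨p', q', hq', rfl⟩ := exists_div g
  have h : algebraMap (Poly n) (RatFun n) q ≠ 0 := by rwa [Ne, IsFractionRing.to_map_eq_zero_iff]
  have h' : algebraMap (Poly n) (RatFun n) q' ≠ 0 := by rwa [Ne, IsFractionRing.to_map_eq_zero_iff]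
  rw [div_mul_div_comm, ← map_mul, ← map_mul, pderivRat_div x hq,
    pderivRat_div x hq', pderivRat_div x (mul_ne_zero hq hq')]
  simp only [map_add, map_sub, map_mul, MvPolynomial.pderiv_mul]
  field_simp
  ring

theorem pderivRat_complex (x : Idx n) (c : ℂ) : pderivRat x (algebraMap ℂ (RatFun n) c) = 0 := by
  rw [algebraMap_complex, pderivRat_algebraMap, MvPolynomial.pderiv_C, map_zero]

theorem pderivRat_mem {f : RatFun n} (x : Idx n) (hf : f ∈ smooth v) : pderivRat x f ∈ smooth v := by
  obtain ⟨p, q, hq, rfl⟩ := hf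
  rw [pderivRat_div x (fun h => hq (by rw [h, map_zero])), ← map_pow]
  exact ⟨_, _, by simp [hq], rfl⟩

/-- The partial derivative as a derivation. -/
def pderivation (x : Idx n) : Derivation ℂ (RatFun n) (RatFun n) :=
  Derivation.mk' ⟨⟨pderivRat x, pderivRat_add x⟩, fun c f => by
    change pderivRat x (c • f) = c • pderivRat x f
    rw [Algebra.smul_def, pderivRat_mul, pderivRat_complex, zero_mul, zero_add, Algebra.smul_def]⟩
    fun f g => by
      change pderivRat x (f * g) = f • pderivRat x g + g • pderivRat x f
      rw [pderivRat_mul, smul_eq_mul, smul_eq_mul]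
      ring

/-- A derivation that vanishes on polynomials vanishes. -/
theorem derivation_eq_zero {D : Derivation ℂ (RatFun n) (RatFun n)}
    (h : ∀ x, D (algebraMap (Poly n) (RatFun n) (MvPolynomial.X x)) = 0) : D = 0 := by
  have hp : ∀ p : Poly n, D (algebraMap (Poly n) (RatFun n) p) = 0 := by
    intro p
    induction p using MvPolynomial.induction_on with
    | C c => rw [← algebraMap_complex, D.map_algebraMap]
    | add p q hp hq => rw [map_add, map_add, hp, hq, add_zero]
    | mul_X p x hp => rw [map_mul, D.leibniz, h, hp, smul_zero, smul_zero, add_zero]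
  ext f
  obtain ⟨p, q, hq, rfl⟩ := exists_div f
  have hq1 : algebraMap (Poly n) (RatFun n) q ≠ 0 := by
    rwa [Ne, IsFractionRing.to_map_eq_zero_iff]
  have := D.leibniz (algebraMap (Poly n) (RatFun n) p / algebraMap (Poly n) (RatFun n) q)
    (algebraMap (Poly n) (RatFun n) q)
  rw [div_mul_cancel₀ _ hq1, hp, hp, smul_zero, zero_add, smul_eq_mul] at this
  exact (mul_eq_zero.mp this.symm).resolve_left hq1

/-- The commutator of two derivations is again a derivation, so it is enough to evaluate it on the
variables, whose first derivatives are constant. -/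
theorem pderivation_comm (x y : Idx n) : ⁅pderivation x, pderivation y⁆ = 0 := by
  refine derivation_eq_zero fun z => ?_
  classical
  rw [Derivation.commutator_apply]
  change pderivRat x (pderivRat y _) - pderivRat y (pderivRat x _) = 0
  simp only [pderivRat_algebraMap, MvPolynomial.pderiv_X, Pi.single_apply]
  split_ifs <;> simp

theorem pderivRat_comm (x y : Idx n) (f : RatFun n) :
    pderivRat x (pderivRat y f) = pderivRat y (pderivRat x f) := by
  have h := DFunLike.congr_fun (pderivation_comm x y) f
  rw [Derivation.commutator_apply] at h
  exact sub_eq_zero.mp h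

end GT

namespace GT

variable {n t : ℕ} {v : Tab n ℂ}

/-! ### Automorphisms of the field of rational functions -/

/-- The extension of an automorphism of the polynomial ring to rational functions. -/
def fracMap (φ : Poly n ≃ₐ[ℂ] Poly n) : RatFun n ≃+* RatFun n :=
  IsFractionRing.ringEquivOfRingEquiv φ.toRingEquiv

theorem fracMap_algebraMap (φ : Poly n ≃ₐ[ℂ] Poly n) (p : Poly n) :
    fracMap φ (algebraMap (Poly n) (RatFun n) p) = algebraMap (Poly n) (RatFun n) (φ p) :=
  IsFractionRing.ringEquivOfRingEquiv_algebraMap _ _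

theorem fracMap_div (φ : Poly n ≃ₐ[ℂ] Poly n) (p q : Poly n) :
    fracMap φ (algebraMap (Poly n) (RatFun n) p / algebraMap (Poly n) (RatFun n) q) =
      algebraMap (Poly n) (RatFun n) (φ p) / algebraMap (Poly n) (RatFun n) (φ q) := by
  rw [map_div₀, fracMap_algebraMap, fracMap_algebraMap]

theorem fracMap_complex (φ : Poly n ≃ₐ[ℂ] Poly n) (c : ℂ) :
    fracMap φ (algebraMap ℂ (RatFun n) c) = algebraMap ℂ (RatFun n) c := by
  rw [algebraMap_complex, fracMap_algebraMap, ← MvPolynomial.algebraMap_eq, φ.commutes]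

/-- The translation `x ↦ x + a` of the variables. -/
def translate (a : Shift n) : Poly n ≃ₐ[ℂ] Poly n :=
  AlgEquiv.ofAlgHom
    (MvPolynomial.aeval fun p => MvPolynomial.X p + MvPolynomial.C ((a.1 p : ℤ) : ℂ))
    (MvPolynomial.aeval fun p => MvPolynomial.X p - MvPolynomial.C ((a.1 p : ℤ) : ℂ))
    (by ext p; simp) (by ext p; simp)

theorem translate_X (a : Shift n) (p : Idx n) :
    translate a (MvPolynomial.X p) = MvPolynomial.X p + MvPolynomial.C ((a.1 p : ℤ) : ℂ) :=
  MvPolynomial.aeval_X _ _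

theorem fracMap_translate_xTab (a z : Shift n) (p : Idx n) :
    fracMap (translate a) (xTab z p) = xTab (z + a) p := by
  rw [xTab_add, xTab, map_add, fracMap_algebraMap, translate_X, map_add, map_intCast]
  simp
  ring

/-- The interchange of two variables. -/
def interchange (p q : Idx n) : Poly n ≃ₐ[ℂ] Poly n :=
  MvPolynomial.renameEquiv ℂ (Equiv.swap p q)

theorem interchange_apply (p q : Idx n) (f : Poly n) :
    interchange p q f = MvPolynomial.rename (Equiv.swap p q) f := rfl

theorem pderivRat_interchange (p q x : Idx n) (f : RatFun n) :
    pderivRat x (fracMap (interchange p q) f) =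
      fracMap (interchange p q) (pderivRat (Equiv.swap p q x) f) := by
  have key : ∀ g : Poly n, MvPolynomial.pderiv x (interchange p q g) =
      interchange p q (MvPolynomial.pderiv (Equiv.swap p q x) g) := fun g => by
    have := MvPolynomial.pderiv_rename (Equiv.swap p q).injective (Equiv.swap p q x) g
    rwa [Equiv.swap_apply_self] at this
  obtain ⟨a, b, hb, rfl⟩ := exists_div f
  rw [fracMap_div, pderivRat_div _ hb, pderivRat_div _ (by simpa using hb), key, key,
    ← map_pow, ← map_pow, ← map_pow, fracMap_div]
  simp only [map_sub, map_mul, map_pow]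

theorem eval_interchange {p q : Idx n} (h : v p = v q) (f : Poly n) :
    MvPolynomial.eval v (interchange p q f) = MvPolynomial.eval v f := by
  rw [interchange_apply, MvPolynomial.eval_rename]
  congr 2
  funext x
  by_cases hp : x = p
  · rw [hp, Function.comp, Equiv.swap_apply_left, h]
  by_cases hq : x = q
  · rw [hq, Function.comp, Equiv.swap_apply_right, h]
  rw [Function.comp, Equiv.swap_apply_of_ne_of_ne hp hq]

theorem interchange_mem {p q : Idx n} (h : v p = v q) {f : RatFun n} (hf : f ∈ smooth v) :
    fracMap (interchange p q) f ∈ smooth v := by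
  obtain ⟨a, b, hb, rfl⟩ := hf
  rw [fracMap_div]
  exact ⟨_, _, by rwa [eval_interchange h], rfl⟩

theorem evalAt_interchange {p q : Idx n} (h : v p = v q) {f : RatFun n} (hf : f ∈ smooth v) :
    evalAt v (fracMap (interchange p q) f) = evalAt v f := by
  obtain ⟨a, b, hb, rfl⟩ := hf
  rw [fracMap_div, evalAt_div hb, evalAt_div (by rwa [eval_interchange h]), eval_interchange h,
    eval_interchange h]

/-- Modulo the difference of the two variables the interchange acts trivially; the induction makes
the divisibility explicit. -/
theorem sub_dvd_sub_interchange (p q : Idx n) (f : Poly n) :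
    (MvPolynomial.X p - MvPolynomial.X q : Poly n) ∣ f - interchange p q f := by
  induction f using MvPolynomial.induction_on with
  | C c => simp [interchange_apply]
  | add f g hf hg =>
    have := dvd_add hf hg
    rwa [map_add, add_sub_add_comm]
  | mul_X f x hf =>
    have h1 : f * MvPolynomial.X x - interchange p q (f * MvPolynomial.X x) =
        (f - interchange p q f) * MvPolynomial.X x +
          interchange p q f * (MvPolynomial.X x - MvPolynomial.X (Equiv.swap p q x)) := by
      rw [map_mul, interchange_apply p q (MvPolynomial.X x), MvPolynomial.rename_X]
      ring
    rw [h1]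
    refine dvd_add (dvd_mul_of_dvd_left hf _) (dvd_mul_of_dvd_right ?_ _)
    by_cases hp : x = p
    · rw [hp, Equiv.swap_apply_left]
    by_cases hq : x = q
    · rw [hq, Equiv.swap_apply_right]
      exact ⟨-1, by ring⟩
    rw [Equiv.swap_apply_of_ne_of_ne hp hq, sub_self]
    exact dvd_zero _

/-- The divided difference of a smooth function is smooth. -/
theorem exists_sub_interchange_eq {p q : Idx n} (h : v p = v q) {f : RatFun n}
    (hf : f ∈ smooth v) : ∃ g ∈ smooth v, f - fracMap (interchange p q) f =
      (algebraMap (Poly n) (RatFun n) (MvPolynomial.X p) -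
        algebraMap (Poly n) (RatFun n) (MvPolynomial.X q)) * g := by
  obtain ⟨a, b, hb, rfl⟩ := hf
  have hb' : MvPolynomial.eval v (interchange p q b) ≠ 0 := by rwa [eval_interchange h]
  -- Over the common denominator `b · τ(b)`, with `τ` the interchange, the numerator of `a/b -
  -- τ(a/b)` is `a τ(b) - τ(a τ(b))`, because `τ` is an involution. It is thus a polynomial
  -- difference of the divisible kind.
  obtain ⟨c, hc⟩ := sub_dvd_sub_interchange p q (a * interchange p q b)
  refine ⟨_, ⟨c, b * interchange p q b, by rw [map_mul]; exact mul_ne_zero hb hb', rfl⟩, ?_⟩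
  have hinv : interchange p q (interchange p q b) = b := by
    rw [interchange_apply, interchange_apply, MvPolynomial.rename_rename]
    have : (Equiv.swap p q) ∘ (Equiv.swap p q) = id := by
      funext x; simp
    rw [this, MvPolynomial.rename_id_apply]
  rw [map_mul, hinv] at hc
  rw [fracMap_div, div_sub_div _ _ (algebraMap_ne_zero_of_map hb) (algebraMap_ne_zero_of_map hb'),
    ← map_sub, mul_div_assoc', ← map_mul, ← map_mul, ← map_mul, ← map_mul, ← map_sub, ← hc,
    mul_comm b (interchange p q a)]

/-! ### Functions invariant under integral translations -/

theorem eval_aeval {σ R : Type*} [CommRing R] [Algebra ℂ R] (c : σ → R)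
    (g : σ → MvPolynomial σ R) (f : MvPolynomial σ ℂ) :
    MvPolynomial.eval c (MvPolynomial.aeval g f) =
      MvPolynomial.aeval (fun x => MvPolynomial.eval c (g x)) f := by
  induction f using MvPolynomial.induction_on with
  | C c => simp [MvPolynomial.algebraMap_apply]
  | add f g hf hg => simp only [map_add, hf, hg]
  | mul_X f x hf => simp only [map_mul, hf, MvPolynomial.aeval_X]

/-- A rational function invariant under all integral translations of the rows below the row `m`
is unchanged by substitutions for the variables of these rows. -/
theorem mul_subst_eq_subst_mul {m : ℕ} (hm : m + 1 ≤ n) {p q : Poly n} (hq : q ≠ 0)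
    (hinv : ∀ a : Shift n, (∀ x : Idx n, m ≤ x.1.val → a.1 x = 0) →
      fracMap (translate a) (algebraMap (Poly n) (RatFun n) p / algebraMap (Poly n) (RatFun n) q) =
        algebraMap (Poly n) (RatFun n) p / algebraMap (Poly n) (RatFun n) q)
    (ψ : Poly n →ₐ[ℂ] Poly n)
    (hψ : ∀ x : Idx n, m ≤ x.1.val → ψ (MvPolynomial.X x) = MvPolynomial.X x) :
    ψ p * q = p * ψ q := by
  set Φ : Poly n →ₐ[ℂ] MvPolynomial (Idx n) (Poly n) := MvPolynomial.aeval fun x =>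
    MvPolynomial.C (MvPolynomial.X x) + if x.1.val < m then MvPolynomial.X x else 0 with hΦ'
  have hΦ : ∀ (c : Idx n → Poly n) (f : Poly n), MvPolynomial.eval c (Φ f) =
      MvPolynomial.aeval (fun x => MvPolynomial.X x + if x.1.val < m then c x else 0) f := by
    intro c f
    rw [hΦ', eval_aeval]
    refine congrArg (fun g => MvPolynomial.aeval g f) (funext fun x => ?_)
    rw [map_add, MvPolynomial.eval_C]
    split_ifs <;> simp
  -- The map `Φ` translates the low rows by new independent variables. The identity holds whenever
  -- these take integer values, an infinite set in each variable, and hence identically. Setting the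
  -- new variables to `ψ(X) - X` then turns `Φ` into `ψ`.
  have h0 : Φ p * MvPolynomial.C q = MvPolynomial.C p * Φ q := by
    refine MvPolynomial.funext_set (fun _ => Set.range (Int.cast : ℤ → Poly n))
      (fun _ => Set.infinite_range_of_injective Int.cast_injective) fun c hc => ?_
    choose b hb using fun x => hc x (Set.mem_univ x)
    let a : Shift n := ⟨fun x => if x.1.val < m then b x else 0, fun x hx => if_neg (by omega)⟩
    have hf := hinv a fun x hx => if_neg (by omega)
    have hs : ∀ f : Poly n, MvPolynomial.eval c (Φ f) = translate a f := by
      intro f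
      rw [hΦ]
      refine congrArg (fun g => MvPolynomial.aeval g f) (funext fun x => ?_)
      change _ = MvPolynomial.X x + MvPolynomial.C (((if x.1.val < m then b x else 0 : ℤ)) : ℂ)
      rw [← hb x]
      split_ifs <;> simp
    rw [map_mul, map_mul, hs, hs, MvPolynomial.eval_C, MvPolynomial.eval_C]
    rw [fracMap_div, div_eq_div_iff, ← map_mul, ← map_mul] at hf
    · exact IsFractionRing.injective (Poly n) (RatFun n) hf
    · rw [Ne, IsFractionRing.to_map_eq_zero_iff]
      simpa using hq
    · rwa [Ne, IsFractionRing.to_map_eq_zero_iff]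
  have h1 := congrArg (MvPolynomial.eval fun x => ψ (MvPolynomial.X x) - MvPolynomial.X x) h0
  have hs : ∀ f : Poly n, MvPolynomial.eval
      (fun x => ψ (MvPolynomial.X x) - MvPolynomial.X x) (Φ f) = ψ f := by
    intro f
    rw [hΦ]
    refine Eq.trans ?_ (DFunLike.congr_fun (MvPolynomial.aeval_unique ψ) f).symm
    refine congrArg (fun g => MvPolynomial.aeval g f) (funext fun x => ?_)
    rw [Function.comp]
    split_ifs with hx
    · ring
    · rw [hψ x (by omega), add_zero]
  rwa [map_mul, map_mul, hs, hs, MvPolynomial.eval_C, MvPolynomial.eval_C] at h1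

end GT

namespace GT

namespace SingularPairs

variable {n t : ℕ} {v : Tab n ℂ} (S : SingularPairs n t)

theorem left_ne_right (r : Fin t) : S.left r ≠ S.right r := by
  intro h
  have h2 : S.fst r = S.snd r := by simpa [left, right] using h
  exact (S.fst_lt_snd r).ne h2

theorem left_ne_left {r s : Fin t} (h : r ≠ s) : S.left r ≠ S.left s := fun e =>
  Set.disjoint_left.mp (S.disjoint r s h) (Or.inl rfl) (Or.inl e)

theorem left_ne_right_of_ne {r s : Fin t} (h : r ≠ s) : S.left r ≠ S.right s := fun e =>
  Set.disjoint_left.mp (S.disjoint r s h) (Or.inl rfl) (Or.inr e)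

theorem right_ne_right {r s : Fin t} (h : r ≠ s) : S.right r ≠ S.right s := fun e =>
  Set.disjoint_left.mp (S.disjoint r s h) (Or.inr rfl) (Or.inr e)

theorem right_ne_left_of_ne {r s : Fin t} (h : r ≠ s) : S.right r ≠ S.left s := fun e =>
  Set.disjoint_left.mp (S.disjoint r s h) (Or.inr rfl) (Or.inl e)

/-- The interchange of the variables of the singular pair `r`. -/
def flip (r : Fin t) : RatFun n ≃+* RatFun n := fracMap (interchange (S.left r) (S.right r))

/-- The difference of the variables of the singular pair `r`. -/
def gap (r : Fin t) : RatFun n := algebraMap (Poly n) (RatFun n) (MvPolynomial.X (S.left r)) -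
  algebraMap (Poly n) (RatFun n) (MvPolynomial.X (S.right r))

theorem P_eq (Δ : Finset (Fin t)) : S.P Δ = ∏ r ∈ Δ, S.gap r := rfl

theorem dOne_add (r : Fin t) (f g : RatFun n) : S.dOne r (f + g) = S.dOne r f + S.dOne r g := by
  simp only [dOne, pderivRat_add]
  ring

theorem dOne_mul (r : Fin t) (f g : RatFun n) :
    S.dOne r (f * g) = S.dOne r f * g + f * S.dOne r g := by
  simp only [dOne, pderivRat_mul]
  ring

theorem dOne_complex (r : Fin t) (c : ℂ) : S.dOne r (algebraMap ℂ (RatFun n) c) = 0 := by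
  simp only [dOne, pderivRat_complex, sub_self, zero_div]

theorem dOne_complex_mul (r : Fin t) (c : ℂ) (f : RatFun n) :
    S.dOne r (algebraMap ℂ (RatFun n) c * f) = algebraMap ℂ (RatFun n) c * S.dOne r f := by
  rw [dOne_mul, dOne_complex, zero_mul, zero_add]

theorem two_eq : (2 : RatFun n) = algebraMap ℂ (RatFun n) 2 :=
  (map_ofNat (algebraMap ℂ (RatFun n)) 2).symm

theorem div_two_mem {f : RatFun n} (hf : f ∈ smooth v) : f / 2 ∈ smooth v := by
  have : f / 2 = algebraMap ℂ (RatFun n) 2⁻¹ * f := by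
    rw [map_inv₀, ← two_eq]
    ring
  rw [this]
  exact mul_mem (algebraMap_complex_mem _) hf

theorem dOne_mem (r : Fin t) {f : RatFun n} (hf : f ∈ smooth v) : S.dOne r f ∈ smooth v :=
  div_two_mem (sub_mem (pderivRat_mem _ hf) (pderivRat_mem _ hf))

theorem dOne_eq (r : Fin t) (f : RatFun n) : S.dOne r f =
    algebraMap ℂ (RatFun n) 2⁻¹ * (pderivation (S.left r) f - pderivation (S.right r) f) := by
  rw [map_inv₀, ← two_eq, dOne, div_eq_inv_mul]
  rfl

theorem derivation_sub_comm {A : Type*} [CommRing A] [Algebra ℂ A] {a b c d : Derivation ℂ A A}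
    (hac : ∀ f, a (c f) = c (a f)) (had : ∀ f, a (d f) = d (a f)) (hbc : ∀ f, b (c f) = c (b f))
    (hbd : ∀ f, b (d f) = d (b f)) (k : ℂ) (f : A) :
    algebraMap ℂ A k * (a (algebraMap ℂ A k * (c f - d f)) - b (algebraMap ℂ A k * (c f - d f))) =
      algebraMap ℂ A k * (c (algebraMap ℂ A k * (a f - b f)) -
        d (algebraMap ℂ A k * (a f - b f))) := by
  simp only [← Algebra.smul_def, Derivation.map_smul, map_sub, hac, had, hbc, hbd]
  congr 1
  simp only [Algebra.smul_def]
  ring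

theorem dOne_comm (r s : Fin t) (f : RatFun n) : S.dOne r (S.dOne s f) = S.dOne s (S.dOne r f) := by
  rw [dOne_eq, dOne_eq, dOne_eq S s, dOne_eq S r]
  exact derivation_sub_comm (fun f => pderivRat_comm _ _ f) (fun f => pderivRat_comm _ _ f)
    (fun f => pderivRat_comm _ _ f) (fun f => pderivRat_comm _ _ f) _ _

theorem dOne_flip_self (r : Fin t) (f : RatFun n) :
    S.dOne r (S.flip r f) = -S.flip r (S.dOne r f) := by
  simp only [dOne, flip, pderivRat_interchange, Equiv.swap_apply_left, Equiv.swap_apply_right,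
    map_div₀, map_sub, map_ofNat]
  ring

theorem dOne_flip_of_ne {r s : Fin t} (h : s ≠ r) (f : RatFun n) :
    S.dOne s (S.flip r f) = S.flip r (S.dOne s f) := by
  simp only [dOne, flip, pderivRat_interchange, map_div₀, map_sub, map_ofNat]
  rw [Equiv.swap_apply_of_ne_of_ne (S.left_ne_left h) (S.left_ne_right_of_ne h),
    Equiv.swap_apply_of_ne_of_ne (S.right_ne_left_of_ne h) (S.right_ne_right h)]

theorem dOne_gap_self (r : Fin t) : S.dOne r (S.gap r) = 1 := by
  classical
  have hp : ∀ x y : Idx n, pderivRat x (algebraMap (Poly n) (RatFun n) (MvPolynomial.X y)) =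
      if y = x then 1 else 0 := fun x y => by
    rw [pderivRat_algebraMap, MvPolynomial.pderiv_X, Pi.single_apply]
    split_ifs <;> simp
  have hs : ∀ (x : Idx n) f g, pderivRat x (f - g) = pderivRat x f - pderivRat x g :=
    fun x f g => map_sub (pderivation x) f g
  simp only [dOne, gap, hs, hp, S.left_ne_right r, (S.left_ne_right r).symm, if_true, if_false]
  norm_num

theorem dOne_gap_of_ne {r s : Fin t} (h : s ≠ r) : S.dOne s (S.gap r) = 0 := by
  classical
  have hp : ∀ x y : Idx n, pderivRat x (algebraMap (Poly n) (RatFun n) (MvPolynomial.X y)) =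
      if y = x then 1 else 0 := fun x y => by
    rw [pderivRat_algebraMap, MvPolynomial.pderiv_X, Pi.single_apply]
    split_ifs <;> simp
  have hs : ∀ (x : Idx n) f g, pderivRat x (f - g) = pderivRat x f - pderivRat x g :=
    fun x f g => map_sub (pderivation x) f g
  simp only [dOne, gap, hs, hp, (S.left_ne_left h).symm, (S.left_ne_right_of_ne h).symm,
    (S.right_ne_left_of_ne h).symm, (S.right_ne_right h).symm, if_false]
  norm_num

theorem gap_mem (r : Fin t) : S.gap r ∈ smooth v :=
  sub_mem (algebraMap_mem_regular _) (algebraMap_mem_regular _)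

theorem P_mem (Δ : Finset (Fin t)) : S.P Δ ∈ smooth v := prod_mem fun r _ => S.gap_mem r

theorem gap_ne_zero (r : Fin t) : S.gap r ≠ 0 := by
  have h := xTab_sub_ne 0 (S.left_ne_right r) 0
  simpa [xTab, gap] using h

theorem flip_gap_self (r : Fin t) : S.flip r (S.gap r) = -S.gap r := by
  rw [flip, gap, map_sub, fracMap_algebraMap, fracMap_algebraMap, interchange_apply,
    interchange_apply, MvPolynomial.rename_X, MvPolynomial.rename_X, Equiv.swap_apply_left,
    Equiv.swap_apply_right, neg_sub]

theorem flip_gap_of_ne {r s : Fin t} (h : s ≠ r) : S.flip r (S.gap s) = S.gap s := by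
  rw [flip, gap, map_sub, fracMap_algebraMap, fracMap_algebraMap, interchange_apply,
    interchange_apply, MvPolynomial.rename_X, MvPolynomial.rename_X,
    Equiv.swap_apply_of_ne_of_ne (S.left_ne_left h) (S.left_ne_right_of_ne h),
    Equiv.swap_apply_of_ne_of_ne (S.right_ne_left_of_ne h) (S.right_ne_right h)]

theorem flip_P (r : Fin t) (Δ : Finset (Fin t)) :
    S.flip r (S.P Δ) = (if r ∈ Δ then -1 else 1) * S.P Δ := by
  rw [P_eq, map_prod]
  split_ifs with h
  · rw [← mul_prod_erase _ _ h, ← mul_prod_erase _ (fun r => S.gap r) h, flip_gap_self,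
      prod_congr rfl fun s hs => S.flip_gap_of_ne (mem_erase.mp hs).1]
    ring
  · rw [one_mul]
    refine prod_congr rfl fun s hs => S.flip_gap_of_ne ?_
    rintro rfl
    exact h hs

/-! ### The iterated derivatives -/

theorem dFun_empty (f : RatFun n) : S.dFun ∅ f = f := by simp [dFun]

/-- The first-order operators commute, so the fixed order in the definition is immaterial and any
index may be applied first. -/
theorem dFun_insert {r : Fin t} {I : Finset (Fin t)} (hr : r ∉ I) (f : RatFun n) :
    S.dFun (insert r I) f = S.dFun I (S.dOne r f) := by
  have hp : ((List.finRange t).filter fun s => decide (s ∈ insert r I)).Perm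
      (r :: (List.finRange t).filter fun s => decide (s ∈ I)) := by
    rw [List.perm_ext_iff_of_nodup ((List.nodup_finRange t).filter _)
      (List.nodup_cons.mpr ⟨by simpa using hr, (List.nodup_finRange t).filter _⟩)]
    intro s
    simp
  rw [dFun, hp.foldl_eq' (fun x _ y _ z => S.dOne_comm y x z), List.foldl_cons, dFun]

theorem dFun_mem (I : Finset (Fin t)) {f : RatFun n} (hf : f ∈ smooth v) :
    S.dFun I f ∈ smooth v := by
  induction I using Finset.induction_on generalizing f with
  | empty => rwa [dFun_empty]
  | insert s I hs ih =>
    rw [dFun_insert _ hs]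
    exact ih (S.dOne_mem s hf)

theorem dFun_add (I : Finset (Fin t)) (f g : RatFun n) :
    S.dFun I (f + g) = S.dFun I f + S.dFun I g := by
  induction I using Finset.induction_on generalizing f g with
  | empty => simp [dFun_empty]
  | insert s I hs ih => rw [dFun_insert _ hs, dFun_insert _ hs, dFun_insert _ hs, dOne_add, ih]

theorem dFun_complex_mul (I : Finset (Fin t)) (c : ℂ) (f : RatFun n) :
    S.dFun I (algebraMap ℂ (RatFun n) c * f) = algebraMap ℂ (RatFun n) c * S.dFun I f := by
  induction I using Finset.induction_on generalizing f with
  | empty => simp [dFun_empty]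
  | insert s I hs ih => rw [dFun_insert _ hs, dFun_insert _ hs, dOne_complex_mul, ih]

/-- Each first-order operator occurs at most once, so the iterated Leibniz rule is a sum over the
ways of splitting `I`, without multiplicities. -/
theorem dFun_mul (I : Finset (Fin t)) (f g : RatFun n) :
    S.dFun I (f * g) = ∑ J ∈ I.powerset, S.dFun J f * S.dFun (I \ J) g := by
  induction I using Finset.induction_on generalizing f g with
  | empty => simp [dFun_empty]
  | insert s I hs ih =>
    rw [dFun_insert _ hs, dOne_mul, dFun_add, ih, ih, sum_powerset_insert hs, add_comm]
    congr 1
    · refine sum_congr rfl fun J hJ => ?_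
      have hJ' : s ∉ J := fun h => hs (mem_powerset.mp hJ h)
      rw [insert_sdiff_of_notMem _ hJ', dFun_insert _ (fun h => hs (mem_sdiff.mp h).1)]
    · refine sum_congr rfl fun J hJ => ?_
      have hJ' : s ∉ J := fun h => hs (mem_powerset.mp hJ h)
      rw [dFun_insert _ hJ', insert_sdiff_insert, sdiff_insert_of_notMem hs]

theorem dFun_flip (r : Fin t) (I : Finset (Fin t)) (f : RatFun n) :
    S.dFun I (S.flip r f) = (if r ∈ I then -1 else 1) * S.flip r (S.dFun I f) := by
  induction I using Finset.induction_on generalizing f with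
  | empty => simp [dFun_empty]
  | insert s I hs ih =>
    rw [dFun_insert _ hs, dFun_insert _ hs]
    by_cases hsr : s = r
    · subst hsr
      have : ∀ g : RatFun n, S.dFun I (-g) = -S.dFun I g := fun g => by
        have := S.dFun_complex_mul I (-1) g
        simpa using this
      rw [dOne_flip_self, this, ih, if_neg hs, if_pos (mem_insert_self _ _), one_mul, neg_one_mul]
    · rw [dOne_flip_of_ne _ hsr, ih]
      simp only [mem_insert, Ne.symm hsr, false_or]

/-! ### Values of the iterated derivatives -/

theorem dVal_empty (f : RatFun n) : S.dVal v ∅ f = evalAt v f := by rw [dVal, dFun_empty]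

theorem dVal_add (I : Finset (Fin t)) {f g : RatFun n} (hf : f ∈ smooth v) (hg : g ∈ smooth v) :
    S.dVal v I (f + g) = S.dVal v I f + S.dVal v I g := by
  rw [dVal, dFun_add, evalAt_add (S.dFun_mem I hf) (S.dFun_mem I hg), dVal, dVal]

theorem dVal_zero (I : Finset (Fin t)) : S.dVal v I 0 = 0 := by
  have h := S.dFun_complex_mul I 0 0
  rw [map_zero, zero_mul, zero_mul] at h
  rw [dVal, h, evalAt_zero]

theorem dVal_complex_mul (I : Finset (Fin t)) (c : ℂ) {f : RatFun n} (hf : f ∈ smooth v) :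
    S.dVal v I (algebraMap ℂ (RatFun n) c * f) = c * S.dVal v I f := by
  rw [dVal, dFun_complex_mul, evalAt_mul (algebraMap_complex_mem c) (S.dFun_mem I hf),
    evalAt_complex, dVal]

theorem dVal_mul (I : Finset (Fin t)) {f g : RatFun n} (hf : f ∈ smooth v) (hg : g ∈ smooth v) :
    S.dVal v I (f * g) = ∑ J ∈ I.powerset, S.dVal v J f * S.dVal v (I \ J) g := by
  rw [dVal, dFun_mul, evalAt_sum _ fun J _ => mul_mem (S.dFun_mem J hf) (S.dFun_mem _ hg)]
  exact sum_congr rfl fun J _ => evalAt_mul (S.dFun_mem J hf) (S.dFun_mem _ hg)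

theorem dVal_one {I : Finset (Fin t)} (hI : I.Nonempty) : S.dVal v I 1 = 0 := by
  obtain ⟨r, hr⟩ := hI
  have h := S.dOne_complex r 1
  rw [map_one] at h
  rw [dVal, ← insert_erase hr, dFun_insert _ (notMem_erase _ _), h]
  exact S.dVal_zero _

/-- At `v` the two entries of the pair agree, so the flip does not change values. The sign comes
only from the derivative along the pair `r`, which is odd under the flip. -/
theorem dVal_flip (hv : S.IsCritical v) (r : Fin t) (I : Finset (Fin t)) {f : RatFun n}
    (hf : f ∈ smooth v) : S.dVal v I (S.flip r f) = (if r ∈ I then -1 else 1) * S.dVal v I f := by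
  rw [dVal, dFun_flip]
  split_ifs
  · rw [neg_one_mul, flip, evalAt_neg (interchange_mem (hv.1 r) (S.dFun_mem I hf)), neg_one_mul,
      dVal, evalAt_interchange (hv.1 r) (S.dFun_mem I hf)]
  · rw [one_mul, one_mul, dVal, flip, evalAt_interchange (hv.1 r) (S.dFun_mem I hf)]

/-- The gap vanishes at `v`, has derivative `1` along its own pair because of the factor one half,
and derivative `0` along every other pair. -/
theorem dVal_gap (hv : S.IsCritical v) (r : Fin t) (I : Finset (Fin t)) :
    S.dVal v I (S.gap r) = if I = {r} then 1 else 0 := by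
  rcases I.eq_empty_or_nonempty with rfl | ⟨s, hs⟩
  · rw [dVal_empty, if_neg (singleton_ne_empty r).symm, gap, ← map_sub, evalAt_algebraMap,
      map_sub, MvPolynomial.eval_X, MvPolynomial.eval_X, hv.1 r, sub_self]
  · rw [dVal, ← insert_erase hs, dFun_insert _ (notMem_erase _ _)]
    by_cases hsr : s = r
    · subst hsr
      rw [dOne_gap_self]
      change S.dVal v _ 1 = _
      rcases (I.erase s).eq_empty_or_nonempty with h | h
      · rw [h, dVal_empty, evalAt_one, if_pos (by simp)]
      · rw [dVal_one _ h, if_neg]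
        intro h'
        rw [insert_erase hs] at h'
        simp [h'] at h
    · rw [dOne_gap_of_ne _ hsr]
      refine (S.dVal_zero _).trans (if_neg fun h => hsr ?_).symm
      rw [insert_erase hs] at h
      rw [h] at hs
      exact mem_singleton.mp hs

end SingularPairs

end GT

namespace GT

/-! ### Semilinear symmetries -/

set_option linter.unusedSectionVars false

section Twist

variable {K Λ : Type*} [Field K] [AddCommGroup Λ]

/-- The semilinear map `f T(z) ↦ θ(f) T(α(z))`. -/
def twist (θ : K ≃+* K) (α : Λ ≃ Λ) : (Λ →₀ K) →+ (Λ →₀ K) :=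
  (Finsupp.mapDomain.addMonoidHom α).comp (Finsupp.mapRange.addMonoidHom (θ : K →+ K))

variable {θ : K ≃+* K} {α : Λ ≃ Λ}

theorem twist_single (z : Λ) (f : K) :
    twist θ α (Finsupp.single z f) = Finsupp.single (α z) (θ f) := by
  change Finsupp.mapDomain α (Finsupp.mapRange (θ : K →+ K) (map_zero _) _) = _
  rw [Finsupp.mapRange_single, Finsupp.mapDomain_single]
  rfl

theorem twist_apply (F : Λ →₀ K) (z : Λ) : twist θ α F (α z) = θ (F z) :=
  Finsupp.mapDomain_apply α.injective _ _

theorem twist_apply' (F : Λ →₀ K) (z : Λ) : twist θ α F z = θ (F (α.symm z)) := by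
  rw [← twist_apply, α.apply_symm_apply]

theorem twist_smul (f : K) (F : Λ →₀ K) : twist θ α (f • F) = θ f • twist θ α F := by
  ext z
  rw [twist_apply', Finsupp.smul_apply, Finsupp.smul_apply, twist_apply', smul_eq_mul, map_mul,
    smul_eq_mul]

/-- Equality of `Θ ∘ X` and `X ∘ Θ` can be checked on the basis. -/
theorem twist_comm_of_basis {X : Module.End K (Λ →₀ K)}
    (h : ∀ z, twist θ α (X (Finsupp.single z 1)) = X (Finsupp.single (α z) 1)) (F : Λ →₀ K) :
    twist θ α (X F) = X (twist θ α F) := by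
  induction F using Finsupp.induction_linear with
  | zero => simp
  | add F G hF hG => rw [map_add, map_add, hF, hG, map_add, map_add]
  | single z f =>
    have h1 : Finsupp.single z f = f • Finsupp.single z (1 : K) := by simp
    rw [h1, map_smul, twist_smul, h, twist_smul, map_smul, twist_single, map_one]

namespace GenericArray

variable {N : ℕ} (W : GenericArray K Λ N)

/-- The pair `(θ, α)` is compatible with the array `W`, up to permutations of the rows. -/
structure IsSymmetry (θ : K ≃+* K) (α : Λ ≃ Λ) (s : ℕ → Equiv.Perm ℕ) : Prop where
  le_iff : ∀ k i, s k i ≤ k ↔ i ≤ k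
  entry : ∀ {k i}, k < N → i ≤ k → ∀ z, θ (W.entry z k i) = W.entry (α z) k (s k i)
  unit : ∀ {k i}, k + 1 < N → i ≤ k → ∀ z, α (z + W.unit k i) = α z + W.unit k (s k i)

variable {W} {s : ℕ → Equiv.Perm ℕ}

theorem IsSymmetry.unit_neg (h : W.IsSymmetry θ α s) {k i : ℕ} (hk : k + 1 < N) (hi : i ≤ k)
    (z : Λ) : α (z + -W.unit k i) = α z + -W.unit k (s k i) := by
  have := h.unit hk hi (z + -W.unit k i)
  rw [neg_add_cancel_right] at this
  rw [this, add_neg_cancel_right]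

theorem IsSymmetry.prod_range (h : W.IsSymmetry θ α s) {M : Type*} [CommMonoid M] (k : ℕ)
    (g : ℕ → M) : ∏ j ∈ range (k + 1), g (s k j) = ∏ j ∈ range (k + 1), g j :=
  prod_equiv (s k) (fun j => by simp [h.le_iff]) fun _ _ => rfl

theorem IsSymmetry.sum_range (h : W.IsSymmetry θ α s) {M : Type*} [AddCommMonoid M] (k : ℕ)
    (g : ℕ → M) : ∑ j ∈ range (k + 1), g (s k j) = ∑ j ∈ range (k + 1), g j :=
  sum_equiv (s k) (fun j => by simp [h.le_iff]) fun _ _ => rfl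

theorem IsSymmetry.prod_erase (h : W.IsSymmetry θ α s) {M : Type*} [CommMonoid M] (k i : ℕ)
    (g : ℕ → M) : ∏ j ∈ (range (k + 1)).erase i, g (s k j) =
      ∏ j ∈ (range (k + 1)).erase (s k i), g j :=
  prod_equiv (s k) (fun j => by simp [h.le_iff]) fun _ _ => rfl

theorem IsSymmetry.denominator (h : W.IsSymmetry θ α s) {k i : ℕ} (hk : k < N) (hi : i ≤ k)
    (z : Λ) : ∏ j ∈ (range (k + 1)).erase i, θ (W.entry z k i - W.entry z k j) =
      ∏ j ∈ (range (k + 1)).erase (s k i),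
        (W.entry (α z) k (s k i) - W.entry (α z) k j) := by
  rw [← h.prod_erase]
  refine prod_congr rfl fun j hj => ?_
  rw [mem_erase, mem_range] at hj
  rw [map_sub, h.entry hk hi, h.entry hk (by omega)]

theorem IsSymmetry.raise (h : W.IsSymmetry θ α s) {k i : ℕ} (hk : k + 1 < N) (hi : i ≤ k) (z : Λ) :
    θ (W.raise k i z) = W.raise k (s k i) (α z) := by
  rw [GenericArray.raise, GenericArray.raise, map_neg, map_div₀, map_prod, map_prod,
    h.denominator (by omega) hi,
    ← h.prod_range (k + 1) fun j => W.entry (α z) k (s k i) - W.entry (α z) (k + 1) j]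
  congr 2
  refine prod_congr rfl fun j hj => ?_
  rw [mem_range] at hj
  rw [map_sub, h.entry (by omega) hi, h.entry hk (by omega)]

theorem IsSymmetry.lower (h : W.IsSymmetry θ α s) {k i : ℕ} (hk : k + 1 < N) (hi : i ≤ k) (z : Λ) :
    θ (W.lower k i z) = W.lower k (s k i) (α z) := by
  rw [GenericArray.lower, GenericArray.lower, map_div₀, map_prod, map_prod,
    h.denominator (by omega) hi]
  congr 1
  cases k with
  | zero => simp
  | succ k =>
    rw [← h.prod_range k fun j =>
      W.entry (α z) (k + 1) (s (k + 1) i) - W.entry (α z) (k + 1 - 1) j]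
    refine prod_congr rfl fun j hj => ?_
    rw [mem_range] at hj
    rw [map_sub, h.entry (by omega) hi, h.entry (by omega) (by omega)]
    rfl

theorem IsSymmetry.weight (h : W.IsSymmetry θ α s) {k : ℕ} (hk : k < N) (z : Λ) :
    θ (W.weight k z) = W.weight k (α z) := by
  rw [GenericArray.weight, GenericArray.weight, map_sub, map_add, map_natCast, map_sum, map_sum,
    ← h.sum_range k fun j => W.entry (α z) k j]
  congr 1
  · congr 1
    refine sum_congr rfl fun j hj => ?_
    rw [mem_range] at hj
    rw [h.entry hk (by omega)]
  · cases k with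
    | zero => simp
    | succ k =>
      rw [← h.sum_range k fun j => W.entry (α z) (k + 1 - 1) j]
      refine sum_congr rfl fun j hj => ?_
      rw [mem_range] at hj
      exact h.entry (by omega) (by omega) z

theorem IsSymmetry.opE (h : W.IsSymmetry θ α s) {k : ℕ} (hk : k + 1 < N) (F : Λ →₀ K) :
    twist θ α (W.opE k F) = W.opE k (twist θ α F) := by
  refine twist_comm_of_basis (fun z => ?_) F
  simp only [GenericArray.opE, LinearMap.sum_apply, shiftOp_single, map_sum, twist_single]
  rw [← h.sum_range k fun j => Finsupp.single (α z + W.unit k j) (W.raise k j (α z))]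
  refine sum_congr rfl fun j hj => ?_
  rw [mem_range] at hj
  rw [h.unit hk (by omega), h.raise hk (by omega)]

theorem IsSymmetry.opF (h : W.IsSymmetry θ α s) {k : ℕ} (hk : k + 1 < N) (F : Λ →₀ K) :
    twist θ α (W.opF k F) = W.opF k (twist θ α F) := by
  refine twist_comm_of_basis (fun z => ?_) F
  simp only [GenericArray.opF, LinearMap.sum_apply, shiftOp_single, map_sum, twist_single]
  rw [← h.sum_range k fun j => Finsupp.single (α z + -W.unit k j) (W.lower k j (α z))]
  refine sum_congr rfl fun j hj => ?_
  rw [mem_range] at hj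
  rw [h.unit_neg hk (by omega), h.lower hk (by omega)]

theorem IsSymmetry.opH (h : W.IsSymmetry θ α s) {k : ℕ} (hk : k < N) (F : Λ →₀ K) :
    twist θ α (W.opH k F) = W.opH k (twist θ α F) := by
  refine twist_comm_of_basis (fun z => ?_) F
  simp only [GenericArray.opH, shiftOp_single, twist_single, add_zero]
  rw [h.weight hk]

theorem IsSymmetry.commutes_unitsOf (h : W.IsSymmetry θ α s) {a b : ℕ} (ha : a < N) (hb : b < N) :
    ∀ F, twist θ α (unitsOf W.opE W.opF W.opH a b F) =
      unitsOf W.opE W.opF W.opH a b (twist θ α F) :=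
  unitsOf_induction (A := Module.End K (Λ →₀ K)) (e := W.opE) (f := W.opF) (h := W.opH) (N := N)
    (fun X => ∀ F, twist θ α (X F) = X (twist θ α F))
    (fun _ hk F => h.opH hk F) (fun _ hk F => h.opE hk F) (fun _ hk F => h.opF hk F)
    (fun X Y hX hY F => by rw [comm_apply, comm_apply, map_sub, hX, hY, hY, hX]) ha hb

end GenericArray

end Twist

/-! ### Operators with restricted coefficients and support -/

section Band

variable {K Λ : Type*} [Field K] [AddCommGroup Λ] (R : Subring K) (Λ₀ : AddSubgroup Λ)

theorem end_apply_eq_sum (X : Module.End K (Λ →₀ K)) (F : Λ →₀ K) (z : Λ) :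
    X F z = ∑ y ∈ F.support, F y * X (Finsupp.single y 1) z := by
  conv_lhs => rw [← Finsupp.sum_single F, Finsupp.sum, map_sum, Finsupp.finsetSum_apply]
  refine sum_congr rfl fun y _ => ?_
  have h1 : Finsupp.single y (F y) = F y • Finsupp.single y (1 : K) := by simp
  rw [h1, map_smul, Finsupp.smul_apply, smul_eq_mul]

/-- The operators that map `T(z)` to combinations of the `T(z + d)`, `d ∈ Λ₀`, with coefficients
in `R`. -/
def bandOps : Subring (Module.End K (Λ →₀ K)) where
  carrier := {X | ∀ z y, X (Finsupp.single z 1) y ∈ R ∧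
    (X (Finsupp.single z 1) y ≠ 0 → y - z ∈ Λ₀)}
  zero_mem' := fun z y => by simp
  one_mem' := fun z y => by
    classical
    rw [Module.End.one_apply, Finsupp.single_apply]
    split_ifs with h
    · exact ⟨one_mem R, fun _ => by rw [h, sub_self]; exact zero_mem _⟩
    · exact ⟨zero_mem R, fun h => absurd rfl h⟩
  neg_mem' := fun {X} hX z y => by
    rw [LinearMap.neg_apply, Finsupp.neg_apply]
    exact ⟨neg_mem (hX z y).1, fun h => (hX z y).2 (neg_ne_zero.mp h)⟩
  add_mem' := fun {X Y} hX hY z y => by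
    rw [LinearMap.add_apply, Finsupp.add_apply]
    refine ⟨add_mem (hX z y).1 (hY z y).1, fun h => ?_⟩
    by_cases h0 : X (Finsupp.single z 1) y = 0
    · exact (hY z y).2 fun h1 => h (by rw [h0, h1, add_zero])
    · exact (hX z y).2 h0
  mul_mem' := fun {X Y} hX hY z y => by
    rw [Module.End.mul_apply, end_apply_eq_sum]
    refine ⟨sum_mem fun u _ => mul_mem (hY z u).1 (hX u y).1, fun h => ?_⟩
    obtain ⟨u, -, hu⟩ := exists_ne_zero_of_sum_ne_zero h
    have := add_mem ((hX u y).2 (right_ne_zero_of_mul hu)) ((hY z u).2 (left_ne_zero_of_mul hu))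
    rwa [sub_add_sub_cancel] at this

variable {R Λ₀}

theorem shiftOp_mem_bandOps {c : Λ → K} {d : Λ} (hc : ∀ z, c z ∈ R) (hd : d ∈ Λ₀) :
    shiftOp c d ∈ bandOps R Λ₀ := fun z y => by
  classical
  rw [shiftOp_single, Finsupp.single_apply]
  split_ifs with h
  · exact ⟨hc z, fun _ => by rwa [← h, add_sub_cancel_left]⟩
  · exact ⟨zero_mem R, fun h => absurd rfl h⟩

theorem comm_mem_bandOps {X Y : Module.End K (Λ →₀ K)} (hX : X ∈ bandOps R Λ₀)
    (hY : Y ∈ bandOps R Λ₀) : comm X Y ∈ bandOps R Λ₀ :=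
  sub_mem (mul_mem hX hY) (mul_mem hY hX)

end Band

end GT

namespace GT

variable {n t : ℕ}

/-- The action of the enveloping algebra on the generic module. -/
def act (n : ℕ) : U n →ₐ[ℂ] Module.End (RatFun n) (GenSpace n) :=
  UniversalEnvelopingAlgebra.lift ℂ (genRep n)

theorem act_ι (g : gl n) : act n (UniversalEnvelopingAlgebra.ι ℂ g) = genRep n g :=
  UniversalEnvelopingAlgebra.lift_ι_apply ℂ _ g

theorem act_ι_E (i j : Fin n) : act n (UniversalEnvelopingAlgebra.ι ℂ (E i j)) = genUnit n i j := by
  rw [act_ι, genRep_E]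

theorem act_algebraMap_apply (c : ℂ) (F : GenSpace n) :
    act n (algebraMap ℂ (U n) c) F = algebraMap ℂ (RatFun n) c • F := by
  rw [AlgHom.commutes, Module.algebraMap_end_apply, algebraMap_smul]

theorem usub_induction {m : ℕ} {P : U n → Prop}
    (gen : ∀ i j : Fin n, i.val < m → j.val < m → P (UniversalEnvelopingAlgebra.ι ℂ (E i j)))
    (scalar : ∀ c : ℂ, P (algebraMap ℂ (U n) c)) (add : ∀ x y, P x → P y → P (x + y))
    (mul : ∀ x y, P x → P y → P (x * y)) {u : U n} (hu : u ∈ Usub n m) : P u := by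
  induction hu using Algebra.adjoin_induction with
  | mem x hx =>
    obtain ⟨i, j, hi, hj, rfl⟩ := hx
    exact gen i j hi hj
  | algebraMap c => exact scalar c
  | add x y _ _ hx hy => exact add x y hx hy
  | mul x y _ _ hx hy => exact mul x y hx hy

theorem Usub_mono {m m' : ℕ} (h : m ≤ m') : Usub n m ≤ Usub n m' :=
  Algebra.adjoin_mono fun _ ⟨i, j, hi, hj, hu⟩ => ⟨i, j, by omega, by omega, hu⟩

theorem GTSub_le : GTSub n ≤ Usub n n := by
  refine Algebra.adjoin_le ?_
  intro u hu
  simp only [Set.mem_iUnion] at hu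
  obtain ⟨m, hm, hu⟩ := hu
  exact Usub_mono (mem_Icc.mp hm).2 hu.1

/-! ### Symmetries of the generic module -/

/-- All coefficients of the generic action depend on `x + z` alone, so translating `x` amounts to
moving `z`. -/
theorem isSymmetry_translate (a : Shift n) :
    (genArray n).IsSymmetry (fracMap (translate a)) (Equiv.addRight a) fun _ => 1 where
  le_iff _ _ := Iff.rfl
  entry hk hi z := by
    rw [genArray_entry, genArray_entry, Equiv.Perm.one_apply, ent_eq _ hk hi, ent_eq _ hk hi,
      fracMap_translate_xTab]
    rfl
  unit _ _ z := add_right_comm z _ a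

/-- The action of a row permutation on integral shifts as a bijection. -/
def permShiftEquiv (σ : RowPerm n) : Shift n ≃ Shift n where
  toFun := permShift σ
  invFun := permShift σ⁻¹
  left_inv z := Subtype.ext (funext fun p =>
    congrArg (fun i => z.1 ⟨p.1, i⟩) ((σ p.1).symm_apply_apply p.2))
  right_inv z := Subtype.ext (funext fun p =>
    congrArg (fun i => z.1 ⟨p.1, i⟩) ((σ p.1).apply_symm_apply p.2))

theorem permShift_add (σ : RowPerm n) (z z' : Shift n) :
    permShift σ (z + z') = permShift σ z + permShift σ z' := rfl

namespace SingularPairs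

variable (S : SingularPairs n t)

theorem swap_left_right (r : Fin t) {k i : ℕ} (hk : k < n) (hi : i < k + 1) :
    ∃ h, Equiv.swap (S.left r) (S.right r) ⟨⟨k, hk⟩, ⟨i, hi⟩⟩ =
      ⟨⟨k, hk⟩, ⟨(if k = S.row r then Equiv.swap (S.fst r).val (S.snd r).val else 1) i, h⟩⟩ := by
  by_cases h : k = S.row r
  · have h' : S.row r = ⟨k, hk⟩ := Fin.ext h.symm
    rw [if_pos h]
    have key : ∀ (k' : Fin n) (f s i : Fin (k'.val + 1)), ∃ h,
        Equiv.swap (⟨k', f⟩ : Idx n) ⟨k', s⟩ ⟨k', i⟩ = ⟨k', ⟨Equiv.swap f.val s.val i.val, h⟩⟩ := by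
      intro k' f s i
      have h1 : Equiv.swap f.val s.val i.val = (Equiv.swap f s i).val :=
        Fin.val_injective.swap_apply f s i
      refine ⟨h1 ▸ (Equiv.swap f s i).2, ?_⟩
      have h2 := (sigma_mk_injective (i := k')
        (β := fun k : Fin n => Fin (k.val + 1))).swap_apply f s i
      rw [h2]
      congr 1
      exact Fin.ext h1.symm
    subst h
    exact key (S.row r) (S.fst r) (S.snd r) ⟨i, hi⟩
  · rw [if_neg h]
    refine ⟨hi, Equiv.swap_apply_of_ne_of_ne ?_ ?_⟩
    · intro e
      exact h (congrArg (fun p : Idx n => p.1.val) e)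
    · intro e
      exact h (congrArg (fun p : Idx n => p.1.val) e)

theorem permTab_tau {A : Type} (r : Fin t) (w : Tab n A) (p : Idx n) :
    permTab (S.tau r) w p = w (Equiv.swap (S.left r) (S.right r) p) := by
  obtain ⟨k, i⟩ := p
  rw [permTab]
  by_cases h : k = S.row r
  · subst h
    simp only [tau, Function.update_self, Equiv.symm_swap]
    congr 1
    exact ((sigma_mk_injective (i := S.row r)
      (β := fun k : Fin n => Fin (k.val + 1))).swap_apply _ _ _).symm
  · simp only [tau, Function.update_of_ne h]
    rw [Equiv.swap_apply_of_ne_of_ne]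
    · rfl
    · intro e
      exact h (congrArg (fun p : Idx n => p.1) e)
    · intro e
      exact h (congrArg (fun p : Idx n => p.1) e)

theorem permShift_tau_apply (r : Fin t) (z : Shift n) (p : Idx n) :
    (permShift (S.tau r) z).1 p = z.1 (Equiv.swap (S.left r) (S.right r) p) :=
  S.permTab_tau r z.1 p

theorem flip_xTab (r : Fin t) (z : Shift n) (p : Idx n) :
    S.flip r (xTab z p) = xTab (permShift (S.tau r) z) (Equiv.swap (S.left r) (S.right r) p) := by
  rw [xTab, xTab, permShift_tau_apply, Equiv.swap_apply_self, map_add, map_intCast, flip,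
    fracMap_algebraMap, interchange_apply, MvPolynomial.rename_X]

/-- Exchanging the pair in `x` and in `z` together permutes two entries of one row of `x + z`, and
the generators are sums over all entries of a row. -/
theorem isSymmetry_flip (r : Fin t) :
    (genArray n).IsSymmetry (S.flip r) (permShiftEquiv (S.tau r)) fun k =>
      if k = S.row r then Equiv.swap (S.fst r).val (S.snd r).val else 1 where
  le_iff k i := by
    have h1 := (S.fst r).2
    have h2 := (S.snd r).2
    split_ifs with h
    · rw [Equiv.swap_apply_def]
      split_ifs <;> omega
    · rfl
  entry {k i} hk hi z := by
    obtain ⟨h, e⟩ := S.swap_left_right r hk (Nat.lt_succ_iff.mpr hi)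
    rw [genArray_entry, genArray_entry, ent_eq _ hk hi, ent_eq _ hk (Nat.lt_succ_iff.mp h),
      flip_xTab, e]
    rfl
  unit {k i} hk hi z := by
    change permShift _ _ = permShift _ _ + _
    rw [permShift_add]
    congr 1
    ext p
    obtain ⟨⟨l, hl⟩, ⟨j, hj⟩⟩ := p
    obtain ⟨h, e⟩ := S.swap_left_right r hl hj
    rw [permShift_tau_apply, e]
    simp only [genArray_unit, unitShift]
    congr 1
    rw [eq_iff_iff]
    by_cases hlk : l = k
    · subst hlk
      split_ifs
      · simp only [true_and, Equiv.swap_apply_eq_iff]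
      · rfl
    · simp [hlk]

end SingularPairs

theorem twist_genRep {θ : Poly n ≃ₐ[ℂ] Poly n} {α : Shift n ≃ Shift n} {s : ℕ → Equiv.Perm ℕ}
    (h : (genArray n).IsSymmetry (fracMap θ) α s) (g : gl n) (F : GenSpace n) :
    twist (fracMap θ) α (genRep n g F) = genRep n g (twist (fracMap θ) α F) := by
  change twist (fracMap θ) α ((∑ r, ∑ s, g r s • genUnit n r s) F) =
    (∑ r, ∑ s, g r s • genUnit n r s) (twist (fracMap θ) α F)
  simp only [LinearMap.sum_apply, map_sum, LinearMap.smul_apply]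
  refine sum_congr rfl fun a _ => sum_congr rfl fun b _ => ?_
  rw [← algebraMap_smul (RatFun n) (g a b), ← algebraMap_smul (RatFun n) (g a b), twist_smul,
    fracMap_complex]
  congr 1
  exact h.commutes_unitsOf a.2 b.2 F

theorem twist_act {θ : Poly n ≃ₐ[ℂ] Poly n} {α : Shift n ≃ Shift n} {s : ℕ → Equiv.Perm ℕ}
    (h : (genArray n).IsSymmetry (fracMap θ) α s) {m : ℕ} {u : U n} (hu : u ∈ Usub n m)
    (F : GenSpace n) :
    twist (fracMap θ) α (act n u F) = act n u (twist (fracMap θ) α F) := by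
  revert F
  refine usub_induction (P := fun u => ∀ F, twist (fracMap θ) α (act n u F) =
    act n u (twist (fracMap θ) α F)) (fun i j _ _ F => ?_) (fun c F => ?_) (fun x y hx hy F => ?_)
    (fun x y hx hy F => ?_) hu
  · rw [act_ι, twist_genRep h]
  · rw [act_algebraMap_apply, act_algebraMap_apply, twist_smul, fracMap_complex]
  · rw [map_add, LinearMap.add_apply, map_add, hx, hy, LinearMap.add_apply]
  · rw [map_mul, Module.End.mul_apply, hx, hy, Module.End.mul_apply]

/-! ### Coefficients and supports -/

/-- The integral shifts of the rows below the row `m`, counted from one. -/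
def lowRows (n m : ℕ) : AddSubgroup (Shift n) where
  carrier := {a | ∀ x : Idx n, m ≤ x.1.val + 1 → a.1 x = 0}
  zero_mem' := fun _ _ => rfl
  add_mem' := by
    intro a b ha hb x hx
    change a.1 x + b.1 x = 0
    rw [ha x hx, hb x hx, add_zero]
  neg_mem' := by
    intro a ha x hx
    change -a.1 x = 0
    rw [ha x hx, neg_zero]

theorem unitShift_mem_lowRows {m k i : ℕ} (h : k + 1 < m) : unitShift n k i ∈ lowRows n m := by
  intro x hx
  refine if_neg ?_
  rintro ⟨h1, -⟩
  omega

theorem ent_xTab_mem {R : Subring (RatFun n)}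
    (hR : ∀ p : Poly n, algebraMap (Poly n) (RatFun n) p ∈ R) (z : Shift n) (k i : ℕ) :
    ent (xTab z) k i ∈ R := by
  rw [ent]
  split_ifs
  · exact add_mem (hR _) (intCast_mem _ _)
  · exact zero_mem _

/-- The coefficients of the operators of `U_m` lie in every ring that contains the polynomials
and the inverses of the differences of the entries in the rows below the row `m`. -/
theorem act_mem_bandOps {R : Subring (RatFun n)} {m : ℕ} (hm : m ≤ n)
    (hR : ∀ p : Poly n, algebraMap (Poly n) (RatFun n) p ∈ R)
    (hinv : ∀ (k : Fin n), k.val + 1 < m → ∀ i j : Fin (k.val + 1), i ≠ j → ∀ z : Shift n,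
      (xTab z ⟨k, i⟩ - xTab z ⟨k, j⟩)⁻¹ ∈ R) {u : U n} (hu : u ∈ Usub n m) :
    act n u ∈ bandOps R (lowRows n m) := by
  have hden : ∀ k i, k + 1 < m → i ≤ k → ∀ z : Shift n, (∏ j ∈ (range (k + 1)).erase i,
      ((genArray n).entry z k i - (genArray n).entry z k j))⁻¹ ∈ R := by
    intro k i hk hi z
    rw [← prod_inv_distrib]
    refine prod_mem fun j hj => ?_
    rw [mem_erase, mem_range] at hj
    rw [genArray_entry, genArray_entry, ent_eq _ (by omega) hi,
      ent_eq _ (show k < n by omega) (show j ≤ k by omega)]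
    exact hinv ⟨k, by omega⟩ hk _ _ (fun h => hj.1 (congrArg Fin.val h).symm) z
  have hent : ∀ z k i, (genArray n).entry z k i ∈ R := fun z k i => ent_xTab_mem hR z _ _
  refine usub_induction (P := fun u => act n u ∈ bandOps R (lowRows n m)) (fun i j hi hj => ?_) (fun c => ?_) (fun x y hx hy => ?_)
    (fun x y hx hy => ?_) hu
  · rw [act_ι_E, genUnit]
    refine unitsOf_induction (A := Module.End (RatFun n) (GenSpace n)) (e := (genArray n).opE)
      (f := (genArray n).opF) (h := (genArray n).opH) (N := m)
      (fun X => X ∈ bandOps R (lowRows n m)) (fun k hk => ?_) (fun k hk => ?_) (fun k hk => ?_)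
      (fun X Y hX hY => comm_mem_bandOps hX hY) hi hj
    · refine shiftOp_mem_bandOps (fun z => ?_) (zero_mem _)
      exact sub_mem (add_mem (natCast_mem _ _) (sum_mem fun j _ => hent _ _ _))
        (sum_mem fun j _ => hent _ _ _)
    · refine sum_mem fun i hi => shiftOp_mem_bandOps (fun z => ?_) (unitShift_mem_lowRows hk)
      rw [mem_range] at hi
      rw [GenericArray.raise, div_eq_mul_inv]
      exact neg_mem (mul_mem (prod_mem fun j _ => sub_mem (hent _ _ _) (hent _ _ _))
        (hden k i hk (by omega) z))
    · refine sum_mem fun i hi => shiftOp_mem_bandOps (fun z => ?_)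
        (neg_mem (unitShift_mem_lowRows hk))
      rw [mem_range] at hi
      rw [GenericArray.lower, div_eq_mul_inv]
      exact mul_mem (prod_mem fun j _ => sub_mem (hent _ _ _) (hent _ _ _))
        (hden k i hk (by omega) z)
  · intro z y
    classical
    rw [act_algebraMap_apply, Finsupp.smul_apply, Finsupp.single_apply]
    split_ifs with h
    · refine ⟨?_, fun _ => by rw [h, sub_self]; exact zero_mem _⟩
      rw [algebraMap_complex, smul_eq_mul, mul_one]
      exact hR _
    · rw [smul_zero]
      exact ⟨zero_mem R, fun h => absurd rfl h⟩
  · rw [map_add]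
    exact add_mem hx hy
  · rw [map_mul]
    exact mul_mem hx hy

end GT

namespace GT

/-! ### Traces of powers of the matrix of generators -/

section TracePower

variable {A ι : Type*} [Ring A] [Fintype ι] [DecidableEq ι]

theorem comm_mul (x y z : A) : comm x (y * z) = comm x y * z + y * comm x z := by
  simp only [comm]
  noncomm_ring

/-- Powers of the matrix transform under its entries in the same way as the matrix itself. In the
Leibniz rule the contributions of the two inner indices cancel. -/
theorem comm_matrix_pow {e : Matrix ι ι A} (he : ∀ a b c d, comm (e a b) (e c d) =
      (if b = c then e a d else 0) - if d = a then e c b else 0) (k : ℕ) (a b c d : ι) :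
    comm (e a b) ((e ^ k) c d) =
      (if b = c then (e ^ k) a d else 0) - if d = a then (e ^ k) c b else 0 := by
  induction k generalizing c d with
  | zero =>
    rw [pow_zero, Matrix.one_apply, Matrix.one_apply, Matrix.one_apply, comm]
    have h1 : e a b * (if c = d then 1 else 0) - (if c = d then 1 else 0) * e a b = 0 := by
      split_ifs <;> simp
    rw [h1, eq_comm, sub_eq_zero]
    by_cases h2 : b = c
    · by_cases h3 : d = a
      · simp [h2, h3]
      · simp [h2, h3, Ne.symm h3]
    · simp [h2, Ne.symm h2]
  | succ k ih =>
    simp only [pow_succ, Matrix.mul_apply, comm_sum, comm_mul, ih, he]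
    simp only [sub_mul, mul_sub, ite_mul, mul_ite, zero_mul, mul_zero, sum_add_distrib,
      sum_sub_distrib, sum_ite_eq, sum_ite_eq', mem_univ, if_true]
    by_cases h1 : b = c <;> by_cases h2 : d = a <;> simp [h1, h2]
    abel

theorem comm_trace_pow {e : Matrix ι ι A} (he : ∀ a b c d, comm (e a b) (e c d) =
      (if b = c then e a d else 0) - if d = a then e c b else 0) (k : ℕ) (a b : ι) :
    comm (e a b) (Matrix.trace (e ^ k)) = 0 := by
  simp only [Matrix.trace, Matrix.diag, comm_sum, comm_matrix_pow he, sum_sub_distrib, sum_ite_eq,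
    sum_ite_eq', mem_univ, if_true, sub_self]

end TracePower

/-! ### Eigenvalues on highest weight vectors -/

section HighestWeight

variable {K V ι : Type*} [Field K] [AddCommGroup V] [Module K V] [Fintype ι] [LinearOrder ι]

/-- The action of the entries of the powers of the matrix of generators on a highest weight vector,
modulo a subgroup `N` that is stable under the generators and under a ring `R` of scalars. -/
theorem matrix_pow_highestWeight {e : Matrix ι ι (Module.End K V)}
    (he : ∀ a b c d, comm (e a b) (e c d) =
      (if b = c then e a d else 0) - if d = a then e c b else 0)
    {R : Subring K} {N : AddSubgroup V} (hRN : ∀ f ∈ R, ∀ w ∈ N, f • w ∈ N)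
    (heN : ∀ a b, ∀ w ∈ N, e a b w ∈ N) {w : V} {l : ι → K} (hl : ∀ a, l a ∈ R)
    (hw : ∀ a b, a < b → e a b w ∈ N) (hd : ∀ a, e a a w - l a • w ∈ N)
    {y : ℕ → ι → K} (hy0 : ∀ a, y 0 a = 1)
    (hy : ∀ k a, y (k + 1) a = l a * y k a + ∑ c, if a < c then y k a - y k c else 0) (k : ℕ) :
    (∀ a, y k a ∈ R) ∧ (∀ a b, ∀ u ∈ N, (e ^ k) a b u ∈ N) ∧
      (∀ a b, a < b → (e ^ k) a b w ∈ N) ∧ ∀ a, (e ^ k) a a w - y k a • w ∈ N := by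
  induction k with
  | zero =>
    refine ⟨fun a => by rw [hy0]; exact one_mem R, fun a b u hu => ?_, fun a b hab => ?_,
      fun a => ?_⟩
    · rw [pow_zero, Matrix.one_apply]
      split_ifs
      · exact hu
      · exact zero_mem _
    · rw [pow_zero, Matrix.one_apply_ne hab.ne]
      exact zero_mem _
    · rw [pow_zero, Matrix.one_apply_eq, hy0, one_smul, Module.End.one_apply, sub_self]
      exact zero_mem _
  | succ k ih =>
    obtain ⟨ihR, ihN, ihu, ihd⟩ := ih
    have hexp : ∀ a b u, (e ^ (k + 1)) a b u = ∑ c, e a c ((e ^ k) c b u) := by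
      intro a b u
      rw [pow_succ', Matrix.mul_apply, LinearMap.sum_apply]
      rfl
    -- Moving `e a c` to the right of the power lets it act on `w` first, where it vanishes modulo
    -- `N` for `a < c`. The terms left behind by this exchange are the differences `y k a - y k c`
    -- of the recursion.
    have hswap : ∀ a c b u, e a c ((e ^ k) c b u) = (e ^ k) a b u -
        (if b = a then (e ^ k) c c u else 0) + (e ^ k) c b (e a c u) := by
      intro a c b u
      have h := DFunLike.congr_fun (comm_matrix_pow he k a c c b) u
      rw [comm_apply, if_pos rfl] at h
      rw [eq_add_of_sub_eq h, LinearMap.sub_apply]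
      split_ifs <;> rfl
    refine ⟨fun a => ?_, fun a b u hu => ?_, fun a b hab => ?_, fun a => ?_⟩
    · rw [hy]
      refine add_mem (mul_mem (hl a) (ihR a)) (sum_mem fun c _ => ?_)
      split_ifs
      · exact sub_mem (ihR a) (ihR c)
      · exact zero_mem _
    · rw [hexp]
      exact sum_mem fun c _ => heN _ _ _ (ihN _ _ _ hu)
    · rw [hexp]
      refine sum_mem fun c _ => ?_
      rcases lt_or_ge c b with hcb | hcb
      · exact heN _ _ _ (ihu c b hcb)
      · rw [hswap, if_neg hab.ne', sub_zero]
        exact add_mem (ihu a b hab) (ihN _ _ _ (hw a c (hab.trans_le hcb)))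
    · have hsum : (e ^ (k + 1)) a a w - y (k + 1) a • w = ∑ c, (e a c ((e ^ k) c a w) -
          ((if c = a then l a * y k a else 0) + if a < c then y k a - y k c else 0) • w) := by
        rw [hexp, sum_sub_distrib, ← sum_smul, sum_add_distrib, sum_ite_eq', if_pos (mem_univ a),
          hy]
      rw [hsum]
      refine sum_mem fun c _ => ?_
      rcases lt_trichotomy c a with h | rfl | h
      · rw [if_neg h.ne, if_neg h.not_gt, add_zero, zero_smul, sub_zero]
        exact heN _ _ _ (ihu c a h)
      · rw [if_pos rfl, if_neg (lt_irrefl c), add_zero]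
        have h1 := add_mem (heN c c _ (ihd c)) (hRN _ (ihR c) _ (hd c))
        rw [map_sub, map_smul, smul_sub, smul_smul, sub_add_sub_cancel, mul_comm] at h1
        exact h1
      · rw [if_neg h.ne', if_pos h, zero_add, hswap, if_pos rfl]
        have h1 := add_mem (sub_mem (ihd a) (ihd c)) (ihN c a _ (hw a c h))
        convert h1 using 1
        rw [sub_smul]
        abel

theorem trace_pow_highestWeight {e : Matrix ι ι (Module.End K V)}
    (he : ∀ a b c d, comm (e a b) (e c d) =
      (if b = c then e a d else 0) - if d = a then e c b else 0)
    {R : Subring K} {N : AddSubgroup V} (hRN : ∀ f ∈ R, ∀ w ∈ N, f • w ∈ N)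
    (heN : ∀ a b, ∀ w ∈ N, e a b w ∈ N) {w : V} {l : ι → K} (hl : ∀ a, l a ∈ R)
    (hw : ∀ a b, a < b → e a b w ∈ N) (hd : ∀ a, e a a w - l a • w ∈ N)
    {y : ℕ → ι → K} (hy0 : ∀ a, y 0 a = 1)
    (hy : ∀ k a, y (k + 1) a = l a * y k a + ∑ c, if a < c then y k a - y k c else 0) (k : ℕ) :
    Matrix.trace (e ^ k) w - (∑ a, y k a) • w ∈ N := by
  rw [Matrix.trace, LinearMap.sum_apply, sum_smul, ← sum_sub_distrib]
  exact sum_mem fun a _ => (matrix_pow_highestWeight he hRN heN hl hw hd hy0 hy k).2.2.2 a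

end HighestWeight

/-! ### Summation of the eigenvalues -/

section PowerSum

variable {K : Type*} [Field K]

/-- The eigenvalues of the diagonal entries of the powers of the matrix of generators, where `L a`
is the shifted highest weight. -/
def hwEigen (m : ℕ) (L : ℕ → K) : ℕ → ℕ → K
  | 0, _ => 1
  | k + 1, a => L a * hwEigen m L k a - ∑ c ∈ Ico (a + 1) m, hwEigen m L k c

/-- The divided difference with nodes `L i` and numerator roots `L i + 1`. The root and node sums
differ by the number of nodes, and the factor with `j = i` is `-1`. -/
theorem sum_prod_one_sub_inv {L : ℕ → K} (s : Finset ℕ)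
    (hL : ∀ i ∈ s, ∀ j ∈ s, i ≠ j → L i ≠ L j) :
    ∑ i ∈ s, ∏ j ∈ s.erase i, (1 - 1 / (L i - L j)) = (s.card : K) := by
  rcases s.eq_empty_or_nonempty with rfl | hs
  · simp
  have key := sum_prod_sub_div_prod_sub s L
    (fun i hi j hj h => not_imp_comm.mp (hL i hi j hj) (not_not.mpr h)) s (fun j => L j + 1) rfl hs
  rw [sum_add_distrib, sum_const, nsmul_one, sub_add_cancel_left] at key
  rw [← neg_inj, ← key, ← sum_neg_distrib]
  refine sum_congr rfl fun i hi => ?_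
  rw [← mul_prod_erase s _ hi, sub_add_cancel_left, neg_one_mul, neg_div, ← prod_div_distrib]
  congr 1
  refine prod_congr rfl fun j hj => ?_
  rw [mem_erase] at hj
  have := sub_ne_zero.mpr (hL i hi j hj.2 hj.1.symm)
  rw [eq_div_iff this, sub_mul, div_mul_cancel₀ _ this]
  ring

/-- Induction on `k` and, inside, downwards on `a`. Tail sums for `k` determine the individual
eigenvalue as the difference of two consecutive ones, and adjoining the node `a` multiplies each
later weight by `1 - 1 / (L i - L a)`. After these substitutions the recursion becomes an identity
for each node separately. -/
theorem sum_hwEigen {m : ℕ} {L : ℕ → K} (hL : ∀ i < m, ∀ j < m, i ≠ j → L i ≠ L j) (k : ℕ) :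
    ∀ a ≤ m, ∑ c ∈ Ico a m, hwEigen m L k c =
      ∑ i ∈ Ico a m, L i ^ k * ∏ j ∈ (Ico a m).erase i, (1 - 1 / (L i - L j)) := by
  induction k with
  | zero =>
    intro a _
    simp only [hwEigen, pow_zero, one_mul, sum_const, nsmul_one]
    rw [sum_prod_one_sub_inv]
    intro i hi j hj
    exact hL i (mem_Ico.mp hi).2 j (mem_Ico.mp hj).2
  | succ k ih =>
    intro a ha
    induction ha using Nat.decreasingInduction with
    | self => simp
    | of_succ a ha iha =>
      have hins : Ico a m = insert a (Ico (a + 1) m) := (insert_Ico_add_one_left_eq_Ico ha).symm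
      have hnot : a ∉ Ico (a + 1) m := by simp
      have hG : ∀ k, ∑ i ∈ Ico a m, L i ^ k * ∏ j ∈ (Ico a m).erase i, (1 - 1 / (L i - L j)) =
          L a ^ k * ∏ j ∈ Ico (a + 1) m, (1 - 1 / (L a - L j)) +
          ∑ i ∈ Ico (a + 1) m, (1 - 1 / (L i - L a)) *
            (L i ^ k * ∏ j ∈ (Ico (a + 1) m).erase i, (1 - 1 / (L i - L j))) := by
        intro k
        rw [hins, sum_insert hnot, erase_insert hnot]
        congr 1
        refine sum_congr rfl fun i hi => ?_
        have hia : i ≠ a := fun h => hnot (h ▸ hi)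
        rw [erase_insert_of_ne hia.symm, prod_insert (fun h => hnot (mem_of_mem_erase h))]
        ring
      have h0 : hwEigen m L k a = (∑ i ∈ Ico a m, L i ^ k *
          ∏ j ∈ (Ico a m).erase i, (1 - 1 / (L i - L j))) -
          ∑ i ∈ Ico (a + 1) m, L i ^ k * ∏ j ∈ (Ico (a + 1) m).erase i, (1 - 1 / (L i - L j)) := by
        rw [← ih a ha.le, ← ih (a + 1) ha, hins, sum_insert hnot]
        ring
      rw [hG (k + 1)]
      conv_lhs => rw [hins]
      rw [sum_insert hnot, iha, hwEigen, ih (a + 1) ha, h0, hG k, add_sub_assoc, ← sum_sub_distrib,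
        mul_add, mul_sum, add_sub_assoc, ← sum_sub_distrib, add_assoc, ← sum_add_distrib]
      congr 1
      · ring
      · refine sum_congr rfl fun i hi => ?_
        have hne : L i - L a ≠ 0 := sub_ne_zero.mpr (hL i (mem_Ico.mp hi).2 a (by omega)
          (fun h => hnot (h ▸ hi)))
        field_simp
        ring

/-- Power sums with nonvanishing weights determine the nodes. -/
theorem exists_node_eq {ι : Type*} {s : Finset ι} {a b A B : ι → K}
    (ha : ∀ i ∈ s, ∀ j ∈ s, i ≠ j → a i ≠ a j) (hA : ∀ i ∈ s, A i ≠ 0)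
    (h : ∀ k : ℕ, ∑ i ∈ s, a i ^ k * A i = ∑ i ∈ s, b i ^ k * B i) {i : ι} (hi : i ∈ s) :
    ∃ j ∈ s, a i = b j := by
  classical
  by_contra! hne
  have hp : ∀ p : K[X], ∑ i ∈ s, p.eval (a i) * A i = ∑ i ∈ s, p.eval (b i) * B i := by
    intro p
    simp only [Polynomial.eval_eq_sum_range, sum_mul, mul_assoc]
    rw [sum_comm, sum_comm (s := s)]
    refine sum_congr rfl fun k _ => ?_
    rw [← mul_sum, ← mul_sum, h]
  -- The test polynomial vanishes at every node `b j` and at every node `a j` except `a i`, so only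
  -- one term can survive on the left and none on the right.
  have := hp ((∏ j ∈ s.erase i, (X - C (a j))) * ∏ j ∈ s, (X - C (b j)))
  simp only [eval_mul, eval_prod, eval_sub, eval_X, eval_C] at this
  rw [sum_eq_single i, sum_eq_zero] at this
  · refine absurd this (mul_ne_zero (mul_ne_zero (prod_ne_zero_iff.mpr fun j hj => ?_)
      (prod_ne_zero_iff.mpr fun j hj => sub_ne_zero.mpr (hne j hj))) (hA i hi))
    rw [mem_erase] at hj
    exact sub_ne_zero.mpr (ha i hi j hj.2 hj.1.symm)
  · intro j hj
    rw [prod_eq_zero (s := s) (i := j) hj (sub_self _), mul_zero, zero_mul]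
  · intro j hj hji
    rw [prod_eq_zero (s := s.erase i) (i := j) (mem_erase.mpr ⟨hji, hj⟩) (sub_self _), zero_mul,
      zero_mul]
  · exact fun h => absurd hi h

end PowerSum

end GT

namespace GT

variable {n : ℕ}

/-! ### The elements `c_{mk}` are central in `U_m` -/

theorem lie_E (a b c d : Fin n) : ⁅E a b, E c d⁆ =
    (if b = c then E a d else 0) - if d = a then E c b else (0 : gl n) := by
  have h : ∀ a b c d : Fin n, E a b * E c d = if b = c then E a d else (0 : gl n) := by
    intro a b c d
    split_ifs with h
    · rw [h, E, E, Matrix.single_mul_single_same, mul_one, E]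
    · rw [E, E, Matrix.single_mul_single_of_ne _ _ _ _ h]
  rw [Ring.lie_def, h, h]

theorem comm_ι_E (a b c d : Fin n) : comm (UniversalEnvelopingAlgebra.ι ℂ (E a b) : U n)
      (UniversalEnvelopingAlgebra.ι ℂ (E c d)) =
    (if b = c then UniversalEnvelopingAlgebra.ι ℂ (E a d) else 0) -
      if d = a then UniversalEnvelopingAlgebra.ι ℂ (E c b) else 0 := by
  have h : comm (UniversalEnvelopingAlgebra.ι ℂ (E a b) : U n)
      (UniversalEnvelopingAlgebra.ι ℂ (E c d)) =
      UniversalEnvelopingAlgebra.ι ℂ ⁅E a b, E c d⁆ :=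
    (LieHom.map_lie (UniversalEnvelopingAlgebra.ι ℂ) (E a b) (E c d)).symm
  rw [h, lie_E, map_sub]
  split_ifs <;> simp

/-- The matrix `(E_{ij})_{i,j ≤ m}`. -/
def genMatrix (n m : ℕ) : Matrix {i : Fin n // i.val < m} {i : Fin n // i.val < m} (U n) :=
  Matrix.of fun i j => UniversalEnvelopingAlgebra.ι ℂ (E i.1 j.1)

theorem cGen_eq (n m k : ℕ) : cGen n m k = Matrix.trace (genMatrix n m ^ k) := rfl

theorem comm_genMatrix (m : ℕ) (a b c d : {i : Fin n // i.val < m}) :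
    comm (genMatrix n m a b) (genMatrix n m c d) =
      (if b = c then genMatrix n m a d else 0) - if d = a then genMatrix n m c b else 0 := by
  have h := comm_ι_E a.1 b.1 c.1 d.1
  simp only [← Subtype.ext_iff] at h
  exact h

theorem genMatrix_pow_mem (m k : ℕ) (a b : {i : Fin n // i.val < m}) :
    (genMatrix n m ^ k) a b ∈ Usub n m := by
  induction k generalizing a b with
  | zero =>
    rw [pow_zero, Matrix.one_apply]
    split_ifs
    · exact one_mem _
    · exact zero_mem _
  | succ k ih =>
    rw [pow_succ, Matrix.mul_apply]
    exact sum_mem fun c _ => mul_mem (ih a c)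
      (Algebra.subset_adjoin ⟨c.1, b.1, c.2, b.2, rfl⟩)

theorem cGen_mem_Zsub (n m k : ℕ) : cGen n m k ∈ Zsub n m := by
  refine ⟨?_, ?_⟩
  · change ∑ a, (genMatrix n m ^ k) a a ∈ Usub n m
    exact sum_mem fun a _ => genMatrix_pow_mem m k a a
  intro u hu
  refine usub_induction (P := fun u => u * cGen n m k = cGen n m k * u) (fun i j hi hj => ?_)
    (fun c => Algebra.commutes c _) (fun x y hx hy => by rw [add_mul, mul_add, hx, hy])
    (fun x y hx hy => by rw [mul_assoc, hy, ← mul_assoc, hx, mul_assoc]) hu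
  exact sub_eq_zero.mp (comm_trace_pow (comm_genMatrix m) k ⟨i, hi⟩ ⟨j, hj⟩)

/-! ### The functions `γ_{mk}` -/

theorem ent_map {F F' : Type} [Field F] [Field F'] (θ : F →+* F') (w : Tab n F) (k i : ℕ) :
    ent (fun p => θ (w p)) k i = θ (ent w k i) := by
  rw [ent, ent]
  split_ifs
  · rfl
  · rw [map_zero]

theorem map_gamma {F F' : Type} [Field F] [Field F'] (θ : F →+* F') (m k : ℕ) (w : Tab n F) :
    θ (gamma m k w) = gamma m k fun p => θ (w p) := by
  simp only [gamma, ent_map, map_sum, map_mul, map_pow, map_prod, map_sub, map_add, map_natCast,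
    map_one, map_div₀]

theorem prod_Icc_erase {M : Type*} [CommMonoid M] (m i : ℕ) (g : ℕ → M) :
    ∏ j ∈ (Icc 1 m).erase (i + 1), g j = ∏ j ∈ (range m).erase i, g (j + 1) := by
  symm
  refine prod_bij (fun j _ => j + 1) (fun j hj => ?_) (fun a _ b _ h => by omega)
    (fun j hj => ?_) fun _ _ => rfl
  · simp only [mem_erase, mem_range, mem_Icc] at hj ⊢
    omega
  · simp only [mem_erase, mem_Icc] at hj
    exact ⟨j - 1, by simp only [mem_erase, mem_range]; omega, by omega⟩

theorem gamma_eq {F : Type} [Field F] (m k : ℕ) (w : Tab n F) :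
    gamma m k w = ∑ i ∈ range m, (ent w m (i + 1) + (m : F) - 1) ^ k *
      ∏ j ∈ (range m).erase i, (1 - 1 / (ent w m (i + 1) - ent w m (j + 1))) := by
  rw [gamma, sum_Icc_one]
  refine sum_congr rfl fun i _ => ?_
  rw [prod_Icc_erase]

theorem ent_xTab_sub_ne {m i j : ℕ} (hm : m < n) (hi : i ≤ m) (hj : j ≤ m) (hij : i ≠ j)
    (z : Shift n) (c : ℤ) : ent (xTab z) (m + 1) (i + 1) - ent (xTab z) (m + 1) (j + 1) ≠ c := by
  rw [ent_eq _ hm hi, ent_eq _ hm hj]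
  refine xTab_sub_ne z ?_ c
  simpa using hij

/-- The eigenvalues `γ_{m+1,k}(x + z)` separate the shifts of the row `m`. -/
theorem eq_of_gamma_eq {m : ℕ} (hm : m < n) {z z' : Shift n}
    (h : ∀ k, gamma (m + 1) k (xTab z) = gamma (m + 1) k (xTab z')) (i : Fin (m + 1)) :
    z.1 ⟨⟨m, hm⟩, i⟩ = z'.1 ⟨⟨m, hm⟩, i⟩ := by
  have hne : ∀ i ∈ range (m + 1), ∀ j ∈ range (m + 1), i ≠ j → ∀ c : ℤ,
      ent (xTab z) (m + 1) (i + 1) - ent (xTab z) (m + 1) (j + 1) ≠ c := fun i hi j hj hij c =>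
    ent_xTab_sub_ne hm (by simpa [Nat.lt_succ_iff] using hi) (by simpa [Nat.lt_succ_iff] using hj)
      hij z c
  obtain ⟨j, hj, e⟩ := exists_node_eq (s := range (m + 1))
    (a := fun i => ent (xTab z) (m + 1) (i + 1) + ((m + 1 : ℕ) : RatFun n) - 1)
    (b := fun i => ent (xTab z') (m + 1) (i + 1) + ((m + 1 : ℕ) : RatFun n) - 1)
    (A := fun i => ∏ j ∈ (range (m + 1)).erase i,
      (1 - 1 / (ent (xTab z) (m + 1) (i + 1) - ent (xTab z) (m + 1) (j + 1))))
    (B := fun i => ∏ j ∈ (range (m + 1)).erase i,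
      (1 - 1 / (ent (xTab z') (m + 1) (i + 1) - ent (xTab z') (m + 1) (j + 1))))
    (fun i hi j hj hij h => hne i hi j hj hij 0 (by
      rw [Int.cast_zero, sub_eq_zero]
      exact add_right_cancel (sub_left_injective h)))
    (fun i hi => prod_ne_zero_iff.mpr fun j hj h => by
      rw [mem_erase] at hj
      have h0 := hne i hi j hj.2 hj.1.symm 0
      rw [Int.cast_zero] at h0
      refine hne i hi j hj.2 hj.1.symm 1 ?_
      rw [sub_eq_zero, eq_div_iff h0, one_mul] at h
      rw [h, Int.cast_one])
    (fun k => by rw [← gamma_eq, ← gamma_eq, h]) (i := i.val) (mem_range.mpr i.2)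
  have hj' : j ≤ m := by simpa [Nat.lt_succ_iff] using hj
  have e' := add_right_cancel (sub_left_injective e)
  rw [ent_eq _ hm (Nat.lt_succ_iff.mp i.2), ent_eq _ hm hj', xTab, xTab] at e'
  -- A match with a different position `j` would express a difference of two independent variables
  -- as an integer.
  by_cases hij : i.val = j
  · subst hij
    exact_mod_cast add_left_cancel e'
  · refine absurd ?_ (ent_xTab_sub_ne hm (Nat.lt_succ_iff.mp i.2) hj' hij 0
      (z'.1 ⟨⟨m, hm⟩, ⟨j, Nat.lt_succ_iff.mpr hj'⟩⟩ - z.1 ⟨⟨m, hm⟩, i⟩))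
    rw [ent_eq _ hm (Nat.lt_succ_iff.mp i.2), ent_eq _ hm hj', xTab, xTab]
    push_cast
    rw [Pi.zero_apply, Pi.zero_apply, Int.cast_zero, add_zero, add_zero]
    linear_combination e'

/-! ### Central elements act diagonally -/

/-- With the whole field as coefficient ring, membership in `bandOps` reduces to its condition on
supports. -/
theorem sub_mem_lowRows_of_act {m : ℕ} (hm : m ≤ n) {u : U n} (hu : u ∈ Usub n m) {z y : Shift n}
    (h : act n u (genT z) y ≠ 0) : y - z ∈ lowRows n m :=
  (act_mem_bandOps (R := ⊤) hm (fun _ => trivial) (fun _ _ _ _ _ _ => trivial) hu z y).2 h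

/-- If `c T(x + z)` has a nonzero coefficient at `y`, then `z` and `y` have the same eigenvalues
under all `c_{kj}` with `k < m`, because `c` commutes with these. The eigenvalues separate the
shifts of the rows below `m`, and `U_m` does not move the remaining rows, so `y = z`. -/
theorem act_eq_smul_of_gamma {m : ℕ} (hm : m ≤ n)
    (hlow : ∀ k < m, ∀ j z, act n (cGen n k j) (genT z) = gamma k j (xTab z) • genT z)
    {c : U n} (hc : c ∈ Zsub n m) (z : Shift n) :
    act n c (genT z) = (act n c (genT z) z) • genT z := by
  classical
  ext y
  rw [Finsupp.smul_apply, genT, Finsupp.single_apply]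
  split_ifs with hyz
  · rw [hyz, smul_eq_mul, mul_one]
  rw [smul_zero]
  by_contra hne
  have hlr := sub_mem_lowRows_of_act hm hc.1 hne
  refine hyz (Eq.symm ?_)
  ext p
  obtain ⟨⟨k, hk⟩, i⟩ := p
  by_cases hkm : k + 1 < m
  · refine eq_of_gamma_eq hk (fun j => ?_) i
    have hcomm : cGen n (k + 1) j * c = c * cGen n (k + 1) j :=
      hc.2 _ (Usub_mono (by omega) (cGen_mem_Zsub n (k + 1) j).1)
    have h1 := DFunLike.congr_fun (congrArg (fun X => act n X (genT z)) hcomm) y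
    simp only [map_mul, Module.End.mul_apply] at h1
    rw [hlow (k + 1) hkm, map_smul, Finsupp.smul_apply, end_apply_eq_sum, sum_eq_single y] at h1
    · have h2 := DFunLike.congr_fun (hlow (k + 1) hkm j y) y
      rw [Finsupp.smul_apply] at h2
      simp only [genT, Finsupp.single_eq_same, smul_eq_mul, mul_one] at h1 h2
      rw [h2, mul_comm] at h1
      exact mul_right_cancel₀ hne h1
    · intro y' _ hy'
      have h2 := DFunLike.congr_fun (hlow (k + 1) hkm j y') y
      rw [Finsupp.smul_apply] at h2
      simp only [genT] at h2
      rw [h2, Finsupp.single_eq_of_ne (Ne.symm hy'), smul_zero, mul_zero]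
    · intro h
      rw [Finsupp.notMem_support_iff.mp h, zero_mul]
  · have := hlr ⟨⟨k, hk⟩, i⟩ (not_lt.mp hkm)
    exact sub_eq_zero.mp this

theorem genT_apply_self (z : Shift n) : genT z z = 1 := Finsupp.single_eq_same

theorem raise_ne_zero {k i : ℕ} (hk : k + 1 < n) (hi : i ≤ k) (z : Shift n) :
    (genArray n).raise k i z ≠ 0 := by
  rw [GenericArray.raise]
  refine neg_ne_zero.mpr (div_ne_zero (prod_ne_zero_iff.mpr fun j hj => ?_)
    (prod_ne_zero_iff.mpr fun j hj => ?_))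
  · rw [mem_range] at hj
    rw [genArray_entry, genArray_entry, ent_eq _ (by omega) hi, ent_eq _ hk (by omega)]
    have := xTab_sub_ne z (p := ⟨⟨k, by omega⟩, ⟨i, by simp; omega⟩⟩)
      (q := ⟨⟨k + 1, hk⟩, ⟨j, by simp; omega⟩⟩) (by simp) 0
    rwa [Int.cast_zero] at this
  · rw [mem_erase, mem_range] at hj
    have := ent_xTab_sub_ne (show k < n by omega) hi (show j ≤ k by omega) hj.1.symm z 0
    rwa [Int.cast_zero] at this

theorem unitShift_injective {k i j : ℕ} (hk : k + 1 < n) (hi : i ≤ k)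
    (h : unitShift n k i = unitShift n k j) : i = j := by
  have := congrArg (fun a : Shift n => a.1 ⟨⟨k, by omega⟩, ⟨i, by simp; omega⟩⟩) h
  simp only [unitShift, hk, and_true, true_and, if_true] at this
  by_contra hij
  simp [hij] at this

/-- The eigenvalues of a central element of `U_m` do not change under shifts of lower rows. -/
theorem act_apply_add_unitShift {m : ℕ} (hm : m ≤ n) {c : U n} (hc : c ∈ Zsub n m)
    (hdiag : ∀ z, act n c (genT z) = (act n c (genT z) z) • genT z) {k i : ℕ} (hk : k + 1 < m)
    (hi : i ≤ k) (z : Shift n) :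
    act n c (genT (z + unitShift n k i)) (z + unitShift n k i) = act n c (genT z) z := by
  have hE : act n (UniversalEnvelopingAlgebra.ι ℂ (E ⟨k, by omega⟩ ⟨k + 1, by omega⟩)) =
      (genArray n).opE k := by
    rw [act_ι_E, genUnit, unitsOf_succ]
  have hcomm : UniversalEnvelopingAlgebra.ι ℂ (E ⟨k, by omega⟩ ⟨k + 1, by omega⟩) * c =
      c * UniversalEnvelopingAlgebra.ι ℂ (E ⟨k, by omega⟩ ⟨k + 1, by omega⟩) :=
    hc.2 _ (Algebra.subset_adjoin ⟨_, _, by simp; omega, by simp; omega, rfl⟩)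
  -- Since `k + 1 < m`, the raising element lies in `U_m` and commutes with `c`. Comparing the
  -- coefficient of one shifted tableau on both sides, the nonzero raising coefficient cancels and
  -- the two eigenvalues agree.
  have h1 := DFunLike.congr_fun (congrArg (fun X => act n X (genT z)) hcomm) (z + unitShift n k i)
  simp only [map_mul, Module.End.mul_apply, hE] at h1
  rw [hdiag z, map_smul, opE_genT, map_sum, Finsupp.smul_apply, Finsupp.finsetSum_apply,
    Finsupp.finsetSum_apply, sum_eq_single ⟨i, by omega⟩, sum_eq_single ⟨i, by omega⟩] at h1
  · rw [map_smul, Finsupp.smul_apply, Finsupp.smul_apply, smul_eq_mul, smul_eq_mul, smul_eq_mul,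
      genT_apply_self, mul_one, mul_comm] at h1
    exact (mul_left_cancel₀ (raise_ne_zero (by omega) hi z) h1).symm
  · intro j _ hj
    rw [map_smul, hdiag, Finsupp.smul_apply, Finsupp.smul_apply, genT, Finsupp.single_eq_of_ne,
      smul_zero, smul_zero]
    intro h
    exact hj (Fin.ext (unitShift_injective (by omega) hi (add_left_cancel h)).symm)
  · exact fun h => absurd (mem_univ _) h
  · intro j _ hj
    rw [Finsupp.smul_apply, genT, Finsupp.single_eq_of_ne, smul_zero]
    intro h
    exact hj (Fin.ext (unitShift_injective (by omega) hi (add_left_cancel h)).symm)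
  · exact fun h => absurd (mem_univ _) h

theorem eq_sum_unitShift {m : ℕ} (hm : m ≤ n) {a : Shift n} (ha : a ∈ lowRows n m) :
    a = ∑ p : Idx n, if p.1.val + 1 < m then a.1 p • unitShift n p.1 p.2 else 0 := by
  ext q
  rw [AddSubgroup.val_finsetSum, Finset.sum_apply, sum_eq_single q]
  · split_ifs with h
    · change _ = a.1 q * _
      have : (unitShift n q.1 q.2).1 q = 1 := if_pos ⟨rfl, rfl, by omega⟩
      rw [this, mul_one]
    · exact ha q (by omega)
  · intro p _ hp
    split_ifs with h
    · change a.1 p * _ = 0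
      have : (unitShift n p.1 p.2).1 q = 0 := if_neg fun hq => hp (by
        obtain ⟨⟨k, hk⟩, ⟨i, hi⟩⟩ := p
        obtain ⟨⟨k', hk'⟩, ⟨i', hi'⟩⟩ := q
        obtain ⟨h1, h2, -⟩ := hq
        simp only at h1 h2
        subst h1 h2
        rfl)
      rw [this, mul_zero]
    · rfl
  · exact fun h => absurd (mem_univ _) h

theorem act_apply_add {m : ℕ} (hm : m ≤ n) {c : U n} (hc : c ∈ Zsub n m)
    (hdiag : ∀ z, act n c (genT z) = (act n c (genT z) z) • genT z) {a : Shift n}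
    (ha : a ∈ lowRows n m) (z : Shift n) :
    act n c (genT (z + a)) (z + a) = act n c (genT z) z := by
  let H : AddSubgroup (Shift n) :=
    { carrier := {a | ∀ z, act n c (genT (z + a)) (z + a) = act n c (genT z) z}
      zero_mem' := fun z => by rw [add_zero]
      add_mem' := fun {a b} ha hb z => by rw [← add_assoc, hb, ha]
      neg_mem' := fun {a} ha z => by
        have := ha (z + -a)
        rw [neg_add_cancel_right] at this
        exact this.symm }
  have : a ∈ H := by
    rw [eq_sum_unitShift hm ha]
    refine sum_mem fun p _ => ?_
    split_ifs with h
    · have hu : unitShift n p.1 p.2 ∈ H := fun z =>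
        act_apply_add_unitShift hm hc hdiag h (Nat.lt_succ_iff.mp p.2.2) z
      exact zsmul_mem hu _
    · exact zero_mem _
  exact this z

/-- Together with `act_apply_add`, this turns the invariance of eigenvalues under shifts of `z` into
the invariance of one rational function under translations of its variables. -/
theorem translate_act_apply {m : ℕ} {u : U n} (hu : u ∈ Usub n m) (a z : Shift n) :
    fracMap (translate a) (act n u (genT z) z) = act n u (genT (z + a)) (z + a) := by
  have h := twist_act (isSymmetry_translate a) hu (genT z)
  have h1 : twist (fracMap (translate a)) (Equiv.addRight a) (genT z) = genT (z + a) := by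
    rw [genT, twist_single, map_one]
    rfl
  rw [h1] at h
  rw [← h]
  exact (twist_apply (α := Equiv.addRight a) _ z).symm

end GT

namespace GT

variable {n : ℕ}

theorem xTab_sub_xTab (z : Shift n) (p q : Idx n) : xTab z p - xTab z q =
    algebraMap (Poly n) (RatFun n) (MvPolynomial.X p - MvPolynomial.X q +
      MvPolynomial.C ((z.1 p - z.1 q : ℤ) : ℂ)) := by
  rw [map_add, map_sub, ← algebraMap_complex, map_intCast, xTab, xTab]
  push_cast
  ring

theorem inv_xTab_sub_mem_regular {F : Type*} [Field F] {ψ : Poly n →+* F} {p q : Idx n}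
    (h : ∀ c : ℤ, ψ (MvPolynomial.X p - MvPolynomial.X q + MvPolynomial.C (c : ℂ)) ≠ 0)
    (z : Shift n) : (xTab z p - xTab z q)⁻¹ ∈ regular ψ := by
  rw [xTab_sub_xTab]
  exact inv_mem_regular (h _)

/-! ### Eigenvalues of central elements are smooth -/

/-- The substitution of generic numbers for the entries in the rows below the row `m`. -/
def freeze (m : ℕ) : Poly n →ₐ[ℂ] Poly n := MvPolynomial.aeval fun x =>
  if x.1.val < m then MvPolynomial.C (x.2.val * Complex.I) else MvPolynomial.X x

/-- The frozen entries of a row are distinct multiples of the imaginary unit, so no two of them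
differ by an integer. -/
theorem eval_freeze_sub_ne {m : ℕ} (v : Tab n ℂ) {k : Fin n} (hk : k.val < m)
    {i j : Fin (k.val + 1)} (hij : i ≠ j) (c : ℤ) :
    MvPolynomial.eval v (freeze m (MvPolynomial.X ⟨k, i⟩ - MvPolynomial.X ⟨k, j⟩ +
      MvPolynomial.C (c : ℂ))) ≠ 0 := by
  rw [map_add, map_sub, freeze, MvPolynomial.aeval_X, MvPolynomial.aeval_X, MvPolynomial.aeval_C,
    if_pos hk, if_pos hk, map_add, map_sub, MvPolynomial.eval_C, MvPolynomial.eval_C,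
    MvPolynomial.algebraMap_eq, MvPolynomial.eval_C]
  intro h
  have := congrArg Complex.im h
  simp at this
  exact hij (Fin.ext (by exact_mod_cast sub_eq_zero.mp this))

/-- A translation-invariant function equals its own frozen form. The poles at `v` caused by the
lower rows are thus avoided by giving these rows generic values. -/
theorem mem_smooth_of_translate_invariant {m : ℕ} (hm : m < n) {f : RatFun n} (v : Tab n ℂ)
    (hf : f ∈ regular ((MvPolynomial.eval v).comp (freeze m : Poly n →ₐ[ℂ] Poly n).toRingHom))
    (hinv : ∀ a ∈ lowRows n (m + 1), fracMap (translate a) f = f) : f ∈ smooth v := by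
  obtain ⟨p, q, hq, rfl⟩ := hf
  have hq0 : q ≠ 0 := fun h => hq (by rw [h, map_zero])
  have hq' : MvPolynomial.eval v (freeze m q) ≠ 0 := hq
  have h := mul_subst_eq_subst_mul hm hq0
    (fun a ha => hinv a fun x hx => ha x (by omega)) (freeze m)
    (fun x hx => by rw [freeze, MvPolynomial.aeval_X, if_neg (by omega)])
  refine ⟨freeze m p, freeze m q, hq', ?_⟩
  rw [div_eq_div_iff (by rwa [Ne, IsFractionRing.to_map_eq_zero_iff])
    (algebraMap_ne_zero_of_map hq'), ← map_mul, ← map_mul, h]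

theorem act_apply_mem_smooth {m : ℕ} (hm : m < n) {c : U n} (hc : c ∈ Zsub n (m + 1))
    (hdiag : ∀ z, act n c (genT z) = (act n c (genT z) z) • genT z) (v : Tab n ℂ) (z : Shift n) :
    act n c (genT z) z ∈ smooth v := by
  refine mem_smooth_of_translate_invariant hm v ?_ fun a ha => ?_
  · exact (act_mem_bandOps (m := m + 1) hm (fun p => algebraMap_mem_regular p)
      (fun k hk i j hij z => inv_xTab_sub_mem_regular
        (fun c => eval_freeze_sub_ne v (by omega) hij c) z) hc.1 z z).1
  · rw [translate_act_apply hc.1, act_apply_add hm hc hdiag ha]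

/-! ### The eigenvalues of `c_{mk}` -/

/-- The substitution of the entries of the row `m` for the entries of the lower rows: the generic
vector becomes a highest weight vector. -/
def collapse {m : ℕ} (hm : m < n) : Poly n →ₐ[ℂ] Poly n := MvPolynomial.aeval fun x =>
  if h : x.1.val < m then MvPolynomial.X ⟨⟨m, hm⟩, ⟨x.2.val, by have := x.2.2; simp; omega⟩⟩
  else MvPolynomial.X x

/-- The substitution `collapse` with values in rational functions. -/
def collapseHom {m : ℕ} (hm : m < n) : Poly n →+* RatFun n :=
  (algebraMap (Poly n) (RatFun n)).comp (collapse hm).toRingHom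

variable {m : ℕ} (hm : m < n)

theorem collapse_X {k i : ℕ} (hk : k ≤ m) (hi : i < k + 1) :
    collapse hm (MvPolynomial.X ⟨⟨k, by omega⟩, ⟨i, hi⟩⟩) =
      MvPolynomial.X ⟨⟨m, hm⟩, ⟨i, by simp; omega⟩⟩ := by
  rw [collapse, MvPolynomial.aeval_X]
  split_ifs with h
  · rfl
  · have : k = m := le_antisymm hk (not_lt.mp h)
    subst this
    rfl

theorem collapseHom_sub_ne {k : Fin n} (hk : k.val < m) {i j : Fin (k.val + 1)} (hij : i ≠ j)
    (c : ℤ) : collapseHom hm (MvPolynomial.X ⟨k, i⟩ - MvPolynomial.X ⟨k, j⟩ +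
      MvPolynomial.C (c : ℂ)) ≠ 0 := by
  change algebraMap (Poly n) (RatFun n) (collapse hm _) ≠ 0
  have h1 := collapse_X hm hk.le i.2
  have h2 := collapse_X hm hk.le j.2
  rw [map_add, map_sub, h1, h2]
  have h3 : (collapse hm) (MvPolynomial.C (c : ℂ)) = MvPolynomial.C (c : ℂ) :=
    (collapse hm).commutes _
  have h4 := xTab_sub_ne 0 (p := ⟨⟨m, hm⟩, ⟨i.val, by have := i.2; simp; omega⟩⟩)
    (q := ⟨⟨m, hm⟩, ⟨j.val, by have := j.2; simp; omega⟩⟩)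
    (by simpa [Fin.ext_iff] using hij) (-c)
  intro h5
  refine h4 ?_
  rw [h3, map_add, ← algebraMap_complex, map_intCast, map_sub] at h5
  simp only [xTab, ZeroMemClass.coe_zero, Pi.zero_apply, Int.cast_zero, add_zero, Int.cast_neg]
  exact eq_neg_of_add_eq_zero_left h5

theorem ent_xTab_zero_sub_mem {k i : ℕ} (hk : k ≤ m) (hi : i ≤ k) :
    ent (xTab (0 : Shift n)) (k + 1) (i + 1) - ent (xTab 0) (m + 1) (i + 1) ∈
      vanishing (collapseHom hm) := by
  rw [ent_eq _ (by omega) hi, ent_eq _ hm (hi.trans hk), xTab_sub_xTab]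
  refine algebraMap_mem_vanishing ?_
  change algebraMap (Poly n) (RatFun n) (collapse hm _) = 0
  rw [map_add, map_sub, collapse_X hm hk, collapse_X hm le_rfl]
  simp

theorem act_mem_bandOps_collapse {u : U n} (hu : u ∈ Usub n (m + 1)) :
    act n u ∈ bandOps (regular (collapseHom hm)) (lowRows n (m + 1)) :=
  act_mem_bandOps (m := m + 1) hm (fun p => algebraMap_mem_regular p)
    (fun k hk i j hij z => inv_xTab_sub_mem_regular
      (fun c => collapseHom_sub_ne hm (by omega) hij c) z) hu

/-- The vectors whose coefficients vanish under `collapse`. -/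
def vanishingVec : AddSubgroup (GenSpace n) where
  carrier := {F | ∀ z, F z ∈ vanishing (collapseHom hm)}
  zero_mem' := fun _ => zero_mem _
  add_mem' := fun hF hG z => add_mem (hF z) (hG z)
  neg_mem' := fun hF z => neg_mem (hF z)

theorem smul_genT_mem {f : RatFun n} (hf : f ∈ vanishing (collapseHom hm)) (z : Shift n) :
    f • genT z ∈ vanishingVec hm := by
  classical
  intro y
  rw [Finsupp.smul_apply, genT, Finsupp.single_apply]
  split_ifs
  · rwa [smul_eq_mul, mul_one]
  · rw [smul_zero]
    exact zero_mem _

theorem apply_mem_vanishingVec {Λ₀ : AddSubgroup (Shift n)}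
    {X : Module.End (RatFun n) (GenSpace n)} (hX : X ∈ bandOps (regular (collapseHom hm)) Λ₀)
    {F : GenSpace n} (hF : F ∈ vanishingVec hm) : X F ∈ vanishingVec hm := by
  intro z
  rw [end_apply_eq_sum]
  refine sum_mem fun y _ => ?_
  rw [mul_comm]
  exact mul_mem_vanishing (hX y z).1 (hF y)

theorem genUnit_mem_bandOps {a b : ℕ} (ha : a ≤ m) (hb : b ≤ m) :
    genUnit n a b ∈ bandOps (regular (collapseHom hm)) (lowRows n (m + 1)) := by
  have := act_mem_bandOps_collapse hm (u := UniversalEnvelopingAlgebra.ι ℂ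
    (E ⟨a, by omega⟩ ⟨b, by omega⟩)) (Algebra.subset_adjoin ⟨_, _, by simp; omega, by simp; omega,
      rfl⟩)
  rwa [act_ι_E] at this

theorem inv_xTab_sub_mem_collapse (k : Fin n) (hk : k.val < m) (i j : Fin (k.val + 1)) (hij : i ≠ j)
    (z : Shift n) : (xTab z ⟨k, i⟩ - xTab z ⟨k, j⟩)⁻¹ ∈ regular (collapseHom hm) :=
  inv_xTab_sub_mem_regular (fun c => collapseHom_sub_ne hm hk hij c) z

theorem inv_ent_sub_mem {R : Subring (RatFun n)} {m : ℕ} (hm : m ≤ n)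
    (hinv : ∀ (k : Fin n), k.val < m → ∀ i j : Fin (k.val + 1), i ≠ j → ∀ z : Shift n,
      (xTab z ⟨k, i⟩ - xTab z ⟨k, j⟩)⁻¹ ∈ R) {k i j : ℕ} (hk : k < m) (hi : i ≤ k) (hj : j ≤ k)
    (hij : i ≠ j) (z : Shift n) :
    (ent (xTab z) (k + 1) (i + 1) - ent (xTab z) (k + 1) (j + 1))⁻¹ ∈ R := by
  rw [ent_eq _ (by omega) hi, ent_eq _ (show k < n by omega) hj]
  exact hinv ⟨k, by omega⟩ hk _ _ (fun h => hij (congrArg Fin.val h)) z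

/-- The numerator contains the difference of the entries `i` in rows `k` and `k + 1`, which are
identified by `collapse`; the denominator stays invertible. -/
theorem raise_zero_mem {k i : ℕ} (hk : k < m) (hi : i ≤ k) :
    (genArray n).raise k i 0 ∈ vanishing (collapseHom hm) := by
  rw [GenericArray.raise_eq_left (j := i) (by omega), mul_comm]
  refine mul_mem_vanishing ?_ ?_
  · rw [div_eq_mul_inv, ← prod_inv_distrib]
    have hent : ∀ k i, (genArray n).entry 0 k i ∈ regular (collapseHom hm) := fun k i =>
      ent_xTab_mem (fun p => algebraMap_mem_regular p) _ _ _
    refine mul_mem (neg_mem (prod_mem fun j _ => sub_mem (hent _ _) (hent _ _)))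
      (prod_mem fun j hj => ?_)
    rw [mem_erase, mem_range] at hj
    exact inv_ent_sub_mem hm.le (inv_xTab_sub_mem_collapse hm) hk hi (by omega) hj.1.symm 0
  · have := sub_mem (ent_xTab_zero_sub_mem hm hk.le hi)
      (ent_xTab_zero_sub_mem hm (k := k + 1) (i := i) hk (by omega))
    rwa [sub_sub_sub_cancel_right] at this

theorem genUnit_genT_zero_mem {a b : ℕ} (hab : a < b) (hb : b ≤ m) :
    genUnit n a b (genT 0) ∈ vanishingVec hm := by
  have hsimple : ∀ k < m, (genArray n).opE k (genT 0) ∈ vanishingVec hm := by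
    intro k hk
    rw [opE_genT]
    exact sum_mem fun i _ => smul_genT_mem hm (raise_zero_mem hm hk (Nat.lt_succ_iff.mp i.2)) _
  induction b, hab using Nat.le_induction with
  | base =>
    rw [genUnit, unitsOf_succ]
    exact hsimple a hb
  | succ b hab ih =>
    rw [genUnit, unitsOf_up hab, comm_apply]
    refine sub_mem (apply_mem_vanishingVec hm (genUnit_mem_bandOps hm (by omega) (by omega))
      (hsimple b hb)) ?_
    have h := genUnit_mem_bandOps hm (a := b) (b := b + 1) (by omega) hb
    rw [genUnit, unitsOf_succ] at h
    exact apply_mem_vanishingVec hm h (ih (by omega))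

theorem weight_zero_sub_mem {a : ℕ} (ha : a ≤ m) :
    (genArray n).weight a 0 - ((a : RatFun n) + ent (xTab 0) (m + 1) (a + 1)) ∈
      vanishing (collapseHom hm) := by
  have h1 : ∑ i ∈ range (a + 1), (ent (xTab (0 : Shift n)) (a + 1) (i + 1) -
      ent (xTab 0) (m + 1) (i + 1)) ∈ vanishing (collapseHom hm) :=
    sum_mem fun i hi => ent_xTab_zero_sub_mem hm ha (by rw [mem_range] at hi; omega)
  have h2 : ∑ i ∈ range a, (ent (xTab (0 : Shift n)) (a - 1 + 1) (i + 1) -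
      ent (xTab 0) (m + 1) (i + 1)) ∈ vanishing (collapseHom hm) :=
    sum_mem fun i hi => ent_xTab_zero_sub_mem hm (by omega) (by rw [mem_range] at hi; omega)
  convert sub_mem h1 h2 using 1
  rw [GenericArray.weight, sum_sub_distrib, sum_sub_distrib, sum_range_succ (fun i =>
    ent (xTab (0 : Shift n)) (m + 1) (i + 1))]
  simp only [genArray_entry]
  ring

theorem sum_subtype_lt {M : Type*} [AddCommMonoid M] {m : ℕ} (hm : m ≤ n) (f : ℕ → M) :
    ∑ c : {i : Fin n // i.val < m}, f c.1.val = ∑ c ∈ range m, f c :=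
  sum_bij (fun c _ => c.1.val) (fun c _ => mem_range.mpr c.2)
    (fun _ _ _ _ h => Subtype.ext (Fin.ext h))
    (fun c hc => ⟨⟨⟨c, (mem_range.mp hc).trans_le hm⟩, mem_range.mp hc⟩, mem_univ _, rfl⟩)
    fun _ _ => rfl

/-- The matrix of generators acting on the generic module. -/
theorem act_genMatrix_pow (m k : ℕ) :
    (Matrix.trace ((genMatrix n m).map (act n) ^ k)) = act n (cGen n m k) := by
  have h : (genMatrix n m).map (act n) ^ k = (genMatrix n m ^ k).map (act n) :=
    (map_pow (RingHom.mapMatrix (act n).toRingHom) (genMatrix n m) k).symm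
  rw [h, cGen_eq, Matrix.trace, Matrix.trace, map_sum]
  rfl

/-- The shifted highest weight. -/
def hwNode (n m i : ℕ) : RatFun n :=
  ent (xTab (0 : Shift n)) (m + 1) (i + 1) + ((m + 1 : ℕ) : RatFun n) - 1

theorem hwNode_sub (i j : ℕ) : hwNode n m i - hwNode n m j =
    ent (xTab (0 : Shift n)) (m + 1) (i + 1) - ent (xTab (0 : Shift n)) (m + 1) (j + 1) := by
  rw [hwNode, hwNode, sub_sub_sub_cancel_right, add_sub_add_right_eq_sub]

theorem gamma_xTab_zero (hm : m < n) (k : ℕ) : gamma (m + 1) k (xTab (0 : Shift n)) =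
    ∑ a : {i : Fin n // i.val < m + 1}, hwEigen (m + 1) (hwNode n m) k a.1.val := by
  rw [sum_subtype_lt hm fun a => hwEigen (m + 1) (hwNode n m) k a, range_eq_Ico,
    sum_hwEigen _ k 0 (Nat.zero_le _), gamma_eq, range_eq_Ico]
  · refine sum_congr rfl fun i _ => ?_
    simp only [hwNode_sub]
    rfl
  · intro i hi j hj hij h
    refine ent_xTab_sub_ne hm (Nat.lt_succ_iff.mp hi) (Nat.lt_succ_iff.mp hj) hij 0 0 ?_
    rw [Int.cast_zero, ← hwNode_sub, h, sub_self]

theorem hwEigen_succ (hm : m < n) (k : ℕ) (a : {i : Fin n // i.val < m + 1}) :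
    hwEigen (m + 1) (hwNode n m) (k + 1) a.1.val =
      (((a.1.val : ℕ) : RatFun n) + ent (xTab (0 : Shift n)) (m + 1) (a.1.val + 1)) *
        hwEigen (m + 1) (hwNode n m) k a.1.val +
      ∑ c : {i : Fin n // i.val < m + 1}, if a < c then
        hwEigen (m + 1) (hwNode n m) k a.1.val - hwEigen (m + 1) (hwNode n m) k c.1.val else 0 := by
  have ha : a.1.val ≤ m := Nat.lt_succ_iff.mp a.2
  generalize hy : hwEigen (m + 1) (hwNode n m) k = y
  have h1 : ∑ c : {i : Fin n // i.val < m + 1}, (if a < c then y a.1.val - y c.1.val else 0) =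
      ∑ c ∈ Ico (a.1.val + 1) (m + 1), (y a.1.val - y c) := by
    refine (sum_subtype_lt (show m + 1 ≤ n from hm) fun c => if a.1.val < c then
      y a.1.val - y c else 0).trans ?_
    rw [← sum_filter]
    refine sum_congr (Finset.ext fun c => ?_) fun _ _ => rfl
    simp only [mem_filter, mem_range, mem_Ico]
    omega
  rw [h1, sum_sub_distrib, sum_const, Nat.card_Ico, nsmul_eq_mul, Nat.add_sub_add_right,
    Nat.cast_sub ha, hwEigen, hy, hwNode]
  push_cast
  ring

theorem act_genMatrix_apply (a b : {i : Fin n // i.val < m}) :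
    (genMatrix n m).map (act n) a b = genUnit n a.1 b.1 := act_ι_E a.1 b.1

theorem comm_act_genMatrix (a b c d : {i : Fin n // i.val < m}) :
    comm ((genMatrix n m).map (act n) a b) ((genMatrix n m).map (act n) c d) =
      (if b = c then (genMatrix n m).map (act n) a d else 0) -
        if d = a then (genMatrix n m).map (act n) c b else 0 := by
  simp only [act_genMatrix_apply]
  have h := genUnit_comm (n := n) a.1.2 b.1.2 c.1.2 d.1.2
  simp only [← Fin.ext_iff, ← Subtype.ext_iff] at h
  exact h

/-- Modulo vectors that vanish under `collapse`, `T(x)` is a highest weight vector for gl(m + 1),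
whose weight at the index `a` is `a` plus the entry `a` of row `m`. Adding `m - a` to it gives the
node `hwNode` used in `γ`. -/
theorem act_cGen_sub_mem (k : ℕ) :
    act n (cGen n (m + 1) k) (genT 0) - gamma (m + 1) k (xTab (0 : Shift n)) • genT 0 ∈
      vanishingVec hm := by
  rw [gamma_xTab_zero hm, ← act_genMatrix_pow]
  refine trace_pow_highestWeight (K := RatFun n) (V := GenSpace n)
    (ι := {i : Fin n // i.val < m + 1}) (e := (genMatrix n (m + 1)).map (act n))
    (R := regular (collapseHom hm)) (N := vanishingVec hm) (w := genT 0)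
    (l := fun a => ((a.1.val : ℕ) : RatFun n) + ent (xTab (0 : Shift n)) (m + 1) (a.1.val + 1))
    (y := fun k a => hwEigen (m + 1) (hwNode n m) k a.1.val)
    comm_act_genMatrix (fun f hf F hF z => mul_mem_vanishing hf (hF z)) (fun a b F hF => ?_)
    (fun a => ?_) (fun a b hab => ?_) (fun a => ?_) (fun _ => rfl) (hwEigen_succ hm) k
  · rw [act_genMatrix_apply]
    exact apply_mem_vanishingVec hm (genUnit_mem_bandOps hm (Nat.lt_succ_iff.mp a.2)
      (Nat.lt_succ_iff.mp b.2)) hF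
  · exact add_mem (natCast_mem _ _) (ent_xTab_mem (fun p => algebraMap_mem_regular p) _ _ _)
  · rw [act_genMatrix_apply]
    exact genUnit_genT_zero_mem hm hab (Nat.lt_succ_iff.mp b.2)
  · rw [act_genMatrix_apply, genUnit, unitsOf_self, opH_genT, ← sub_smul]
    exact smul_genT_mem hm (weight_zero_sub_mem hm (Nat.lt_succ_iff.mp a.2)) 0

/-- The difference of the two sides vanishes under `collapse` and is invariant under translations of
the lower rows. By invariance the substitution cannot change it, so it was already zero. -/
theorem act_cGen_zero_eq (hm : m < n) {k : ℕ}
    (hdiag : ∀ z, act n (cGen n (m + 1) k) (genT z) =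
      (act n (cGen n (m + 1) k) (genT z) z) • genT z) :
    act n (cGen n (m + 1) k) (genT 0) 0 = gamma (m + 1) k (xTab (0 : Shift n)) := by
  have hc := cGen_mem_Zsub n (m + 1) k
  have hmem := act_cGen_sub_mem hm k 0
  rw [Finsupp.sub_apply, Finsupp.smul_apply, genT_apply_self, smul_eq_mul, mul_one] at hmem
  have hinv : ∀ a ∈ lowRows n (m + 1), fracMap (translate a)
      (act n (cGen n (m + 1) k) (genT 0) 0 - gamma (m + 1) k (xTab (0 : Shift n))) =
      act n (cGen n (m + 1) k) (genT 0) 0 - gamma (m + 1) k (xTab (0 : Shift n)) := by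
    intro a ha
    rw [map_sub, translate_act_apply hc.1, act_apply_add (show m + 1 ≤ n from hm) hc hdiag ha]
    congr 1
    refine (map_gamma (fracMap (translate a) : RatFun n →+* RatFun n) _ _ _).trans ?_
    -- Row `m`, counted from zero, is the only row entering `γ`, and translations in `lowRows n (m +
    -- 1)` leave it fixed.
    have hent : ∀ i, ent (fun p => (fracMap (translate a) : RatFun n →+* RatFun n)
        (xTab (0 : Shift n) p)) (m + 1) (i + 1) = ent (xTab (0 : Shift n)) (m + 1) (i + 1) := by
      intro i
      by_cases hi : i ≤ m
      · rw [ent_eq _ hm hi, ent_eq _ hm hi]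
        refine (fracMap_translate_xTab a 0 _).trans ?_
        rw [xTab_add, ha _ (le_refl (m + 1)), Int.cast_zero, add_zero]
      · rw [ent_eq_zero _ (by omega), ent_eq_zero _ (by omega)]
    rw [gamma_eq, gamma_eq]
    simp only [hent]
  obtain ⟨p, q, hq, hp, e⟩ := hmem
  have hq0 : q ≠ 0 := fun h => hq (by rw [h, map_zero])
  have h := mul_subst_eq_subst_mul (m := m) hm hq0
    (fun a ha => by
      rw [← e]
      exact hinv a fun x hx => ha x (by omega)) (collapse hm)
    (fun x hx => by rw [collapse, MvPolynomial.aeval_X, dif_neg (by omega)])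
  have hp' : collapse hm p = 0 :=
    (IsFractionRing.to_map_eq_zero_iff (R := Poly n) (K := RatFun n)).mp hp
  have hq' : collapse hm q ≠ 0 := fun h => hq (by
    change algebraMap (Poly n) (RatFun n) (collapse hm q) = 0
    rw [h, map_zero])
  rw [hp', zero_mul, eq_comm, mul_eq_zero, or_iff_left hq'] at h
  rw [h, map_zero (algebraMap (Poly n) (RatFun n)), zero_div] at e
  exact sub_eq_zero.mp e

/-- Strong induction on the row: the formula for smaller `m` makes the new element diagonal, and its
eigenvalue is computed at `z = 0` and transported to every `z` by translation. -/
theorem act_cGen (n m : ℕ) (hm : m ≤ n) (k : ℕ) (z : Shift n) :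
    act n (cGen n m k) (genT z) = gamma m k (xTab z) • genT z := by
  induction m using Nat.strong_induction_on generalizing k z with
  | _ m ih =>
    cases m with
    | zero =>
      have h1 : cGen n 0 k = 0 := by
        rw [cGen_eq, Matrix.trace]
        exact sum_eq_zero fun a _ => absurd a.2 (Nat.not_lt_zero _)
      rw [h1, map_zero, LinearMap.zero_apply, gamma_eq, range_zero, sum_empty, zero_smul]
    | succ m =>
      have hc := cGen_mem_Zsub n (m + 1) k
      have hdiag := act_eq_smul_of_gamma hm
        (fun k hk j z => ih k hk (by omega) j z) hc
      rw [hdiag z]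
      congr 1
      have h0 := act_cGen_zero_eq hm hdiag
      have h1 := translate_act_apply hc.1 z 0
      rw [h0, zero_add] at h1
      rw [← h1]
      refine (map_gamma (fracMap (translate z) : RatFun n →+* RatFun n) _ _ _).trans ?_
      congr 1
      funext p
      refine (fracMap_translate_xTab z 0 p).trans ?_
      rw [zero_add]

theorem act_Zsub {m : ℕ} (hm : m ≤ n) {c : U n} (hc : c ∈ Zsub n m) (z : Shift n) :
    act n c (genT z) = (act n c (genT z) z) • genT z :=
  act_eq_smul_of_gamma hm (fun k hk j z => act_cGen n k (by omega) j z) hc z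

/-- The Gelfand–Tsetlin subalgebra acts diagonally on the generic module, with smooth
eigenvalues. -/
theorem exists_act_GTSub_eq (v : Tab n ℂ) {c : U n} (hc : c ∈ GTSub n) (z : Shift n) :
    ∃ f ∈ smooth v, act n c (genT z) = f • genT z := by
  induction hc using Algebra.adjoin_induction with
  | mem c hc =>
    simp only [Set.mem_iUnion] at hc
    obtain ⟨m, hm, hc⟩ := hc
    rw [mem_Icc] at hm
    obtain ⟨m, rfl⟩ : ∃ m', m = m' + 1 := ⟨m - 1, by omega⟩
    exact ⟨_, act_apply_mem_smooth hm.2 hc (act_Zsub hm.2 hc) v z, act_Zsub hm.2 hc z⟩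
  | algebraMap c => exact ⟨_, algebraMap_complex_mem c, act_algebraMap_apply c _⟩
  | add x y _ _ hx hy =>
    obtain ⟨f, hf, hx⟩ := hx
    obtain ⟨g, hg, hy⟩ := hy
    exact ⟨f + g, add_mem hf hg, by rw [map_add, LinearMap.add_apply, hx, hy, add_smul]⟩
  | mul x y _ _ hx hy =>
    obtain ⟨f, hf, hx⟩ := hx
    obtain ⟨g, hg, hy⟩ := hy
    exact ⟨f * g, mul_mem hf hg, by
      rw [map_mul, Module.End.mul_apply, hy, map_smul, hx, smul_smul, mul_comm]⟩

/-- The individual summands of `γ` may have poles at singular pairs. Smoothness of the sum is read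
off from its role as the eigenvalue of a central element. -/
theorem gamma_mem_smooth (v : Tab n ℂ) {m : ℕ} (h1 : 1 ≤ m) (hm : m ≤ n) (k : ℕ) (z : Shift n) :
    gamma m k (xTab z) ∈ smooth v := by
  obtain ⟨f, hf, e⟩ := exists_act_GTSub_eq v (c := cGen n m k) (Algebra.subset_adjoin (by
    simp only [Set.mem_iUnion]
    exact ⟨m, mem_Icc.mpr ⟨h1, hm⟩, cGen_mem_Zsub n m k⟩)) z
  rw [act_cGen n m hm] at e
  have := DFunLike.congr_fun e z
  rw [Finsupp.smul_apply, Finsupp.smul_apply, genT_apply_self, smul_eq_mul, smul_eq_mul, mul_one,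
    mul_one] at this
  rwa [this]

end GT

/-! ### Poles of the generic action at a singular tableau. -/

namespace GT

namespace SingularPairs

variable {n t : ℕ} {v : Tab n ℂ} (S : SingularPairs n t)

/-- The singular pairs at which `z` is symmetric. -/
def sym (z : Shift n) : Finset (Fin t) := univ.filter fun r => z.1 (S.left r) = z.1 (S.right r)

variable {S}

theorem mem_sym {z : Shift n} {r : Fin t} :
    r ∈ S.sym z ↔ z.1 (S.left r) = z.1 (S.right r) := by
  rw [sym, mem_filter, and_iff_right (mem_univ r)]

variable (S) in
/-- The singular pairs in the row `k` at which `z` is symmetric. -/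
def symRow (z : Shift n) (k : ℕ) : Finset (Fin t) := (S.sym z).filter fun r => (S.row r).val = k

/-- The pairs of positions at which `v` is singular. -/
def IsPair (S : SingularPairs n t) (r : Fin t) (p q : Idx n) : Prop :=
  S.left r = p ∧ S.right r = q ∨ S.left r = q ∧ S.right r = p

theorem exists_isPair (hv : S.IsCritical v) {k : Fin n} (hk : k.val + 1 < n)
    {i j : Fin (k.val + 1)} (hij : i ≠ j) {c : ℤ} (h : v ⟨k, i⟩ - v ⟨k, j⟩ + c = 0) :
    c = 0 ∧ ∃ r, S.IsPair r ⟨k, i⟩ ⟨k, j⟩ := by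
  have hex : ∃ r, S.IsPair r ⟨k, i⟩ ⟨k, j⟩ := by
    by_contra! hne
    rcases lt_or_gt_of_ne hij with h1 | h1
    · exact hv.2 k hk i j h1 (fun r hr => hne r (Or.inl hr)) (-c) (by
        push_cast; exact eq_neg_of_add_eq_zero_left h)
    · exact hv.2 k hk j i h1 (fun r hr => hne r (Or.inr hr)) c (by
        linear_combination -h)
  refine ⟨?_, hex⟩
  obtain ⟨r, ⟨h1, h2⟩ | ⟨h1, h2⟩⟩ := hex
  · have := hv.1 r
    rw [h1, h2] at this
    rw [this, sub_self, zero_add] at h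
    exact_mod_cast h
  · have := hv.1 r
    rw [h1, h2] at this
    rw [this, sub_self, zero_add] at h
    exact_mod_cast h

theorem IsPair.row_eq {r : Fin t} {k : Fin n} {i j : Fin (k.val + 1)}
    (h : S.IsPair r ⟨k, i⟩ ⟨k, j⟩) : (S.row r).val = k.val := by
  obtain ⟨h, -⟩ | ⟨h, -⟩ := h
  · exact congrArg (fun p : Idx n => p.1.val) h
  · exact congrArg (fun p : Idx n => p.1.val) h

theorem IsPair.unique {r s : Fin t} {p q q' : Idx n} (h : S.IsPair r p q) (h' : S.IsPair s p q') :
    r = s ∧ q = q' := by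
  have hrs : r = s := by
    by_contra hrs
    obtain ⟨h1, h2⟩ | ⟨h1, h2⟩ := h <;> obtain ⟨h3, h4⟩ | ⟨h3, h4⟩ := h'
    · exact S.left_ne_left hrs (h1.trans h3.symm)
    · exact S.left_ne_right_of_ne hrs (h1.trans h4.symm)
    · exact S.right_ne_left_of_ne hrs (h2.trans h3.symm)
    · exact S.right_ne_right hrs (h2.trans h4.symm)
  subst hrs
  refine ⟨rfl, ?_⟩
  obtain ⟨h1, h2⟩ | ⟨h1, h2⟩ := h <;> obtain ⟨h3, h4⟩ | ⟨h3, h4⟩ := h'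
  · exact h2.symm.trans h4
  · exact absurd (h1.trans h4.symm) (S.left_ne_right r)
  · exact absurd (h3.trans h2.symm) (S.left_ne_right r)
  · exact h1.symm.trans h3

/-- The difference of two entries of a row is invertible at `v`, except at the singular pairs. -/
theorem inv_sub_mem (hv : S.IsCritical v) {k : Fin n} (hk : k.val + 1 < n)
    {i j : Fin (k.val + 1)} (hij : i ≠ j) (z : Shift n)
    (hne : ∀ r ∈ S.sym z, ¬ S.IsPair r ⟨k, i⟩ ⟨k, j⟩) :
    (xTab z ⟨k, i⟩ - xTab z ⟨k, j⟩)⁻¹ ∈ smooth v := by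
  rw [xTab_sub_xTab]
  refine inv_mem_regular fun h => ?_
  rw [map_add, map_sub, MvPolynomial.eval_X, MvPolynomial.eval_X, MvPolynomial.eval_C] at h
  obtain ⟨h0, r, hr⟩ := exists_isPair hv hk hij h
  refine hne r (mem_sym.mpr ?_) hr
  rw [sub_eq_zero] at h0
  obtain ⟨h1, h2⟩ | ⟨h1, h2⟩ := hr
  · rw [h1, h2, h0]
  · rw [h1, h2, h0]

theorem mul_inv_neg_self {F : Type*} [Field F] {a : F} (ha : a ≠ 0) : a * (-a)⁻¹ = -1 := by
  field_simp

/-- When `z` is symmetric at the pair, the difference of the two entries of `x + z` is the gap up to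
sign. -/
theorem gap_mul_inv_mem {r : Fin t} {p q : Idx n} {z : Shift n} (hr : r ∈ S.sym z)
    (h : S.IsPair r p q) : S.gap r * (xTab z p - xTab z q)⁻¹ ∈ smooth v := by
  rw [mem_sym] at hr
  obtain ⟨h1, h2⟩ | ⟨h1, h2⟩ := h
  · have : xTab z p - xTab z q = S.gap r := by
      rw [← h1, ← h2, xTab, xTab, hr, gap]
      ring
    rw [this, mul_inv_cancel₀ (S.gap_ne_zero r)]
    exact one_mem _
  · have : xTab z p - xTab z q = -S.gap r := by
      rw [← h1, ← h2, xTab, xTab, hr, gap]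
      ring
    rw [this]
    exact (mul_inv_neg_self (S.gap_ne_zero r)).symm ▸ neg_mem (one_mem _)

/-- The singular pairs are disjoint, so the position `i` has at most one partner. Hence at most one
factor of the denominator vanishes at `v`, and the gap of that pair cancels it. -/
theorem P_symRow_mul_inv_mem (hv : S.IsCritical v) {k : Fin n} (hk : k.val + 1 < n)
    (i : Fin (k.val + 1)) (z : Shift n) :
    S.P (S.symRow z k.val) * (∏ j ∈ univ.erase i, (xTab z ⟨k, i⟩ - xTab z ⟨k, j⟩))⁻¹ ∈
      smooth v := by
  rw [← prod_inv_distrib]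
  by_cases hex : ∃ j, ∃ r ∈ S.sym z, S.IsPair r ⟨k, i⟩ ⟨k, j⟩
  · obtain ⟨j, r, hr, hp⟩ := hex
    have hj : j ∈ univ.erase i := by
      refine mem_erase.mpr ⟨?_, mem_univ _⟩
      rintro rfl
      obtain ⟨h1, h2⟩ | ⟨h1, h2⟩ := hp
      · exact S.left_ne_right r (h1.trans h2.symm)
      · exact S.left_ne_right r (h1.trans h2.symm)
    have hr' : r ∈ S.symRow z k.val := mem_filter.mpr ⟨hr, hp.row_eq⟩
    rw [P_eq, ← mul_prod_erase _ _ hr', ← mul_prod_erase _ _ hj, mul_mul_mul_comm]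
    refine mul_mem (gap_mul_inv_mem hr hp) (mul_mem (prod_mem fun s _ => S.gap_mem s)
      (prod_mem fun j' hj' => ?_))
    rw [mem_erase, mem_erase] at hj'
    refine inv_sub_mem hv hk hj'.2.1.symm z fun s _ hs => hj'.1 ?_
    have := (hp.unique hs).2
    exact (sigma_mk_injective this).symm
  · push Not at hex
    refine mul_mem (S.P_mem _) (prod_mem fun j hj => ?_)
    exact inv_sub_mem hv hk (mem_erase.mp hj).1.symm z fun r hr => hex j r hr

theorem P_symRow_mul_inv_ent_mem (hv : S.IsCritical v) {k i : ℕ} (hk : k + 1 < n) (hi : i ≤ k)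
    (z : Shift n) : S.P (S.symRow z k) * (∏ j ∈ (range (k + 1)).erase i,
      (ent (xTab z) (k + 1) (i + 1) - ent (xTab z) (k + 1) (j + 1)))⁻¹ ∈ smooth v := by
  have h := P_symRow_mul_inv_mem hv (k := ⟨k, by omega⟩) hk ⟨i, Nat.lt_succ_iff.mpr hi⟩ z
  convert h using 3
  refine (prod_bij (fun (j : Fin (k + 1)) _ => j.val) (fun j hj => ?_)
    (fun _ _ _ _ h => Fin.ext h) (fun j hj => ?_) fun j hj => ?_).symm
  · rw [mem_erase] at hj
    exact mem_erase.mpr ⟨fun h => hj.1 (Fin.ext h), mem_range.mpr j.2⟩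
  · rw [mem_erase, mem_range] at hj
    exact ⟨⟨j, hj.2⟩, mem_erase.mpr ⟨fun h => hj.1 (congrArg Fin.val h), mem_univ _⟩, rfl⟩
  · rw [ent_eq _ (show k < n by omega) hi, ent_eq _ (show k < n by omega) (Nat.lt_succ_iff.mp j.2)]

/-- The denominator of `e_{rs}` in the row `k`, counted from one. -/
def rowDen (w : Tab n (RatFun n)) (k : ℕ) : RatFun n :=
  ∏ j ∈ Icc 2 k, (ent w k 1 - ent w k j)

theorem P_symRow_mul_rowDen_mem (hv : S.IsCritical v) {a b : ℕ} (hab : a ≤ b) (hb : b + 1 < n)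
    {σ : RowPerm n} (hσ : σ ∈ Phi ⟨a, by omega⟩ ⟨b + 1, hb⟩) {k : ℕ} (hk : k ∈ Icc a b)
    (z : Shift n) :
    S.P (S.symRow z k) * (rowDen (permTab σ (xTab z)) (k + 1))⁻¹ ∈ smooth v := by
  rw [mem_Icc] at hk
  rw [mem_Phi (by omega)] at hσ
  obtain ⟨⟨c, hc⟩, hcs⟩ := (hσ ⟨k, by omega⟩).1 ⟨hk.1, by simp; omega⟩
  rw [rowDen, ent_permTab_first hcs, prod_ent_permTab hcs _
    fun y => ent (xTab z) (k + 1) (c + 1) - y]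
  exact P_symRow_mul_inv_ent_mem hv (show k + 1 < n by omega) (show c ≤ k from
    Nat.lt_succ_iff.mp hc) z

/-- The coefficient has one denominator for each row from `a` to `b`, so the gaps can be distributed
by row. Gaps belonging to other rows are harmless smooth factors. -/
theorem P_sym_mul_mem (hv : S.IsCritical v) {a b : ℕ} (hab : a ≤ b) (hb : b + 1 < n)
    {σ : RowPerm n} (hσ : σ ∈ Phi ⟨a, by omega⟩ ⟨b + 1, hb⟩) (z : Shift n) {f : RatFun n}
    (hf : f ∈ smooth v) :
    S.P (S.sym z) * (f * ∏ k ∈ Icc (a + 1) (b + 1), (rowDen (permTab σ (xTab z)) k)⁻¹) ∈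
      smooth v := by
  have h1 : S.P (S.sym z) = S.P ((S.sym z).filter fun r => (S.row r).val ∉ Icc a b) *
      ∏ k ∈ Icc a b, S.P (S.symRow z k) := by
    have h2 : ∏ k ∈ Icc a b, S.P (S.symRow z k) =
        S.P ((S.sym z).filter fun r => (S.row r).val ∈ Icc a b) := by
      simp only [P_eq]
      rw [← prod_fiberwise_of_maps_to (t := Icc a b) (g := fun r => (S.row r).val)
        (fun r hr => (mem_filter.mp hr).2)]
      refine prod_congr rfl fun k hk => prod_congr ?_ fun _ _ => rfl
      ext r
      simp only [symRow, mem_filter]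
      constructor
      · rintro ⟨h1, rfl⟩
        exact ⟨⟨h1, hk⟩, rfl⟩
      · rintro ⟨⟨h1, -⟩, h2⟩
        exact ⟨h1, h2⟩
    rw [h2, mul_comm]
    exact (prod_filter_mul_prod_filter_not _ _ _).symm
  have h3 : ∏ k ∈ Icc (a + 1) (b + 1), (rowDen (permTab σ (xTab z)) k)⁻¹ =
      ∏ k ∈ Icc a b, (rowDen (permTab σ (xTab z)) (k + 1))⁻¹ := by
    rw [← image_add_right_Icc, prod_image fun _ _ _ _ h => add_right_cancel h]
  rw [h1, h3]
  have h4 : (∏ k ∈ Icc a b, S.P (S.symRow z k)) *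
      ∏ k ∈ Icc a b, (rowDen (permTab σ (xTab z)) (k + 1))⁻¹ ∈ smooth v := by
    rw [← prod_mul_distrib]
    exact prod_mem fun k hk => P_symRow_mul_rowDen_mem hv hab hb hσ hk z
  have h5 : ∀ a b c d : RatFun n, a * b * (c * d) = a * c * (b * d) := fun a b c d => by ring
  rw [h5]
  exact mul_mem (mul_mem (S.P_mem _) hf) h4

theorem ent_permTab_mem (σ : RowPerm n) (z : Shift n) (k i : ℕ) :
    ent (permTab σ (xTab z)) k i ∈ smooth v := by
  rw [ent]
  split_ifs
  · exact add_mem (algebraMap_mem_regular _) (intCast_mem _ _)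
  · exact zero_mem _

theorem prod_ent_sub_mem (σ : RowPerm n) (z : Shift n) (s : Finset ℕ) (k l i : ℕ) :
    ∏ j ∈ s, (ent (permTab σ (xTab z)) k i - ent (permTab σ (xTab z)) l j) ∈ smooth v :=
  prod_mem fun _ _ => sub_mem (ent_permTab_mem _ _ _ _) (ent_permTab_mem _ _ _ _)

theorem neg_div_mul_div {F : Type*} [Field F] (a b c d : F) :
    -(a / b) * (c / d) = -a * c * (d⁻¹ * b⁻¹) := by
  rw [div_eq_mul_inv, div_eq_mul_inv]
  ring

theorem P_sym_mul_eCoef_up_mem (hv : S.IsCritical v) {a b : ℕ} (hab : a ≤ b) (hb : b + 1 < n)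
    {σ : RowPerm n} (hσ : σ ∈ Phi ⟨a, by omega⟩ ⟨b + 1, hb⟩) (z : Shift n) :
    S.P (S.sym z) * eCoef (a + 1) (b + 2) (permTab σ (xTab z)) ∈ smooth v := by
  have hN : -((∏ j ∈ Icc 1 (b + 2), (ent (permTab σ (xTab z)) (b + 1) 1 -
      ent (permTab σ (xTab z)) (b + 2) j))) * ∏ j ∈ Icc (a + 1) b, ∏ t ∈ Icc 2 (j + 1),
        (ent (permTab σ (xTab z)) j 1 - ent (permTab σ (xTab z)) (j + 1) t) ∈ smooth v :=
    mul_mem (neg_mem (prod_ent_sub_mem _ _ _ _ _ _))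
      (prod_mem fun j _ => prod_ent_sub_mem _ _ _ _ _ _)
  convert P_sym_mul_mem hv hab hb hσ z hN using 2
  rw [eCoef_up _ hab, upRest, prod_div_distrib, prod_Icc_succ_top (a := a + 1) (b := b) (by omega)
    fun k => (rowDen (permTab σ (xTab z)) k)⁻¹, prod_inv_distrib]
  simp only [rowDen]
  exact neg_div_mul_div _ _ _ _

theorem P_sym_mul_eCoef_down_mem (hv : S.IsCritical v) {a b : ℕ} (hab : a ≤ b) (hb : b + 1 < n)
    {σ : RowPerm n} (hσ : σ ∈ Phi ⟨a, by omega⟩ ⟨b + 1, hb⟩) (z : Shift n) :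
    S.P (S.sym z) * eCoef (b + 2) (a + 1) (permTab σ (xTab z)) ∈ smooth v := by
  have hN : (∏ j ∈ Icc 1 a, (ent (permTab σ (xTab z)) (a + 1) 1 -
      ent (permTab σ (xTab z)) a j)) * ∏ j ∈ Icc (a + 3) (b + 2), ∏ t ∈ Icc 2 (j - 2),
        (ent (permTab σ (xTab z)) (j - 1) 1 - ent (permTab σ (xTab z)) (j - 2) t) ∈ smooth v :=
    mul_mem (prod_ent_sub_mem _ _ _ _ _ _) (prod_mem fun j _ => prod_ent_sub_mem _ _ _ _ _ _)
  convert P_sym_mul_mem hv hab hb hσ z hN using 2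
  have h1 : ∏ k ∈ Icc (a + 1) (b + 1), (rowDen (permTab σ (xTab z)) k)⁻¹ =
      (rowDen (permTab σ (xTab z)) (a + 1))⁻¹ *
        ∏ j ∈ Icc (a + 3) (b + 2), (rowDen (permTab σ (xTab z)) (j - 1))⁻¹ := by
    have h2 : Icc (a + 1) (b + 1) = insert (a + 1) (Icc (a + 2) (b + 1)) := by
      ext x; simp only [mem_insert, mem_Icc]; omega
    rw [h2, prod_insert (by simp)]
    congr 1
    rw [show a + 3 = a + 2 + 1 from rfl, show b + 2 = b + 1 + 1 from rfl, ← image_add_right_Icc,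
      prod_image fun _ _ _ _ h => add_right_cancel h]
    rfl
  rw [eCoef_down _ hab, downRest, prod_div_distrib, h1, prod_inv_distrib]
  simp only [rowDen, div_eq_mul_inv]
  ring

theorem eCoef_self_mem (k : ℕ) (σ : RowPerm n) (z : Shift n) :
    eCoef k k (permTab σ (xTab z)) ∈ smooth v := by
  rw [eCoef, if_neg (lt_irrefl k), if_neg (lt_irrefl k)]
  exact sub_mem (add_mem (sub_mem (natCast_mem _ _) (one_mem _))
    (sum_mem fun _ _ => ent_permTab_mem _ _ _ _)) (sum_mem fun _ _ => ent_permTab_mem _ _ _ _)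

theorem P_sym_mul_eCoef_mem (hv : S.IsCritical v) (r s : Fin n) {σ : RowPerm n}
    (hσ : σ ∈ Phi r s) (z : Shift n) :
    S.P (S.sym z) * eCoef (r.val + 1) (s.val + 1) (permTab σ (xTab z)) ∈ smooth v := by
  obtain ⟨a, ha⟩ := r
  obtain ⟨b, hb⟩ := s
  rcases lt_trichotomy a b with hab | rfl | hab
  · obtain ⟨b, rfl⟩ : ∃ b', b = b' + 1 := ⟨b - 1, by omega⟩
    exact P_sym_mul_eCoef_up_mem (a := a) (b := b) hv (by omega) hb hσ z
  · exact mul_mem (S.P_mem _) (eCoef_self_mem _ _ _)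
  · obtain ⟨a, rfl⟩ : ∃ b', a = b' + 1 := ⟨a - 1, by omega⟩
    rw [Phi_symm] at hσ
    exact P_sym_mul_eCoef_down_mem (a := b) (b := a) hv (by omega) ha hσ z

/-- Vectors with smooth coefficients. -/
def smoothVec (v : Tab n ℂ) : AddSubgroup (GenSpace n) where
  carrier := {F | ∀ z, F z ∈ smooth v}
  zero_mem' := fun _ => zero_mem _
  add_mem' := fun hF hG z => add_mem (hF z) (hG z)
  neg_mem' := fun hF z => neg_mem (hF z)

theorem smul_mem_smoothVec {f : RatFun n} (hf : f ∈ smooth v) {F : GenSpace n}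
    (hF : F ∈ smoothVec v) : f • F ∈ smoothVec v := fun z => mul_mem hf (hF z)

theorem genT_mem_smoothVec (z : Shift n) : genT z ∈ smoothVec v := fun y => by
  classical
  rw [genT, Finsupp.single_apply]
  split_ifs
  · exact one_mem _
  · exact zero_mem _

theorem complex_smul_eq (c : ℂ) (F : GenSpace n) : c • F = algebraMap ℂ (RatFun n) c • F :=
  (algebraMap_smul (RatFun n) c F).symm

theorem P_sym_smul_genRep_mem (hv : S.IsCritical v) (g : gl n) (z : Shift n) :
    S.P (S.sym z) • genRep n g (genT z) ∈ smoothVec v := by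
  have hg : genRep n g (genT z) = ∑ a, ∑ b, g a b • genRep n (E a b) (genT z) := by
    have : genRep n g = ∑ a, ∑ b, g a b • genRep n (E a b) := by
      simp only [genRep_E]
      rfl
    rw [this]
    simp only [LinearMap.sum_apply, LinearMap.smul_apply]
  rw [hg, smul_sum]
  refine sum_mem fun a _ => ?_
  rw [smul_sum]
  refine sum_mem fun b _ => ?_
  rw [smul_comm, complex_smul_eq]
  refine smul_mem_smoothVec (algebraMap_complex_mem _) ?_
  rw [isGenericAction_genRep n a b z, smul_sum]
  refine sum_mem fun σ hσ => ?_
  rw [smul_smul]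
  exact smul_mem_smoothVec (P_sym_mul_eCoef_mem hv a b hσ z) (genT_mem_smoothVec _)

end SingularPairs

end GT

namespace GT

namespace SingularPairs

variable {n t : ℕ} {v : Tab n ℂ} (S : SingularPairs n t)

/-! ### The maps `D_I` on smooth vectors -/

theorem single_mem_smoothVec (z : Shift n) {f : RatFun n} (hf : f ∈ smooth v) :
    (Finsupp.single z f : GenSpace n) ∈ smoothVec v := fun y => by
  classical
  rw [Finsupp.single_apply]
  split_ifs
  · exact hf
  · exact zero_mem _

theorem smoothVec_induction {Q : GenSpace n → Prop} (zero : Q 0)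
    (add : ∀ F ∈ smoothVec v, ∀ G ∈ smoothVec v, Q F → Q G → Q (F + G))
    (single : ∀ z, ∀ f ∈ smooth v, Q (Finsupp.single z f)) {F : GenSpace n}
    (hF : F ∈ smoothVec v) : Q F := by
  have h : ∀ s : Finset (Shift n), Q (∑ z ∈ s, Finsupp.single z (F z)) := by
    intro s
    classical
    induction s using Finset.induction_on with
    | empty => rwa [sum_empty]
    | insert z s hz ih =>
      rw [sum_insert hz]
      exact add _ (single_mem_smoothVec z (hF z)) _
        (sum_mem fun y _ => single_mem_smoothVec y (hF y)) (single z _ (hF z)) ih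
  rw [← Finsupp.sum_single F]
  exact h _

theorem dVec_single (I : Finset (Fin t)) (z : Shift n) (f : RatFun n) :
    S.dVec v I (Finsupp.single z f) = ∑ J ∈ I.powerset, S.dVal v (I \ J) f • S.DT J z :=
  Finsupp.sum_single_index (by simp only [dVal_zero, zero_smul, sum_const_zero])

theorem dVec_zero (I : Finset (Fin t)) : S.dVec v I 0 = 0 := Finsupp.sum_zero_index

theorem dVec_add (I : Finset (Fin t)) {F G : GenSpace n} (hF : F ∈ smoothVec v)
    (hG : G ∈ smoothVec v) : S.dVec v I (F + G) = S.dVec v I F + S.dVec v I G := by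
  classical
  have h0 : ∀ z ∈ F.support ∪ G.support,
      ∑ J ∈ I.powerset, S.dVal v (I \ J) 0 • S.DT J z = 0 := fun z _ => by
    simp only [dVal_zero, zero_smul, sum_const_zero]
  rw [dVec, dVec, dVec, Finsupp.sum_of_support_subset _ Finsupp.support_add _ h0,
    Finsupp.sum_of_support_subset _ subset_union_left _ h0,
    Finsupp.sum_of_support_subset _ subset_union_right _ h0, ← sum_add_distrib]
  refine sum_congr rfl fun z _ => ?_
  rw [← sum_add_distrib]
  refine sum_congr rfl fun J _ => ?_
  rw [Finsupp.add_apply, dVal_add _ _ (hF z) (hG z), add_smul]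

theorem dVec_sum {ι : Type*} (I : Finset (Fin t)) (s : Finset ι) {F : ι → GenSpace n}
    (hF : ∀ i ∈ s, F i ∈ smoothVec v) : S.dVec v I (∑ i ∈ s, F i) = ∑ i ∈ s, S.dVec v I (F i) := by
  classical
  induction s using Finset.induction_on with
  | empty => rw [sum_empty, sum_empty, dVec_zero]
  | insert i s hi ih =>
    rw [sum_insert hi, sum_insert hi, dVec_add _ _ (hF i (mem_insert_self _ _))
      (sum_mem fun j hj => hF j (mem_insert_of_mem hj)), ih fun j hj => hF j (mem_insert_of_mem hj)]

theorem smul_single' (f h : RatFun n) (z : Shift n) :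
    f • (Finsupp.single z h : GenSpace n) = Finsupp.single z (f * h) :=
  Finsupp.smul_single _ _ _

/-- The Leibniz rule. -/
theorem dVec_smul (I : Finset (Fin t)) {f : RatFun n} (hf : f ∈ smooth v) {F : GenSpace n}
    (hF : F ∈ smoothVec v) :
    S.dVec v I (f • F) = ∑ J ∈ I.powerset, S.dVal v J f • S.dVec v (I \ J) F := by
  refine smoothVec_induction (Q := fun F => S.dVec v I (f • F) =
    ∑ J ∈ I.powerset, S.dVal v J f • S.dVec v (I \ J) F) ?_ ?_ ?_ hF
  · simp only [smul_zero, dVec_zero, sum_const_zero]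
  · intro F hF G hG h1 h2
    rw [smul_add, dVec_add _ _ (smul_mem_smoothVec hf hF) (smul_mem_smoothVec hf hG), h1, h2,
      ← sum_add_distrib]
    refine sum_congr rfl fun J _ => ?_
    rw [dVec_add _ _ hF hG, smul_add]
  · intro z h hh
    rw [smul_single', dVec_single]
    simp only [dVec_single, smul_sum, smul_smul, dVal_mul _ _ hf hh, sum_smul]
    rw [sum_comm' (t' := I.powerset) (s' := fun J => (I \ J).powerset)]
    · refine sum_congr rfl fun J _ => sum_congr rfl fun K _ => ?_
      rw [sdiff_right_comm]
    · intro K J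
      simp only [mem_powerset, subset_sdiff]
      constructor
      · rintro ⟨h1, h2, h3⟩
        exact ⟨⟨h1, h3.symm⟩, h2⟩
      · rintro ⟨⟨h1, h2⟩, h3⟩
        exact ⟨h1, h3, h2.symm⟩

theorem dVal_complex_nonempty {I : Finset (Fin t)} (hI : I ≠ ∅) (c : ℂ) :
    S.dVal v I (algebraMap ℂ (RatFun n) c) = 0 := by
  have h := S.dVal_complex_mul I c (one_mem (smooth v))
  rwa [mul_one, dVal_one _ (nonempty_iff_ne_empty.mpr hI), mul_zero] at h

theorem dVec_complex_smul (I : Finset (Fin t)) (c : ℂ) {F : GenSpace n} (hF : F ∈ smoothVec v) :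
    S.dVec v I (algebraMap ℂ (RatFun n) c • F) = c • S.dVec v I F := by
  rw [dVec_smul _ _ (algebraMap_complex_mem c) hF,
    sum_eq_single_of_mem ∅ (empty_mem_powerset I) fun J _ hJ => by
      rw [dVal_complex_nonempty _ hJ, zero_smul], dVal_empty, evalAt_complex, sdiff_empty]

theorem dVec_neg (I : Finset (Fin t)) {F : GenSpace n} (hF : F ∈ smoothVec v) :
    S.dVec v I (-F) = -S.dVec v I F := by
  have h := S.dVec_add I hF (neg_mem hF)
  rw [add_neg_cancel, dVec_zero] at h
  exact (neg_eq_of_add_eq_zero_right h.symm).symm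

theorem dVec_sub (I : Finset (Fin t)) {F G : GenSpace n} (hF : F ∈ smoothVec v)
    (hG : G ∈ smoothVec v) : S.dVec v I (F - G) = S.dVec v I F - S.dVec v I G := by
  rw [sub_eq_add_neg, dVec_add _ _ hF (neg_mem hG), dVec_neg _ _ hG, sub_eq_add_neg]

theorem dVec_genT (I : Finset (Fin t)) (z : Shift n) : S.dVec v I (genT z) = S.DT I z := by
  rw [genT, dVec_single, sum_eq_single_of_mem I (mem_powerset_self I), sdiff_self,
    Finset.bot_eq_empty, dVal_empty, evalAt_one, one_smul]
  intro J hJ hne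
  rw [dVal_one, zero_smul]
  rw [sdiff_nonempty]
  exact fun h => hne (Subset.antisymm (mem_powerset.mp hJ) h)

/-- In the Leibniz rule only the splitting that spends exactly the derivative `r` on the gap
survives at `v`. -/
theorem dVec_gap_smul (hv : S.IsCritical v) (r : Fin t) (I : Finset (Fin t)) {F : GenSpace n}
    (hF : F ∈ smoothVec v) :
    S.dVec v I (S.gap r • F) = if r ∈ I then S.dVec v (I.erase r) F else 0 := by
  rw [dVec_smul _ _ (S.gap_mem r) hF]
  simp only [dVal_gap _ hv, ite_smul, one_smul, zero_smul, sum_ite_eq', mem_powerset,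
    singleton_subset_iff, sdiff_singleton_eq_erase]

/-- Multiplication by gaps uses up the corresponding derivatives. Consequently every `D_I` is `D_R`
of a multiple by the complementary product, and it suffices to study `D_R`. -/
theorem dVec_P_smul (hv : S.IsCritical v) (Δ I : Finset (Fin t)) {F : GenSpace n}
    (hF : F ∈ smoothVec v) :
    S.dVec v I (S.P Δ • F) = if Δ ⊆ I then S.dVec v (I \ Δ) F else 0 := by
  induction Δ using Finset.induction_on generalizing I with
  | empty => rw [P_eq, prod_empty, one_smul, if_pos (empty_subset _), sdiff_empty]
  | insert r Δ hr ih =>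
    have h1 : S.P (insert r Δ) • F = S.gap r • (S.P Δ • F) := by
      rw [smul_smul, P_eq, prod_insert hr, P_eq]
    rw [h1, dVec_gap_smul _ hv _ _ (smul_mem_smoothVec (S.P_mem Δ) hF), ih]
    by_cases hI : r ∈ I
    · rw [if_pos hI]
      have h2 : Δ ⊆ I.erase r ↔ insert r Δ ⊆ I := by
        rw [subset_erase, insert_subset_iff, and_comm, and_congr_left_iff]
        exact fun _ => iff_of_true hr hI
      simp only [h2, sdiff_insert, erase_sdiff_comm]
    · rw [if_neg hI, if_neg fun h => hI (h (mem_insert_self _ _))]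

/-! ### Symmetries of the smooth vectors -/

theorem DT_tau (I : Finset (Fin t)) (r : Fin t) (z : Shift n) :
    S.DT I (permShift (S.tau r) z) = (if r ∈ I then (-1 : ℂ) else 1) • S.DT I z := by
  have h : (Submodule.Quotient.mk (Finsupp.single (I, permShift (S.tau r) z) 1 -
      (if r ∈ I then (-1 : ℂ) else 1) • Finsupp.single (I, z) 1) : S.DSpace) = 0 :=
    (Submodule.Quotient.mk_eq_zero _).mpr (Submodule.subset_span ⟨I, r, z, rfl⟩)
  rw [Submodule.Quotient.mk_sub, sub_eq_zero] at h
  exact h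

/-- The semilinear map `f(x) T(x + z) ↦ f(τ_r(x)) T(x + τ_r(z))`. -/
def flipVec (r : Fin t) : GenSpace n →+ GenSpace n :=
  twist (S.flip r) (permShiftEquiv (S.tau r))

theorem flipVec_single (r : Fin t) (z : Shift n) (f : RatFun n) :
    S.flipVec r (Finsupp.single z f) = Finsupp.single (permShift (S.tau r) z) (S.flip r f) :=
  twist_single z f

theorem flipVec_genT (r : Fin t) (z : Shift n) :
    S.flipVec r (genT z) = genT (permShift (S.tau r) z) := by
  rw [genT, flipVec_single, map_one, genT]

theorem flipVec_smul (r : Fin t) (f : RatFun n) (F : GenSpace n) :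
    S.flipVec r (f • F) = S.flip r f • S.flipVec r F := twist_smul f F

theorem flip_mem (hv : S.IsCritical v) (r : Fin t) {f : RatFun n} (hf : f ∈ smooth v) :
    S.flip r f ∈ smooth v := interchange_mem (hv.1 r) hf

theorem flipVec_mem (hv : S.IsCritical v) (r : Fin t) {F : GenSpace n} (hF : F ∈ smoothVec v) :
    S.flipVec r F ∈ smoothVec v := fun z => by
  rw [flipVec, twist_apply']
  exact S.flip_mem hv r (hF _)

theorem flipVec_genRep (r : Fin t) (g : gl n) (F : GenSpace n) :
    S.flipVec r (genRep n g F) = genRep n g (S.flipVec r F) :=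
  twist_genRep (S.isSymmetry_flip r) g F

theorem flipVec_act (r : Fin t) {u : U n} (hu : u ∈ Usub n n) (F : GenSpace n) :
    S.flipVec r (act n u F) = act n u (S.flipVec r F) :=
  twist_act (S.isSymmetry_flip r) hu F

/-- In the term indexed by `J ⊆ I`, the derivative of the coefficient contributes a sign if `r ∈ I \
J` and the tableau contributes one if `r ∈ J`. At most one of the two occurs, and one does exactly
when `r ∈ I`. -/
theorem dVec_flipVec (hv : S.IsCritical v) (r : Fin t) (I : Finset (Fin t)) {F : GenSpace n}
    (hF : F ∈ smoothVec v) :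
    S.dVec v I (S.flipVec r F) = (if r ∈ I then (-1 : ℂ) else 1) • S.dVec v I F := by
  refine smoothVec_induction (Q := fun F => S.dVec v I (S.flipVec r F) =
    (if r ∈ I then (-1 : ℂ) else 1) • S.dVec v I F) ?_ ?_ ?_ hF
  · rw [map_zero, dVec_zero, smul_zero]
  · intro F hF G hG h1 h2
    rw [map_add, dVec_add _ _ (S.flipVec_mem hv r hF) (S.flipVec_mem hv r hG), h1, h2,
      dVec_add _ _ hF hG, smul_add]
  · intro z f hf
    rw [flipVec_single, dVec_single, dVec_single, smul_sum]
    refine sum_congr rfl fun J hJ => ?_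
    rw [DT_tau, dVal_flip _ hv _ _ hf, smul_smul, smul_smul]
    congr 1
    have hJ' : r ∈ J → r ∈ I := fun h => mem_powerset.mp hJ h
    by_cases h1 : r ∈ J
    · simp [h1, hJ' h1]
    · by_cases h2 : r ∈ I <;> simp [h1, h2]

theorem flip_flip (r : Fin t) (f : RatFun n) : S.flip r (S.flip r f) = f := by
  obtain ⟨a, b, hb, rfl⟩ := exists_div f
  have h : ∀ a : Poly n, interchange (S.left r) (S.right r)
      (interchange (S.left r) (S.right r) a) = a := fun a => by
    rw [interchange_apply, interchange_apply, MvPolynomial.rename_rename]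
    convert MvPolynomial.rename_id_apply a
    ext1 p
    exact Equiv.swap_apply_self _ _ p
  rw [flip, fracMap_div, fracMap_div, h, h]

theorem swap_swap_comm {r s : Fin t} (h : r ≠ s) (p : Idx n) :
    Equiv.swap (S.left r) (S.right r) (Equiv.swap (S.left s) (S.right s) p) =
      Equiv.swap (S.left s) (S.right s) (Equiv.swap (S.left r) (S.right r) p) := by
  have h1 : (Equiv.swap (S.left r) (S.right r)).Disjoint (Equiv.swap (S.left s) (S.right s)) := by
    intro p
    by_cases hl : p = S.left r
    · right
      rw [hl]
      exact Equiv.swap_apply_of_ne_of_ne (S.left_ne_left h) (S.left_ne_right_of_ne h)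
    by_cases hr : p = S.right r
    · right
      rw [hr]
      exact Equiv.swap_apply_of_ne_of_ne (S.right_ne_left_of_ne h) (S.right_ne_right h)
    · exact Or.inl (Equiv.swap_apply_of_ne_of_ne hl hr)
  exact congrArg (fun e : Equiv.Perm (Idx n) => e p) h1.commute.eq

theorem flip_comm (r s : Fin t) (f : RatFun n) :
    S.flip r (S.flip s f) = S.flip s (S.flip r f) := by
  by_cases hrs : r = s
  · rw [hrs]
  obtain ⟨a, b, hb, rfl⟩ := exists_div f
  have h : ∀ a : Poly n, interchange (S.left r) (S.right r)
      (interchange (S.left s) (S.right s) a) = interchange (S.left s) (S.right s)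
      (interchange (S.left r) (S.right r) a) := fun a => by
    rw [interchange_apply, interchange_apply, interchange_apply, interchange_apply,
      MvPolynomial.rename_rename, MvPolynomial.rename_rename]
    congr 2
    ext1 p
    exact S.swap_swap_comm hrs p
  rw [flip, flip, fracMap_div, fracMap_div, fracMap_div, fracMap_div, h, h]

theorem permShift_tau_tau (r : Fin t) (z : Shift n) :
    permShift (S.tau r) (permShift (S.tau r) z) = z :=
  Subtype.ext (funext fun p => by
    rw [permShift_tau_apply, permShift_tau_apply, Equiv.swap_apply_self])

theorem permShift_tau_comm (r s : Fin t) (z : Shift n) :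
    permShift (S.tau r) (permShift (S.tau s) z) = permShift (S.tau s) (permShift (S.tau r) z) := by
  by_cases hrs : r = s
  · rw [hrs]
  refine Subtype.ext (funext fun p => ?_)
  rw [permShift_tau_apply, permShift_tau_apply, permShift_tau_apply, permShift_tau_apply,
    S.swap_swap_comm hrs]

theorem flipVec_flipVec (r : Fin t) (F : GenSpace n) : S.flipVec r (S.flipVec r F) = F := by
  induction F using Finsupp.induction_linear with
  | zero => rw [map_zero, map_zero]
  | add F G hF hG => rw [map_add, map_add, hF, hG]
  | single z f => rw [flipVec_single, flipVec_single, flip_flip, permShift_tau_tau]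

theorem flipVec_comm (r s : Fin t) (F : GenSpace n) :
    S.flipVec r (S.flipVec s F) = S.flipVec s (S.flipVec r F) := by
  induction F using Finsupp.induction_linear with
  | zero => simp only [map_zero]
  | add F G hF hG => rw [map_add, map_add, hF, hG, map_add, map_add]
  | single z f =>
    rw [flipVec_single, flipVec_single, flipVec_single, flipVec_single, flip_comm,
      permShift_tau_comm]

end SingularPairs

end GT

namespace GT

namespace SingularPairs

variable {n t : ℕ} {v : Tab n ℂ} (S : SingularPairs n t)

theorem sym_tau (r : Fin t) (z : Shift n) : S.sym (permShift (S.tau r) z) = S.sym z := by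
  ext s
  rw [mem_sym, mem_sym, permShift_tau_apply, permShift_tau_apply]
  by_cases hrs : s = r
  · rw [hrs, Equiv.swap_apply_left, Equiv.swap_apply_right]
    exact eq_comm
  · rw [Equiv.swap_apply_of_ne_of_ne (S.left_ne_left hrs) (S.left_ne_right_of_ne hrs),
      Equiv.swap_apply_of_ne_of_ne (S.right_ne_left_of_ne hrs) (S.right_ne_right hrs)]

theorem permShift_tau_of_mem_sym {r : Fin t} {z : Shift n} (h : r ∈ S.sym z) :
    permShift (S.tau r) z = z := by
  rw [mem_sym] at h
  refine Subtype.ext (funext fun p => ?_)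
  rw [permShift_tau_apply]
  by_cases hl : p = S.left r
  · rw [hl, Equiv.swap_apply_left, h]
  by_cases hr : p = S.right r
  · rw [hr, Equiv.swap_apply_right, h]
  · rw [Equiv.swap_apply_of_ne_of_ne hl hr]

theorem eq_zero_of_eq_neg {M : Type*} [AddCommGroup M] [Module ℂ M] {x : M} (h : x = -x) :
    x = 0 := by
  have h2 : (2 : ℂ) • x = 0 := by
    rw [two_smul]
    nth_rewrite 1 [h]
    exact neg_add_cancel x
  exact (smul_eq_zero.mp h2).resolve_left two_ne_zero

/-! ### The action on the derivative tableaux -/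

theorem P_union {Δ Δ' : Finset (Fin t)} (h : Disjoint Δ Δ') :
    S.P (Δ ∪ Δ') = S.P Δ * S.P Δ' := prod_union h

theorem P_smul_genRep_mem (hv : S.IsCritical v) (g : gl n) {I : Finset (Fin t)} {z : Shift n}
    (h : Disjoint I (S.sym z)) : S.P (univ \ I) • genRep n g (genT z) ∈ smoothVec v := by
  have h1 : univ \ I = ((univ \ I) \ S.sym z) ∪ S.sym z := by
    refine (sdiff_union_of_subset fun r hr => ?_).symm
    exact mem_sdiff.mpr ⟨mem_univ r, fun hI => disjoint_left.mp h hI hr⟩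
  rw [h1, P_union _ sdiff_disjoint, mul_smul]
  exact smul_mem_smoothVec (S.P_mem _) (P_sym_smul_genRep_mem hv g z)

open Classical in
/-- The value of `g · D_I T(v + z)`. -/
def dRepBasis (v : Tab n ℂ) (g : gl n) (x : Finset (Fin t) × Shift n) : S.DSpace :=
  -- If `z` is symmetric at some pair of `I`, the defining relations force `D_I T(v + z) = 0`,
  -- whence the default value `0`.
  if Disjoint x.1 (S.sym x.2) then
    S.dVec v univ (S.P (univ \ x.1) • genRep n g (genT x.2)) else 0

/-- This is what makes the operator descend to the quotient. The flip changes the sign of the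
product of gaps when `r ∉ I`, and `D_R` always contributes `-1`; the two together give the sign of
the relation. -/
theorem dRepBasis_tau (hv : S.IsCritical v) (g : gl n) (I : Finset (Fin t)) (r : Fin t)
    (z : Shift n) : S.dRepBasis v g (I, permShift (S.tau r) z) =
      (if r ∈ I then (-1 : ℂ) else 1) • S.dRepBasis v g (I, z) := by
  unfold dRepBasis
  simp only [sym_tau]
  by_cases h : Disjoint I (S.sym z)
  · rw [if_pos h, if_pos h]
    have h1 : S.P (univ \ I) • genRep n g (genT (permShift (S.tau r) z)) =
        S.flipVec r ((if r ∈ univ \ I then (-1 : RatFun n) else 1) •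
          S.P (univ \ I) • genRep n g (genT z)) := by
      have h2 : S.flip r (if r ∈ univ \ I then (-1 : RatFun n) else 1) =
          if r ∈ univ \ I then -1 else 1 := by
        split_ifs
        · rw [map_neg, map_one]
        · rw [map_one]
      rw [flipVec_smul, flipVec_smul, flip_P, flipVec_genRep, flipVec_genT, h2, smul_smul,
        ← mul_assoc]
      split_ifs
      · rw [neg_mul_neg, one_mul, one_mul]
      · rw [one_mul, one_mul]
    rw [h1]
    by_cases hr : r ∈ I
    · rw [if_neg fun h => (mem_sdiff.mp h).2 hr, if_pos hr, one_smul,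
        dVec_flipVec _ hv _ _ (S.P_smul_genRep_mem hv g h), if_pos (mem_univ r)]
    · rw [if_pos (mem_sdiff.mpr ⟨mem_univ r, hr⟩), if_neg hr, neg_one_smul,
        dVec_flipVec _ hv _ _ (neg_mem (S.P_smul_genRep_mem hv g h)), if_pos (mem_univ r),
        dVec_neg _ _ (S.P_smul_genRep_mem hv g h), smul_neg, neg_one_smul, neg_neg, one_smul]
  · rw [if_neg h, if_neg h, smul_zero]

/-- The operator of `g` on the space of derivative tableaux. -/
def dRep (hv : S.IsCritical v) (g : gl n) : Module.End ℂ S.DSpace :=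
  Submodule.liftQ _ (Finsupp.linearCombination ℂ (S.dRepBasis v g)) (by
    rw [Submodule.span_le]
    rintro f ⟨I, r, z, rfl⟩
    change Finsupp.linearCombination ℂ (S.dRepBasis v g) _ = 0
    rw [map_sub, map_smul, Finsupp.linearCombination_single, Finsupp.linearCombination_single,
      one_smul, one_smul, dRepBasis_tau _ hv, sub_self])

theorem dRep_DT_eq_basis (hv : S.IsCritical v) (g : gl n) (I : Finset (Fin t)) (z : Shift n) :
    S.dRep hv g (S.DT I z) = S.dRepBasis v g (I, z) := by
  change Finsupp.linearCombination ℂ (S.dRepBasis v g) (Finsupp.single (I, z) 1) = _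
  rw [Finsupp.linearCombination_single, one_smul]

theorem dRep_DT (hv : S.IsCritical v) (g : gl n) {I : Finset (Fin t)} {z : Shift n}
    (h : Disjoint I (S.sym z)) :
    S.dRep hv g (S.DT I z) = S.dVec v univ (S.P (univ \ I) • genRep n g (genT z)) := by
  rw [dRep_DT_eq_basis, dRepBasis, if_pos h]

theorem dSpace_ext {M : Type*} [AddCommGroup M] [Module ℂ M] {A B : S.DSpace →ₗ[ℂ] M}
    (h : ∀ I z, A (S.DT I z) = B (S.DT I z)) : A = B := by
  refine Submodule.linearMap_qext _ (Finsupp.lhom_ext' fun x => LinearMap.ext_ring ?_)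
  exact h x.1 x.2

/-- The action of `g` commutes with `D_I` on `P T(x + z)`, for `P` the product over all singular
pairs at which `z` is symmetric. -/
theorem dVec_P_sym_genRep (hv : S.IsCritical v) (g : gl n) (I : Finset (Fin t)) (z : Shift n) :
    S.dVec v I (S.P (S.sym z) • genRep n g (genT z)) =
      S.dRep hv g (S.dVec v I (S.P (S.sym z) • genT z)) := by
  have hG := P_sym_smul_genRep_mem hv g z
  rw [dVec_P_smul _ hv _ _ (genT_mem_smoothVec z)]
  by_cases h : S.sym z ⊆ I
  · rw [if_pos h, dVec_genT, S.dRep_DT hv g sdiff_disjoint]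
    have h1 : univ \ (I \ S.sym z) = (univ \ I) ∪ S.sym z := by
      ext r
      simp only [mem_sdiff, mem_univ, true_and, mem_union]
      tauto
    have h2 : Disjoint (univ \ I) (S.sym z) :=
      disjoint_left.mpr fun r hr hs => (mem_sdiff.mp hr).2 (h hs)
    rw [h1, P_union _ h2, mul_smul, dVec_P_smul _ hv _ _ hG, if_pos (subset_univ _),
      Finset.sdiff_sdiff_eq_self (subset_univ I)]
  · rw [if_neg h, map_zero]
    -- For a symmetric pair `r` outside `I` the vector is antisymmetric under the flip, whereas
    -- `D_I` is invariant under it. The value is therefore its own negative.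
    obtain ⟨r, hr, hI⟩ := not_subset.mp h
    have h1 := S.dVec_flipVec hv r I hG
    rw [if_neg hI, one_smul, flipVec_smul, flip_P, if_pos hr, flipVec_genRep, flipVec_genT,
      S.permShift_tau_of_mem_sym hr, neg_one_mul, neg_smul, dVec_neg _ _ hG] at h1
    exact eq_zero_of_eq_neg h1.symm

theorem dRep_dVec_smul (hv : S.IsCritical v) (g : gl n) (I : Finset (Fin t)) (z : Shift n)
    {f : RatFun n} (hf : f ∈ smooth v) :
    S.dRep hv g (S.dVec v I (f • S.P (S.sym z) • genT z)) =
      S.dVec v I (f • S.P (S.sym z) • genRep n g (genT z)) := by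
  rw [dVec_smul _ _ hf (smul_mem_smoothVec (S.P_mem _) (genT_mem_smoothVec z)),
    dVec_smul _ _ hf (P_sym_smul_genRep_mem hv g z), map_sum]
  refine sum_congr rfl fun J _ => ?_
  rw [map_smul, dVec_P_sym_genRep]

/-! ### Antisymmetric vectors -/

/-- The smooth vectors that are antisymmetric at all singular pairs. -/
def antiVec (v : Tab n ℂ) : AddSubgroup (GenSpace n) where
  carrier := {F | F ∈ smoothVec v ∧ ∀ r, S.flipVec r F = -F}
  zero_mem' := ⟨zero_mem _, fun r => by rw [map_zero, neg_zero]⟩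
  add_mem' := fun hF hG => ⟨add_mem hF.1 hG.1, fun r => by
    rw [map_add, hF.2, hG.2, neg_add]⟩
  neg_mem' := fun hF => ⟨neg_mem hF.1, fun r => by rw [map_neg, hF.2]⟩

/-- An antisymmetric function is half of its difference with its flip, hence a multiple of the gap
with smooth cofactor. The other flips fix this gap, so the cofactor remains antisymmetric at the
other pairs and the division can be repeated. -/
theorem exists_eq_P_mul (hv : S.IsCritical v) (Δ : Finset (Fin t)) {f : RatFun n}
    (hf : f ∈ smooth v) (h : ∀ r ∈ Δ, S.flip r f = -f) : ∃ g ∈ smooth v, f = S.P Δ * g := by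
  induction Δ using Finset.induction_on generalizing f with
  | empty => exact ⟨f, hf, by rw [P_eq, prod_empty, one_mul]⟩
  | insert r Δ hr ih =>
    obtain ⟨g, hg, hfg⟩ := exists_sub_interchange_eq (hv.1 r) hf
    have h1 : f = S.gap r * (g / 2) := by
      have h2 : f - S.flip r f = S.gap r * g := hfg
      rw [h r (mem_insert_self _ _), sub_neg_eq_add, ← two_mul] at h2
      rw [← mul_div_assoc, ← h2, mul_div_cancel_left₀ _ (two_ne_zero' (RatFun n))]
    have h3 : ∀ s ∈ Δ, S.flip s (g / 2) = -(g / 2) := fun s hs => by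
      have h4 := h s (mem_insert_of_mem hs)
      have hrs : r ≠ s := fun e => hr (e ▸ hs)
      rw [h1, map_mul, S.flip_gap_of_ne hrs] at h4
      refine mul_left_cancel₀ (S.gap_ne_zero r) (h4.trans ?_)
      exact (mul_neg _ _).symm
    obtain ⟨g', hg', h5⟩ := ih (div_two_mem hg) h3
    refine ⟨g', hg', ?_⟩
    rw [h1, h5, P_eq, P_eq, prod_insert hr, mul_assoc]

/-- At a pair where `z` is symmetric, `τ_r` fixes `z`. Antisymmetry of the vector then becomes
antisymmetry of the single coefficient at `z`. -/
theorem exists_antiVec_apply_eq (hv : S.IsCritical v) {F : GenSpace n} (hF : F ∈ S.antiVec v)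
    (z : Shift n) : ∃ f ∈ smooth v, F z = f * S.P (S.sym z) := by
  obtain ⟨f, hf, h⟩ := S.exists_eq_P_mul hv (S.sym z) (hF.1 z) fun r hr => by
    have h1 : S.flipVec r F (permShift (S.tau r) z) = S.flip r (F z) := twist_apply F z
    rw [← h1, hF.2, S.permShift_tau_of_mem_sym hr, Finsupp.neg_apply]
  exact ⟨f, hf, by rw [h, mul_comm]⟩

/-- The factor `P (sym z)` in the coefficient at `z` cancels the poles of `g T(x + z)`, so
smoothness persists; antisymmetry persists because the flips commute with the action. This allows
the action to be iterated before `D_I` is taken. -/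
theorem genRep_antiVec (hv : S.IsCritical v) (g : gl n) {F : GenSpace n} (hF : F ∈ S.antiVec v) :
    genRep n g F ∈ S.antiVec v ∧ ∀ I, S.dRep hv g (S.dVec v I F) = S.dVec v I (genRep n g F) := by
  choose f hf hFf using S.exists_antiVec_apply_eq hv hF
  have h1 : F = ∑ z ∈ F.support, f z • S.P (S.sym z) • genT z := by
    conv_lhs => rw [← Finsupp.sum_single F]
    refine sum_congr rfl fun z _ => ?_
    rw [smul_smul, ← hFf, genT, smul_single', mul_one]
  have h2 : genRep n g F =
      ∑ z ∈ F.support, f z • S.P (S.sym z) • genRep n g (genT z) := by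
    conv_lhs => rw [h1]
    simp only [map_sum, map_smul]
  have h3 : ∀ z ∈ F.support, f z • S.P (S.sym z) • genRep n g (genT z) ∈ smoothVec v :=
    fun z _ => smul_mem_smoothVec (hf z) (P_sym_smul_genRep_mem hv g z)
  refine ⟨⟨?_, fun r => ?_⟩, fun I => ?_⟩
  · rw [h2]
    exact sum_mem h3
  · rw [flipVec_genRep, hF.2, map_neg]
  · rw [h2, dVec_sum _ _ _ h3]
    conv_lhs => rw [h1]
    rw [dVec_sum _ _ _ fun z _ => smul_mem_smoothVec (hf z)
      (smul_mem_smoothVec (S.P_mem _) (genT_mem_smoothVec z)), map_sum]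
    exact sum_congr rfl fun z _ => S.dRep_dVec_smul hv g I z (hf z)

theorem flip_complex (r : Fin t) (c : ℂ) :
    S.flip r (algebraMap ℂ (RatFun n) c) = algebraMap ℂ (RatFun n) c := fracMap_complex _ c

/-- There is an antisymmetrization that commutes with the action and with `D_R`. -/
theorem exists_antisymmetrization (hv : S.IsCritical v) (Δ : Finset (Fin t)) :
    ∃ A : GenSpace n → GenSpace n,
      (∀ F ∈ smoothVec v, A F ∈ smoothVec v ∧ S.dVec v univ (A F) = S.dVec v univ F) ∧
      (∀ u ∈ Usub n n, ∀ F, A (act n u F) = act n u (A F)) ∧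
      ∀ r ∈ Δ, ∀ F, S.flipVec r (A F) = -A F := by
  induction Δ using Finset.induction_on with
  | empty => exact ⟨id, fun F hF => ⟨hF, rfl⟩, fun _ _ _ => rfl, fun r hr => by simp at hr⟩
  | insert r Δ hr ih =>
    obtain ⟨A, h1, h2, h3⟩ := ih
    -- Since `D_R` changes sign under every flip, averaging a vector with the negative of its flip
    -- leaves `D_R` unchanged. The flips commute, so antisymmetry at the earlier pairs is kept.
    refine ⟨fun F => algebraMap ℂ (RatFun n) 2⁻¹ • (A F - S.flipVec r (A F)), fun F hF => ?_,
      fun u hu F => ?_, fun s hs F => ?_⟩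
    · obtain ⟨hA, hD⟩ := h1 F hF
      have hA' := S.flipVec_mem hv r hA
      refine ⟨smul_mem_smoothVec (algebraMap_complex_mem _) (sub_mem hA hA'), ?_⟩
      rw [dVec_complex_smul _ _ _ (sub_mem hA hA'), dVec_sub _ _ hA hA', dVec_flipVec _ hv _ _ hA,
        if_pos (mem_univ r), neg_one_smul, sub_neg_eq_add, ← two_smul ℂ, smul_smul,
        inv_mul_cancel₀ two_ne_zero, one_smul, hD]
    · beta_reduce
      rw [h2 u hu, flipVec_act _ _ hu, ← map_sub, ← map_smul]
    · have h4 : S.flipVec s (A F - S.flipVec r (A F)) = -(A F - S.flipVec r (A F)) := by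
        rcases mem_insert.mp hs with rfl | hs
        · rw [map_sub, flipVec_flipVec, neg_sub]
        · rw [map_sub, flipVec_comm, h3 s hs, map_neg, neg_sub, sub_neg_eq_add, neg_add_eq_sub]
      beta_reduce
      rw [flipVec_smul, flip_complex, h4]
      exact smul_neg _ _

/-- The vector is the antisymmetrization of `P_{Σ∖I} T(x + z)`. Thus antisymmetric vectors reach all
generators of `V(T(v))`, and operators there may be compared on their images. -/
theorem exists_antiVec (hv : S.IsCritical v) (I : Finset (Fin t)) (z : Shift n) :
    ∃ F ∈ S.antiVec v, S.dVec v univ F = S.DT I z := by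
  obtain ⟨A, h1, -, h3⟩ := S.exists_antisymmetrization hv univ
  have hF : S.P (univ \ I) • genT z ∈ smoothVec v :=
    smul_mem_smoothVec (S.P_mem _) (genT_mem_smoothVec z)
  refine ⟨A (S.P (univ \ I) • genT z), ⟨(h1 _ hF).1, fun r => h3 r (mem_univ r) _⟩, ?_⟩
  rw [(h1 _ hF).2, dVec_P_smul _ hv _ _ (genT_mem_smoothVec z), if_pos (subset_univ _),
    Finset.sdiff_sdiff_eq_self (subset_univ I), dVec_genT]

theorem dRep_ext (hv : S.IsCritical v) {A B : Module.End ℂ S.DSpace}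
    (h : ∀ F ∈ S.antiVec v, A (S.dVec v univ F) = B (S.dVec v univ F)) : A = B :=
  S.dSpace_ext fun I z => by
    obtain ⟨F, hF, h1⟩ := S.exists_antiVec hv I z
    rw [← h1, h F hF]

theorem dRep_dVec (hv : S.IsCritical v) (g : gl n) {F : GenSpace n} (hF : F ∈ S.antiVec v) :
    S.dRep hv g (S.dVec v univ F) = S.dVec v univ (genRep n g F) :=
  (S.genRep_antiVec hv g hF).2 univ

/-- The `gl(n)`-module of derivative tableaux. -/
def derRep (hv : S.IsCritical v) : gl n →ₗ⁅ℂ⁆ Module.End ℂ S.DSpace where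
  toFun := S.dRep hv
  map_add' g h := S.dRep_ext hv fun F hF => by
    rw [LinearMap.add_apply, dRep_dVec _ _ _ hF, dRep_dVec _ _ _ hF, dRep_dVec _ _ _ hF, map_add,
      LinearMap.add_apply, dVec_add _ _ (S.genRep_antiVec hv g hF).1.1
        (S.genRep_antiVec hv h hF).1.1]
  map_smul' c g := S.dRep_ext hv fun F hF => by
    rw [RingHom.id_apply, LinearMap.smul_apply, dRep_dVec _ _ _ hF, dRep_dVec _ _ _ hF, map_smul,
      LinearMap.smul_apply, complex_smul_eq, dVec_complex_smul _ _ _ (S.genRep_antiVec hv g hF).1.1]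
  map_lie' := fun {g h} => S.dRep_ext hv fun F hF => by
    have hg := (S.genRep_antiVec hv g hF).1
    have hh := (S.genRep_antiVec hv h hF).1
    have h1 : genRep n ⁅g, h⁆ F = genRep n g (genRep n h F) - genRep n h (genRep n g F) := by
      rw [LieHom.map_lie]
      rfl
    change _ = S.dRep hv g (S.dRep hv h _) - S.dRep hv h (S.dRep hv g _)
    rw [dRep_dVec _ _ _ hF, dRep_dVec _ _ _ hF, dRep_dVec _ _ _ hF,
      dRep_dVec _ _ _ hg, dRep_dVec _ _ _ hh, h1,
      dVec_sub _ _ (S.genRep_antiVec hv g hh).1.1 (S.genRep_antiVec hv h hg).1.1]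

end SingularPairs

end GT

/-! ### The Gelfand–Tsetlin subalgebra on derivative tableaux. -/

namespace GT

/-- Each application of the operator replaces the index set by strictly smaller ones, so it can be
applied at most `I.card` times before reaching zero. -/
theorem pow_apply_eq_zero {ι M : Type*} [DecidableEq ι] [AddCommGroup M] [Module ℂ M]
    {N : Module.End ℂ M} {a : Finset ι → ℂ} {d : Finset ι → M}
    (h : ∀ I, N (d I) = ∑ J ∈ I.powerset.erase ∅, a J • d (I \ J)) (m : ℕ) :
    ∀ I : Finset ι, I.card < m → (N ^ m) (d I) = 0 := by
  induction m with
  | zero => intro I hI; omega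
  | succ m ih =>
    intro I hI
    rw [pow_succ, Module.End.mul_apply, h, map_sum]
    refine sum_eq_zero fun J hJ => ?_
    rw [mem_erase, mem_powerset] at hJ
    have h1 := card_pos.mpr (nonempty_iff_ne_empty.mpr hJ.1)
    have h2 := card_sdiff_add_card_eq_card hJ.2
    rw [map_smul, ih _ (by omega), smul_zero]

namespace SingularPairs

variable {n t : ℕ} {v : Tab n ℂ} (S : SingularPairs n t)

theorem isDerivativeAction_derRep (hv : S.IsCritical v) :
    IsDerivativeAction S v (genRep n) (S.derRep hv) := by
  intro g I z h
  have h1 : Disjoint I (S.sym z) := disjoint_left.mpr fun r hr hs => h r hr (mem_sym.mp hs)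
  exact ⟨S.P_smul_genRep_mem hv g h1, S.dRep_DT hv g h1⟩

/-- The action of the enveloping algebra on the derivative tableaux. -/
def derAct (hv : S.IsCritical v) : U n →ₐ[ℂ] Module.End ℂ S.DSpace :=
  UniversalEnvelopingAlgebra.lift ℂ (S.derRep hv)

theorem derAct_ι (hv : S.IsCritical v) (g : gl n) :
    S.derAct hv (UniversalEnvelopingAlgebra.ι ℂ g) = S.dRep hv g :=
  UniversalEnvelopingAlgebra.lift_ι_apply ℂ _ g

theorem act_antiVec (hv : S.IsCritical v) {u : U n} (hu : u ∈ Usub n n) :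
    ∀ F ∈ S.antiVec v, act n u F ∈ S.antiVec v ∧
      S.derAct hv u (S.dVec v univ F) = S.dVec v univ (act n u F) := by
  refine usub_induction (P := fun u => ∀ F ∈ S.antiVec v, act n u F ∈ S.antiVec v ∧
      S.derAct hv u (S.dVec v univ F) = S.dVec v univ (act n u F)) ?_ ?_ ?_ ?_ hu
  · intro i j _ _ F hF
    rw [act_ι, derAct_ι]
    exact ⟨(S.genRep_antiVec hv _ hF).1, S.dRep_dVec hv _ hF⟩
  · intro c F hF
    rw [act_algebraMap_apply, dVec_complex_smul _ _ _ hF.1, AlgHom.commutes,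
      Module.algebraMap_end_apply]
    refine ⟨⟨smul_mem_smoothVec (algebraMap_complex_mem c) hF.1, fun r => ?_⟩, rfl⟩
    rw [flipVec_smul, flip_complex, hF.2]
    exact smul_neg _ _
  · intro x y hx hy F hF
    rw [map_add, map_add, LinearMap.add_apply, LinearMap.add_apply, (hx F hF).2, (hy F hF).2,
      dVec_add _ _ (hx F hF).1.1 (hy F hF).1.1]
    exact ⟨add_mem (hx F hF).1 (hy F hF).1, rfl⟩
  · intro x y hx hy F hF
    rw [map_mul, map_mul, Module.End.mul_apply, Module.End.mul_apply, (hy F hF).2]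
    exact hx _ (hy F hF).1

/-- Write `D_I T` as `D_R` of the antisymmetrization of `P_{Σ∖I} T(x + z)`, on which `u` commutes
with `D_R`. Antisymmetrization also commutes with `u`; smoothness of `u T(x + z)` permits removing
it again and turning `D_R` of the product with `P_{Σ∖I}` back into `D_I`. -/
theorem derAct_DT (hv : S.IsCritical v) {u : U n} (hu : u ∈ Usub n n) (I : Finset (Fin t))
    {z : Shift n} (hz : act n u (genT z) ∈ smoothVec v) :
    S.derAct hv u (S.DT I z) = S.dVec v I (act n u (genT z)) := by
  obtain ⟨A, h1, h2, h3⟩ := S.exists_antisymmetrization hv univ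
  have hP : ∀ F ∈ smoothVec v, S.dVec v univ (S.P (univ \ I) • F) = S.dVec v I F := fun F hF => by
    rw [dVec_P_smul _ hv _ _ hF, if_pos (subset_univ _), Finset.sdiff_sdiff_eq_self (subset_univ I)]
  have hF : S.P (univ \ I) • genT z ∈ smoothVec v :=
    smul_mem_smoothVec (S.P_mem _) (genT_mem_smoothVec z)
  rw [← dVec_genT, ← hP _ (genT_mem_smoothVec z), ← (h1 _ hF).2,
    (S.act_antiVec hv hu _ ⟨(h1 _ hF).1, fun r => h3 r (mem_univ r) _⟩).2, ← h2 u hu, map_smul,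
    (h1 _ (smul_mem_smoothVec (S.P_mem _) hz)).2, hP _ hz]

theorem act_GTSub_genT_mem (v : Tab n ℂ) {c : U n} (hc : c ∈ GTSub n) (z : Shift n) :
    act n c (genT z) ∈ smoothVec v := by
  obtain ⟨f, hf, h⟩ := exists_act_GTSub_eq v hc z
  rw [h]
  exact smul_mem_smoothVec hf (genT_mem_smoothVec z)

theorem derAct_GTSub_DT (hv : S.IsCritical v) {c : U n} (hc : c ∈ GTSub n) (I : Finset (Fin t))
    (z : Shift n) : S.derAct hv c (S.DT I z) = S.dVec v I (act n c (genT z)) :=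
  S.derAct_DT hv (GTSub_le hc) I (act_GTSub_genT_mem v hc z)

theorem cGen_mem_GTSub {m : ℕ} (h1 : 1 ≤ m) (hm : m ≤ n) (k : ℕ) : cGen n m k ∈ GTSub n :=
  Algebra.subset_adjoin (Set.mem_biUnion (mem_Icc.mpr ⟨h1, hm⟩) (cGen_mem_Zsub n m k))

theorem derAct_cGen_DT (hv : S.IsCritical v) {m : ℕ} (h1 : 1 ≤ m) (hm : m ≤ n) (k : ℕ)
    (I : Finset (Fin t)) (z : Shift n) :
    S.derAct hv (cGen n m k) (S.DT I z) =
      ∑ J ∈ I.powerset, S.dVal v J (gamma m k (xTab z)) • S.DT (I \ J) z := by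
  rw [S.derAct_GTSub_DT hv (cGen_mem_GTSub h1 hm k), act_cGen n m hm,
    dVec_smul _ _ (gamma_mem_smooth v h1 hm k z) (genT_mem_smoothVec z)]
  simp only [dVec_genT]

theorem derAct_cGen_sub_pow_DT (hv : S.IsCritical v) {m : ℕ} (h1 : 1 ≤ m) (hm : m ≤ n) (k : ℕ)
    (I : Finset (Fin t)) (z : Shift n) :
    S.derAct hv ((cGen n m k - algebraMap ℂ (U n) (evalAt v (gamma m k (xTab z)))) ^ (I.card + 1))
      (S.DT I z) = 0 := by
  rw [map_pow]
  refine pow_apply_eq_zero (a := fun J => S.dVal v J (gamma m k (xTab z)))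
    (d := fun I => S.DT I z) (fun I => ?_) _ I (Nat.lt_succ_self _)
  -- The term with `J = ∅` is multiplication by the value of `γ` at `v`, which is exactly what is
  -- subtracted.
  rw [map_sub, LinearMap.sub_apply, S.derAct_cGen_DT hv h1 hm, AlgHom.commutes,
    Module.algebraMap_end_apply, ← add_sum_erase _ _ (empty_mem_powerset I), dVal_empty,
    sdiff_empty, add_sub_cancel_left]

end SingularPairs

end GT

end

theorem mainTheorem2 (n t : ℕ) (hn : 2 ≤ n) (S : GT.SingularPairs n t) (v : GT.Tab n ℂ)
    (hv : S.IsCritical v) :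
    -- the generic module over rational functions, and the module `V(T(v))`
    ∃ (ρgen : GT.gl n →ₗ⁅ℂ⁆ Module.End (GT.RatFun n) (GT.GenSpace n))
      (ρ : GT.gl n →ₗ⁅ℂ⁆ Module.End ℂ S.DSpace),
      GT.IsGenericAction ρgen ∧ GT.IsDerivativeAction S v ρgen ρ ∧
      -- `Γ` is `D^v`-invariant
      (∀ c ∈ GT.GTSub n, ∀ (I : Finset (Fin t)) (z : GT.Shift n),
        GT.IsSmoothVec v (UniversalEnvelopingAlgebra.lift ℂ ρgen c (GT.genT z)) ∧
        UniversalEnvelopingAlgebra.lift ℂ ρ c (S.DT I z) =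
          S.dVec v I (UniversalEnvelopingAlgebra.lift ℂ ρgen c (GT.genT z))) ∧
      -- the action of the generators `c_{ij}`
      (∀ i j : ℕ, 1 ≤ j → j ≤ i → i ≤ n → ∀ (I : Finset (Fin t)) (z : GT.Shift n),
        GT.IsSmooth v (GT.gamma i j (GT.xTab z)) ∧
        UniversalEnvelopingAlgebra.lift ℂ ρ (GT.cGen n i j) (S.DT I z) =
          ∑ J ∈ I.powerset, S.dVal v J (GT.gamma i j (GT.xTab z)) • S.DT (I \ J) z ∧
        UniversalEnvelopingAlgebra.lift ℂ ρ
          ((GT.cGen n i j - algebraMap ℂ (GT.U n) (GT.evalAt v (GT.gamma i j (GT.xTab z)))) ^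
            (I.card + 1)) (S.DT I z) = 0) :=
  ⟨GT.genRep n, S.derRep hv, GT.isGenericAction_genRep n, S.isDerivativeAction_derRep hv,
    fun _ hc I z => ⟨GT.SingularPairs.act_GTSub_genT_mem v hc z, S.derAct_GTSub_DT hv hc I z⟩,
    fun _ k h1 h2 h3 I z => ⟨GT.gamma_mem_smooth v (h1.trans h2) h3 k z,
      S.derAct_cGen_DT hv (h1.trans h2) h3 k I z,
      S.derAct_cGen_sub_pow_DT hv (h1.trans h2) h3 k I z⟩⟩
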